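/- **Setting.** The finite types are generated from the type $0$ of natural numbers by $\rho,\tau\mapsto\rho\to\tau$; write $1$ for $0\to0$. Terms are built by typed application from variables of all finite types and the constants $0$, $S$, $+$, $\cdot$, the combinators $\Pi_{\rho,\tau}$ and $\Sigma_{\delta,\rho,\tau}$, and the recursors $R_\sigma$ of type $0\to\sigma\to(\sigma\to0\to\sigma)\to\sigma$, for all finite types. Formulas are built from $\bot$ and equations $s=_0t$ between terms of type $0$ by $\land,\lor,\to$ and quantifiers over all finite types ($\lnot A$ is $A\to\bot$); for $\sigma=\rho_1\to\dots\to\rho_k\to0$, $s=_\sigma t$ abbreviates $\forall y_1^{\rho_1}\cdots\forall y_k^{\rho_k}\,(s\,y_1\cdots y_k=_0t\,y_1\cdots y_k)$. $\mathsf{E}\text{-}\mathsf{HA}^\omega$ is the theory over intuitionistic predicate logic whose axioms are the equality axioms for $=_0$; the usual axioms for $0,S,+,\cdot$; extensionality $x=_\rho y\to z(x)=_\tau z(y)$; the equations $\Pi xy=x$, $\Sigma xyz=xz(yz)$, $R_\sigma0yz=y$, $R_\sigma(Sn)yz=z(R_\sigma nyz)n$; and induction $A(0)\to(\forall n(A(n)\to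 A(n+1))\to\forall n\,A(n))$ for all formulas $A$. $\mathsf{E}\text{-}\mathsf{HA}^2$ is its restriction to the formulas in which all variables have type $0$ or $1$ and the only recursor is $R_0$; here $x,y,z,n$ in the axioms stand for arbitrary terms of the restricted language, and an asserted equation $s=_\tau t$ of higher type stands for all equations $s\,u_1\cdots u_k=_0t\,u_1\cdots u_k$ with terms $u_i$ of the restricted language. $\mathsf{QF}\text{-}\mathsf{AC}^{\rho,\tau}$ is the scheme $\forall x^\rho\exists y^\tau A_0(x,y)\to\exists Y^{\rho\to\tau}\forall x^\rho A_0(x,Y(x))$ for quantifier-free $A_0$, possibly with parameters. $\mathsf{RCA}^\omega$ is $\mathsf{E}\text{-}\mathsf{HA}^\omega$ plus $\mathsf{QF}\text{-}\mathsf{AC}^{1,0}$ and the law of the excluded middle. $\mathsf{RCA}$ is $\mathsf{E}\text{-}\mathsf{HA}^2$ plus $\mathsf{QF}\text{-}\mathsf{AC}^{0,0}$ and the law of the excluded middle, all schemes restricted to the language $\mathcal L(\mathsf{RCA})$ of $\mathsf{E}\text{-}\mathsf{HA}^2$. **Theorem.** For each sentence $\Phi$ in $\mathcal L(\mathsf{RCA})$,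 if $\mathsf{RCA}^\omega\vdash\Phi$ then $\mathsf{RCA}\vdash\Phi$. -/

import Mathlib

namespace FiniteType

/-- The finite types: `nat` is the type `0` of natural numbers, `ρ ⇾ τ` is the type of functions
from objects of type `ρ` to objects of type `τ`. -/
inductive Ty : Type
  | nat : Ty
  | arr : Ty → Ty → Ty

infixr:60 " ⇾ " => Ty.arr

/-- The type `1`, that is `0 → 0`. -/
abbrev Ty.one : Ty := Ty.nat ⇾ Ty.nat

/-- A language fragment: which types variables (free or bound) may have, and for which types `σ`
the recursor constant `R_σ` is available. -/
structure Fragment where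
  varTy : Ty → Prop
  recTy : Ty → Prop
  nat_mem : varTy Ty.nat

/-- All finite types: variables of every type and recursors of every type. -/
def Fragment.omega : Fragment where
  varTy _ := True
  recTy _ := True
  nat_mem := trivial

/-- The second order restriction: variables of types `0` and `1` only, and only the recursor
of type `0`. -/
def Fragment.second : Fragment where
  varTy σ := σ = Ty.nat ∨ σ = Ty.one
  recTy σ := σ = Ty.nat
  nat_mem := Or.inl rfl

/-- A variable context; the head of the list is the innermost variable (de Bruijn index `0`). -/
abbrev Ctx : Type := List Ty

/-- `Var Γ σ`: the variables of type `σ` in the context `Γ`. -/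
inductive Var : Ctx → Ty → Type
  | zero {Γ : Ctx} {σ : Ty} : Var (σ :: Γ) σ
  | succ {Γ : Ctx} {σ τ : Ty} (x : Var Γ σ) : Var (τ :: Γ) σ

/-- Typed terms: variables, the constants `0`, `S`, `+`, `·`, the projection combinators
`Π_{ρ,τ}` (`proj`), the substitution combinators `Σ_{δ,ρ,τ}` (`comb`), the recursors `R_σ`,
and application. -/
inductive Term (L : Fragment) (Γ : Ctx) : Ty → Type
  | var {σ : Ty} (h : L.varTy σ) (x : Var Γ σ) : Term L Γ σ
  | zero : Term L Γ Ty.nat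
  | succ : Term L Γ (Ty.nat ⇾ Ty.nat)
  | add : Term L Γ (Ty.nat ⇾ Ty.nat ⇾ Ty.nat)
  | mul : Term L Γ (Ty.nat ⇾ Ty.nat ⇾ Ty.nat)
  | proj (ρ τ : Ty) : Term L Γ (ρ ⇾ τ ⇾ ρ)
  | comb (δ ρ τ : Ty) : Term L Γ ((δ ⇾ ρ ⇾ τ) ⇾ (δ ⇾ ρ) ⇾ δ ⇾ τ)
  | recursor (σ : Ty) (h : L.recTy σ) : Term L Γ (Ty.nat ⇾ σ ⇾ (σ ⇾ Ty.nat ⇾ σ) ⇾ σ)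
  | app {σ τ : Ty} (s : Term L Γ (σ ⇾ τ)) (t : Term L Γ σ) : Term L Γ τ

/-- Formulas; the only primitive relation is equality between terms of type `0`. -/
inductive Formula (L : Fragment) : Ctx → Type
  | eq {Γ : Ctx} (s t : Term L Γ Ty.nat) : Formula L Γ
  | bot {Γ : Ctx} : Formula L Γ
  | and {Γ : Ctx} (A B : Formula L Γ) : Formula L Γ
  | or {Γ : Ctx} (A B : Formula L Γ) : Formula L Γ
  | imp {Γ : Ctx} (A B : Formula L Γ) : Formula L Γ
  | all {Γ : Ctx} (σ : Ty) (h : L.varTy σ) (A : Formula L (σ :: Γ)) : Formula L Γ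
  | ex {Γ : Ctx} (σ : Ty) (h : L.varTy σ) (A : Formula L (σ :: Γ)) : Formula L Γ

infix:50 " ≐ " => Formula.eq
infixr:30 " ⇒ " => Formula.imp

/-- Negation `¬A` is an abbreviation for `A → ⊥`. -/
abbrev Formula.neg {L : Fragment} {Γ : Ctx} (A : Formula L Γ) : Formula L Γ := A ⇒ Formula.bot

/-- Sentences are formulas without free variables. -/
abbrev Sentence (L : Fragment) : Type := Formula L []

/-! ### Renaming and substitution -/

/-- A renaming of variables. -/
abbrev Ren (Γ Δ : Ctx) : Type := ∀ ⦃σ : Ty⦄, Var Γ σ → Var Δ σ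

/-- A simultaneous substitution of terms for the variables of `Γ`. -/
abbrev Sub (L : Fragment) (Γ Δ : Ctx) : Type := ∀ ⦃σ : Ty⦄, L.varTy σ → Var Γ σ → Term L Δ σ

def Ren.lift {Γ Δ : Ctx} {ρ : Ty} (r : Ren Γ Δ) : Ren (ρ :: Γ) (ρ :: Δ)
  | _, Var.zero => Var.zero
  | _, Var.succ x => Var.succ (r x)

def Term.rename {L : Fragment} {Γ Δ : Ctx} (r : Ren Γ Δ) : {σ : Ty} → Term L Γ σ → Term L Δ σ
  | _, .var h x => .var h (r x)
  | _, .zero => .zero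
  | _, .succ => .succ
  | _, .add => .add
  | _, .mul => .mul
  | _, .proj ρ τ => .proj ρ τ
  | _, .comb δ ρ τ => .comb δ ρ τ
  | _, .recursor σ h => .recursor σ h
  | _, .app s t => .app (s.rename r) (t.rename r)

/-- Weakening of a term by one fresh variable. -/
abbrev Term.shift {L : Fragment} {Γ : Ctx} {ρ σ : Ty} (t : Term L Γ σ) : Term L (ρ :: Γ) σ :=
  t.rename (fun _ x => Var.succ x)

def Sub.lift {L : Fragment} {Γ Δ : Ctx} {ρ : Ty} (s : Sub L Γ Δ) : Sub L (ρ :: Γ) (ρ :: Δ)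
  | _, h, Var.zero => .var h Var.zero
  | _, h, Var.succ x => (s h x).shift

def Term.subst {L : Fragment} {Γ Δ : Ctx} (s : Sub L Γ Δ) : {σ : Ty} → Term L Γ σ → Term L Δ σ
  | _, .var h x => s h x
  | _, .zero => .zero
  | _, .succ => .succ
  | _, .add => .add
  | _, .mul => .mul
  | _, .proj ρ τ => .proj ρ τ
  | _, .comb δ ρ τ => .comb δ ρ τ
  | _, .recursor σ h => .recursor σ h
  | _, .app t u => .app (t.subst s) (u.subst s)

def Formula.rename {L : Fragment} : {Γ Δ : Ctx} → Ren Γ Δ → Formula L Γ → Formula L Δ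
  | _, _, r, .eq s t => .eq (s.rename r) (t.rename r)
  | _, _, _, .bot => .bot
  | _, _, r, .and A B => .and (A.rename r) (B.rename r)
  | _, _, r, .or A B => .or (A.rename r) (B.rename r)
  | _, _, r, .imp A B => .imp (A.rename r) (B.rename r)
  | _, _, r, .all σ h A => .all σ h (A.rename r.lift)
  | _, _, r, .ex σ h A => .ex σ h (A.rename r.lift)

/-- Weakening of a formula by one fresh variable. -/
abbrev Formula.shift {L : Fragment} {Γ : Ctx} {ρ : Ty} (A : Formula L Γ) : Formula L (ρ :: Γ) :=
  A.rename (fun _ x => Var.succ x)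

def Formula.subst {L : Fragment} : {Γ Δ : Ctx} → Sub L Γ Δ → Formula L Γ → Formula L Δ
  | _, _, s, .eq t u => .eq (t.subst s) (u.subst s)
  | _, _, _, .bot => .bot
  | _, _, s, .and A B => .and (A.subst s) (B.subst s)
  | _, _, s, .or A B => .or (A.subst s) (B.subst s)
  | _, _, s, .imp A B => .imp (A.subst s) (B.subst s)
  | _, _, s, .all σ h A => .all σ h (A.subst s.lift)
  | _, _, s, .ex σ h A => .ex σ h (A.subst s.lift)

/-- The substitution of `t` for the innermost variable. -/
def Sub.single {L : Fragment} {Γ : Ctx} {ρ : Ty} (t : Term L Γ ρ) : Sub L (ρ :: Γ) Γ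
  | _, _, Var.zero => t
  | _, h, Var.succ x => .var h x

/-- `A(t)`, for a formula `A` with a distinguished innermost variable. -/
abbrev Formula.inst {L : Fragment} {Γ : Ctx} {ρ : Ty} (A : Formula L (ρ :: Γ)) (t : Term L Γ ρ) :
    Formula L Γ :=
  A.subst (Sub.single t)

/-! ### Intuitionistic predicate calculus -/

/-- Intuitionistic natural deduction in all the sorts of `L`, from a set `T` of (possibly open)
axioms. `Derives T H A` says that `A` is derivable from the finitely many hypotheses `H`. -/
inductive Derives {L : Fragment} (T : ∀ Γ : Ctx, Set (Formula L Γ)) :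
    {Γ : Ctx} → List (Formula L Γ) → Formula L Γ → Prop
  | ax {Γ : Ctx} {H : List (Formula L Γ)} {A : Formula L Γ} : A ∈ T Γ → Derives T H A
  | hyp {Γ : Ctx} {H : List (Formula L Γ)} {A : Formula L Γ} : A ∈ H → Derives T H A
  | botE {Γ : Ctx} {H : List (Formula L Γ)} {A : Formula L Γ} :
      Derives T H .bot → Derives T H A
  | andI {Γ : Ctx} {H : List (Formula L Γ)} {A B : Formula L Γ} :
      Derives T H A → Derives T H B → Derives T H (.and A B)
  | andE₁ {Γ : Ctx} {H : List (Formula L Γ)} {A B : Formula L Γ} :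
      Derives T H (.and A B) → Derives T H A
  | andE₂ {Γ : Ctx} {H : List (Formula L Γ)} {A B : Formula L Γ} :
      Derives T H (.and A B) → Derives T H B
  | orI₁ {Γ : Ctx} {H : List (Formula L Γ)} {A B : Formula L Γ} :
      Derives T H A → Derives T H (.or A B)
  | orI₂ {Γ : Ctx} {H : List (Formula L Γ)} {A B : Formula L Γ} :
      Derives T H B → Derives T H (.or A B)
  | orE {Γ : Ctx} {H : List (Formula L Γ)} {A B C : Formula L Γ} :
      Derives T H (.or A B) → Derives T (A :: H) C → Derives T (B :: H) C → Derives T H C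
  | impI {Γ : Ctx} {H : List (Formula L Γ)} {A B : Formula L Γ} :
      Derives T (A :: H) B → Derives T H (A ⇒ B)
  | impE {Γ : Ctx} {H : List (Formula L Γ)} {A B : Formula L Γ} :
      Derives T H (A ⇒ B) → Derives T H A → Derives T H B
  | allI {Γ : Ctx} {H : List (Formula L Γ)} {σ : Ty} {h : L.varTy σ} {A : Formula L (σ :: Γ)} :
      Derives T (H.map Formula.shift) A → Derives T H (.all σ h A)
  | allE {Γ : Ctx} {H : List (Formula L Γ)} {σ : Ty} {h : L.varTy σ} {A : Formula L (σ :: Γ)}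
      (t : Term L Γ σ) : Derives T H (.all σ h A) → Derives T H (A.inst t)
  | exI {Γ : Ctx} {H : List (Formula L Γ)} {σ : Ty} {h : L.varTy σ} {A : Formula L (σ :: Γ)}
      (t : Term L Γ σ) : Derives T H (A.inst t) → Derives T H (.ex σ h A)
  | exE {Γ : Ctx} {H : List (Formula L Γ)} {σ : Ty} {h : L.varTy σ} {A : Formula L (σ :: Γ)}
      {B : Formula L Γ} :
      Derives T H (.ex σ h A) → Derives T (A :: H.map Formula.shift) B.shift → Derives T H B

/-! ### Higher type equations -/

/-- All argument types of `σ = ρ₁ → ⋯ → ρₖ → 0` are types of variables of `L`; exactly then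
the formula `s =_σ t` can be written in the fragment `L`. -/
def Ty.ArgsIn (L : Fragment) : Ty → Prop
  | .nat => True
  | .arr ρ τ => L.varTy ρ ∧ Ty.ArgsIn L τ

/-- The formula `s =_σ t`: pointwise equality,
`∀ y₁ ⋯ yₖ, s y₁ ⋯ yₖ =₀ t y₁ ⋯ yₖ`. -/
def Formula.eqAt {L : Fragment} :
    {Γ : Ctx} → (σ : Ty) → Ty.ArgsIn L σ → Term L Γ σ → Term L Γ σ → Formula L Γ
  | _, .nat, _, s, t => s ≐ t
  | _, .arr ρ τ, h, s, t =>
      .all ρ h.1 (Formula.eqAt τ h.2 (.app s.shift (.var h.1 .zero)) (.app t.shift (.var h.1 .zero)))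

/-- A list of argument terms to which a term of type `σ` can be applied to yield type `0`. -/
inductive Spine (L : Fragment) (Γ : Ctx) : Ty → Type
  | nil : Spine L Γ Ty.nat
  | cons {ρ τ : Ty} (t : Term L Γ ρ) (u : Spine L Γ τ) : Spine L Γ (ρ ⇾ τ)

/-- `t u₁ ⋯ uₖ`, of type `0`. -/
def Term.apps {L : Fragment} {Γ : Ctx} : {σ : Ty} → Term L Γ σ → Spine L Γ σ → Term L Γ Ty.nat
  | _, t, .nil => t
  | _, t, .cons a u => Term.apps (.app t a) u

/-! ### Arithmetic in finite types -/

section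
variable {L : Fragment} {Γ : Ctx}

/-- The term `S t`. -/
abbrev Term.s (t : Term L Γ Ty.nat) : Term L Γ Ty.nat := .app .succ t

/-- The term `s + t`. -/
abbrev Term.plus (s t : Term L Γ Ty.nat) : Term L Γ Ty.nat := .app (.app .add s) t

/-- The term `s · t`. -/
abbrev Term.times (s t : Term L Γ Ty.nat) : Term L Γ Ty.nat := .app (.app .mul s) t

/-- The term `R_σ n y z`. -/
abbrev Term.recAt {σ : Ty} (h : L.recTy σ) (n : Term L Γ Ty.nat) (y : Term L Γ σ)
    (z : Term L Γ (σ ⇾ Ty.nat ⇾ σ)) : Term L Γ σ :=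
  .app (.app (.app (.recursor σ h) n) y) z

/-- The substitution that replaces the innermost variable `n` by `S n`. -/
def Sub.step : Sub L (Ty.nat :: Γ) (Ty.nat :: Γ)
  | _, h, Var.zero => .app .succ (.var h Var.zero)
  | _, h, Var.succ x => .var h (Var.succ x)

/-- For `A(x, y)` in the context `y, x, Γ`: the substitution of `Y x` for `y`, with values in the
context `x, Y, Γ`. -/
def Sub.choice {ρ τ : Ty} (hρ : L.varTy ρ) (hY : L.varTy (ρ ⇾ τ)) :
    Sub L (τ :: ρ :: Γ) (ρ :: (ρ ⇾ τ) :: Γ)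
  | _, _, Var.zero => .app (.var hY (Var.succ Var.zero)) (.var hρ Var.zero)
  | _, h, Var.succ Var.zero => .var h Var.zero
  | _, h, Var.succ (Var.succ x) => .var h (Var.succ (Var.succ x))

end

/-- The non-logical axioms of extensional arithmetic with full induction in the fragment `L`.
Axioms are open, the letters in them ranging over all terms and formulas of the fragment.
An equation `s =_τ t` that is asserted (the defining equations of `Π`, `Σ`, `R_σ` and the
conclusion of the extensionality scheme) is given by all its instances `s u₁ ⋯ uₖ =₀ t u₁ ⋯ uₖ`,
so that it makes sense also when the variables needed to write `s =_τ t` are not available;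
when they are, this amounts to the same as asserting the formula `s =_τ t`. -/
inductive EHA (L : Fragment) : (Γ : Ctx) → Formula L Γ → Prop
  | eq_refl {Γ : Ctx} (t : Term L Γ .nat) : EHA L Γ (t ≐ t)
  | eq_symm {Γ : Ctx} (s t : Term L Γ .nat) : EHA L Γ (s ≐ t ⇒ t ≐ s)
  | eq_trans {Γ : Ctx} (s t u : Term L Γ .nat) : EHA L Γ (s ≐ t ⇒ t ≐ u ⇒ s ≐ u)
  | succ_ne_zero {Γ : Ctx} (t : Term L Γ .nat) : EHA L Γ (t.s ≐ .zero).neg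
  | succ_inj {Γ : Ctx} (s t : Term L Γ .nat) : EHA L Γ (s.s ≐ t.s ⇒ s ≐ t)
  | add_zero {Γ : Ctx} (s : Term L Γ .nat) : EHA L Γ (s.plus .zero ≐ s)
  | add_succ {Γ : Ctx} (s t : Term L Γ .nat) : EHA L Γ (s.plus t.s ≐ (s.plus t).s)
  | mul_zero {Γ : Ctx} (s : Term L Γ .nat) : EHA L Γ (s.times .zero ≐ .zero)
  | mul_succ {Γ : Ctx} (s t : Term L Γ .nat) : EHA L Γ (s.times t.s ≐ (s.times t).plus s)
  /-- `x =_ρ y → z x =_τ z y` -/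
  | ext {Γ : Ctx} {ρ τ : Ty} (h : ρ.ArgsIn L) (x y : Term L Γ ρ) (z : Term L Γ (ρ ⇾ τ))
      (u : Spine L Γ τ) :
      EHA L Γ (Formula.eqAt ρ h x y ⇒ (Term.app z x).apps u ≐ (Term.app z y).apps u)
  /-- `Π x y =_ρ x` -/
  | proj {Γ : Ctx} {ρ τ : Ty} (x : Term L Γ ρ) (y : Term L Γ τ) (u : Spine L Γ ρ) :
      EHA L Γ (Term.apps (.app (.app (.proj ρ τ) x) y) u ≐ x.apps u)
  /-- `Σ x y z =_τ x z (y z)` -/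
  | comb {Γ : Ctx} {δ ρ τ : Ty} (x : Term L Γ (δ ⇾ ρ ⇾ τ)) (y : Term L Γ (δ ⇾ ρ))
      (z : Term L Γ δ) (u : Spine L Γ τ) :
      EHA L Γ (Term.apps (.app (.app (.app (.comb δ ρ τ) x) y) z) u ≐
        Term.apps (.app (.app x z) (.app y z)) u)
  /-- `R_σ 0 y z =_σ y` -/
  | rec_zero {Γ : Ctx} {σ : Ty} (h : L.recTy σ) (y : Term L Γ σ) (z : Term L Γ (σ ⇾ .nat ⇾ σ))
      (u : Spine L Γ σ) :
      EHA L Γ ((Term.recAt h .zero y z).apps u ≐ y.apps u)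
  /-- `R_σ (S n) y z =_σ z (R_σ n y z) n` -/
  | rec_succ {Γ : Ctx} {σ : Ty} (h : L.recTy σ) (n : Term L Γ .nat) (y : Term L Γ σ)
      (z : Term L Γ (σ ⇾ .nat ⇾ σ)) (u : Spine L Γ σ) :
      EHA L Γ ((Term.recAt h n.s y z).apps u ≐
        Term.apps (.app (.app z (Term.recAt h n y z)) n) u)
  /-- `A(0) → (∀ n, A(n) → A(n + 1)) → ∀ n, A(n)` -/
  | induction {Γ : Ctx} (A : Formula L (.nat :: Γ)) :
      EHA L Γ (A.inst .zero ⇒ .all .nat L.nat_mem (A ⇒ A.subst Sub.step) ⇒ .all .nat L.nat_mem A)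

/-- Quantifier-free formulas. -/
def Formula.QF {L : Fragment} : {Γ : Ctx} → Formula L Γ → Prop
  | _, .eq _ _ => True
  | _, .bot => True
  | _, .and A B => A.QF ∧ B.QF
  | _, .or A B => A.QF ∧ B.QF
  | _, .imp A B => A.QF ∧ B.QF
  | _, .all _ _ _ => False
  | _, .ex _ _ _ => False

/-- The scheme `QF-AC^{ρ,τ}`: `∀ x ∃ y, A(x, y) → ∃ Y ∀ x, A(x, Y x)` for quantifier-free `A`
with arbitrary parameters. -/
inductive QFAC (L : Fragment) (ρ τ : Ty) : (Γ : Ctx) → Formula L Γ → Prop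
  | choice {Γ : Ctx} (hρ : L.varTy ρ) (hτ : L.varTy τ) (hY : L.varTy (ρ ⇾ τ))
      (A : Formula L (τ :: ρ :: Γ)) (hA : A.QF) :
      QFAC L ρ τ Γ (.all ρ hρ (.ex τ hτ A) ⇒
        .ex (ρ ⇾ τ) hY (.all ρ hρ (A.subst (Sub.choice hρ hY))))

/-- The law of the excluded middle. -/
inductive LEM (L : Fragment) : (Γ : Ctx) → Formula L Γ → Prop
  | em {Γ : Ctx} (A : Formula L Γ) : LEM L Γ (.or A A.neg)

/-- The axioms of `RCA^ω`: extensional arithmetic in all finite types with full induction,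
`QF-AC^{1,0}`, and excluded middle. -/
def RCAomega (Γ : Ctx) : Set (Formula Fragment.omega Γ) :=
  {A | EHA .omega Γ A ∨ QFAC .omega .one .nat Γ A ∨ LEM .omega Γ A}

/-- The axioms of `RCA`: the second order restriction of extensional arithmetic with full
induction, `QF-AC^{0,0}`, and excluded middle. -/
def RCA (Γ : Ctx) : Set (Formula Fragment.second Γ) :=
  {A | EHA .second Γ A ∨ QFAC .second .nat .nat Γ A ∨ LEM .second Γ A}

/-- `T ⊢ Φ` for a sentence `Φ`. -/
def Provable {L : Fragment} (T : ∀ Γ : Ctx, Set (Formula L Γ)) (Φ : Sentence L) : Prop :=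
  Derives T [] Φ

/-! ### The language of `RCA` as a part of the language of `RCA^ω` -/

/-- A term of a fragment, read as a term of the full language. -/
def Term.toOmega {L : Fragment} {Γ : Ctx} : {σ : Ty} → Term L Γ σ → Term Fragment.omega Γ σ
  | _, .var _ x => .var trivial x
  | _, .zero => .zero
  | _, .succ => .succ
  | _, .add => .add
  | _, .mul => .mul
  | _, .proj ρ τ => .proj ρ τ
  | _, .comb δ ρ τ => .comb δ ρ τ
  | _, .recursor σ _ => .recursor σ trivial
  | _, .app s t => .app s.toOmega t.toOmega

/-- A formula of a fragment, read as a formula of the full language. -/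
def Formula.toOmega {L : Fragment} : {Γ : Ctx} → Formula L Γ → Formula Fragment.omega Γ
  | _, .eq s t => .eq s.toOmega t.toOmega
  | _, .bot => .bot
  | _, .and A B => .and A.toOmega B.toOmega
  | _, .or A B => .or A.toOmega B.toOmega
  | _, .imp A B => .imp A.toOmega B.toOmega
  | _, .all σ _ A => .all σ trivial A.toOmega
  | _, .ex σ _ A => .ex σ trivial A.toOmega

end FiniteType

set_option linter.unusedSectionVars false

namespace FiniteType

/-! ### Renaming and substitution commute -/

section Substitution
variable {L : Fragment}

/-! The argument is model-theoretic. If `RCA` does not prove `Φ`, a Henkin construction gives a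
structure `M` with `IsModel M` in which `Φ` fails (`exists_model_of_not_provable`). Types above 1
have no variables in `RCA`; their objects in `M` are germs of terms modulo hereditary extensional
equality. From `M` a model `extModel M` of `RCAomega` is built whose objects of types 0 and 1
correspond to those of `M`, so `Φ` fails there too, and soundness shows that `RCAomega` does not
prove `Φ`.

To reach higher types, work inside the possibly nonstandard `M` with the sets that are computably
enumerable relative to some type 1 object. They form a graph algebra: `n ∈ A ⋆ B` iff `pair n D ∈ A`
for some coded finite set `D` contained in `B`. It has combinators `K` and `S`, hence fixed points,
a recursor serving all types, and unbounded search. Numbers are singletons, and `extModel M`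
consists of the elements that hereditarily respect extensional equality.

Three facts carry the proof. Every enumerable set has a type 1 index, so satisfaction of each fixed
formula of the full language is definable in `M` (`DefEnv.satExt`), and full induction in `M` yields
full induction in `extModel M`. A quantifier-free formula has a characteristic element in the
algebra, and searching from 0 finds the least witness; that witness depends only on the extensional
class of the argument, so the search is a legitimate object of type 2 and `QF-AC^{1,0}` holds
(`sat_choice`). Finally, an enumerable set that sends singletons to singletons has an enumerable
graph, from which `QF-AC^{0,0}` in `M` extracts a type 1 object (`exists_rel_left`); a logical
relation extends the correspondence to terms and sentences (`sat_toOmega`). -/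

theorem Term.rename_rename {Γ Δ Θ : Ctx} (r : Ren Γ Δ) (r' : Ren Δ Θ) {σ : Ty} (t : Term L Γ σ) :
    (t.rename r).rename r' = t.rename (fun _ x => r' (r x)) := by
  induction t <;> simp_all only [Term.rename]

theorem Term.rename_subst {Γ Δ Θ : Ctx} (s : Sub L Γ Δ) (r : Ren Δ Θ) {σ : Ty} (t : Term L Γ σ) :
    (t.subst s).rename r = t.subst (fun _ h x => (s h x).rename r) := by
  induction t <;> simp_all only [Term.rename, Term.subst]

theorem Term.subst_rename {Γ Δ Θ : Ctx} (r : Ren Γ Δ) (s : Sub L Δ Θ) {σ : Ty} (t : Term L Γ σ) :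
    (t.rename r).subst s = t.subst (fun _ h x => s h (r x)) := by
  induction t <;> simp_all only [Term.rename, Term.subst]

theorem Term.subst_subst {Γ Δ Θ : Ctx} (s : Sub L Γ Δ) (s' : Sub L Δ Θ) {σ : Ty}
    (t : Term L Γ σ) : (t.subst s).subst s' = t.subst (fun _ h x => (s h x).subst s') := by
  induction t <;> simp_all only [Term.subst]

theorem Term.subst_var {Γ : Ctx} {σ : Ty} (t : Term L Γ σ) :
    t.subst (fun _ h x => .var h x) = t := by
  induction t <;> simp_all only [Term.subst]

theorem Ren.lift_comp {Γ Δ Θ : Ctx} {ρ : Ty} (r : Ren Γ Δ) (r' : Ren Δ Θ) :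
    (fun _ x => r'.lift (r.lift x) : Ren (ρ :: Γ) (ρ :: Θ)) = Ren.lift (fun _ x => r' (r x)) := by
  funext σ x
  cases x <;> rfl

theorem Sub.lift_rename {Γ Δ Θ : Ctx} {ρ : Ty} (s : Sub L Γ Δ) (r : Ren Δ Θ) :
    (fun _ h x => (s.lift h x).rename r.lift : Sub L (ρ :: Γ) (ρ :: Θ)) =
      Sub.lift (fun _ h x => (s h x).rename r) := by
  funext σ h x
  cases x with
  | zero => rfl
  | succ x => simp [Sub.lift, Term.rename_rename, Ren.lift]

theorem Sub.rename_lift {Γ Δ Θ : Ctx} {ρ : Ty} (r : Ren Γ Δ) (s : Sub L Δ Θ) :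
    (fun _ h x => s.lift h (r.lift x) : Sub L (ρ :: Γ) (ρ :: Θ)) =
      Sub.lift (fun _ h x => s h (r x)) := by
  funext σ h x
  cases x <;> rfl

theorem Sub.lift_subst {Γ Δ Θ : Ctx} {ρ : Ty} (s : Sub L Γ Δ) (s' : Sub L Δ Θ) :
    (fun _ h x => (s.lift h x).subst s'.lift : Sub L (ρ :: Γ) (ρ :: Θ)) =
      Sub.lift (fun _ h x => (s h x).subst s') := by
  funext σ h x
  cases x with
  | zero => rfl
  | succ x => simp [Sub.lift, Term.subst_rename, Term.rename_subst]

theorem Sub.lift_var {Γ : Ctx} {ρ : Ty} :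
    Sub.lift (fun _ h x => .var h x : Sub L Γ Γ) = (fun _ h x => .var h x : Sub L (ρ :: Γ) _) := by
  funext σ h x
  cases x <;> rfl

theorem Formula.rename_rename {Γ Δ Θ : Ctx} (r : Ren Γ Δ) (r' : Ren Δ Θ) (A : Formula L Γ) :
    (A.rename r).rename r' = A.rename (fun _ x => r' (r x)) := by
  induction A generalizing Δ Θ <;>
    simp_all only [Formula.rename, Term.rename_rename, Ren.lift_comp]

theorem Formula.rename_subst {Γ Δ Θ : Ctx} (s : Sub L Γ Δ) (r : Ren Δ Θ) (A : Formula L Γ) :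
    (A.subst s).rename r = A.subst (fun _ h x => (s h x).rename r) := by
  induction A generalizing Δ Θ <;>
    simp_all only [Formula.rename, Formula.subst, Term.rename_subst, Sub.lift_rename]

theorem Formula.subst_rename {Γ Δ Θ : Ctx} (r : Ren Γ Δ) (s : Sub L Δ Θ) (A : Formula L Γ) :
    (A.rename r).subst s = A.subst (fun _ h x => s h (r x)) := by
  induction A generalizing Δ Θ <;>
    simp_all only [Formula.rename, Formula.subst, Term.subst_rename, Sub.rename_lift]

theorem Formula.subst_subst {Γ Δ Θ : Ctx} (s : Sub L Γ Δ) (s' : Sub L Δ Θ) (A : Formula L Γ) :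
    (A.subst s).subst s' = A.subst (fun _ h x => (s h x).subst s') := by
  induction A generalizing Δ Θ <;>
    simp_all only [Formula.subst, Term.subst_subst, Sub.lift_subst]

theorem Formula.subst_var {Γ : Ctx} (A : Formula L Γ) :
    A.subst (fun _ h x => .var h x) = A := by
  induction A <;> simp_all only [Formula.subst, Term.subst_var, Sub.lift_var]

theorem Formula.inst_rename {Γ Δ : Ctx} {ρ : Ty} (A : Formula L (ρ :: Γ)) (t : Term L Γ ρ)
    (r : Ren Γ Δ) : (A.inst t).rename r = (A.rename r.lift).inst (t.rename r) := by
  rw [Formula.inst, Formula.inst, Formula.rename_subst, Formula.subst_rename]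
  congr 1
  funext σ h x
  cases x <;> rfl

theorem Formula.shift_rename_lift {Γ Δ : Ctx} {ρ : Ty} (A : Formula L Γ) (r : Ren Γ Δ) :
    (A.shift (ρ := ρ)).rename r.lift = (A.rename r).shift := by
  simp only [Formula.rename_rename, Formula.shift, Ren.lift]

theorem Term.shift_rename_lift {Γ Δ : Ctx} {ρ σ : Ty} (t : Term L Γ σ) (r : Ren Γ Δ) :
    (t.shift (ρ := ρ)).rename r.lift = (t.rename r).shift := by
  simp only [Term.rename_rename, Term.shift, Ren.lift]

theorem Term.shift_subst_single {Γ : Ctx} {ρ σ : Ty} (s : Term L Γ σ) (t : Term L Γ ρ) :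
    (s.shift (ρ := ρ)).subst (Sub.single t) = s := by
  rw [Term.subst_rename]
  exact Term.subst_var s

/-- This lets an eigenvariable act as its own witness, both in natural deduction and for the fresh
variables of the Henkin construction. -/
theorem Formula.rename_lift_inst_zero {Γ : Ctx} {ρ : Ty} (h : L.varTy ρ) (A : Formula L (ρ :: Γ)) :
    (A.rename (Ren.lift (fun _ x => Var.succ x))).inst (.var h Var.zero) = A := by
  rw [Formula.inst, Formula.subst_rename]
  convert Formula.subst_var A using 2
  funext σ h x
  cases x <;> rfl

/-- Extension of a substitution by a term for the innermost variable. -/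
def Sub.cons {Γ Δ : Ctx} {ρ : Ty} (t : Term L Δ ρ) (s : Sub L Γ Δ) : Sub L (ρ :: Γ) Δ
  | _, _, Var.zero => t
  | _, h, Var.succ x => s h x

theorem Formula.subst_lift_inst {Γ Δ : Ctx} {ρ : Ty} (A : Formula L (ρ :: Γ)) (s : Sub L Γ Δ)
    (t : Term L Δ ρ) : (A.subst s.lift).inst t = A.subst (Sub.cons t s) := by
  rw [Formula.inst, Formula.subst_subst]
  congr 1
  funext σ h x
  cases x with
  | zero => rfl
  | succ x => exact Term.shift_subst_single _ _

/-! ### The axioms are closed under renaming -/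

/-- Renaming of a list of arguments. -/
def Spine.rename {Γ Δ : Ctx} (r : Ren Γ Δ) : {σ : Ty} → Spine L Γ σ → Spine L Δ σ
  | _, .nil => .nil
  | _, .cons t u => .cons (t.rename r) (u.rename r)

theorem Term.apps_rename {Γ Δ : Ctx} (r : Ren Γ Δ) {σ : Ty} (t : Term L Γ σ) (u : Spine L Γ σ) :
    (t.apps u).rename r = (t.rename r).apps (u.rename r) := by
  induction u with
  | nil => rfl
  | cons a u ih => exact ih _

theorem Formula.eqAt_rename {Γ Δ : Ctx} (r : Ren Γ Δ) (σ : Ty) (h : σ.ArgsIn L)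
    (s t : Term L Γ σ) :
    (Formula.eqAt σ h s t).rename r = Formula.eqAt σ h (s.rename r) (t.rename r) := by
  induction σ generalizing Γ Δ with
  | nat => rfl
  | arr ρ τ _ ih =>
    simp only [Formula.eqAt, Formula.rename, ih, Term.rename, Term.shift_rename_lift]
    rfl

theorem Formula.QF.rename {Γ Δ : Ctx} (r : Ren Γ Δ) {A : Formula L Γ} (h : A.QF) :
    (A.rename r).QF := by
  induction A generalizing Δ <;> simp_all only [Formula.QF, Formula.rename, and_self]

theorem Formula.step_rename {Γ Δ : Ctx} (r : Ren Γ Δ) (A : Formula L (.nat :: Γ)) :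
    (A.subst Sub.step).rename r.lift = (A.rename r.lift).subst Sub.step := by
  rw [Formula.rename_subst, Formula.subst_rename]
  congr 1
  funext σ h x
  cases x <;> rfl

theorem Formula.choice_rename {Γ Δ : Ctx} (r : Ren Γ Δ) {ρ τ : Ty} (hρ : L.varTy ρ)
    (hY : L.varTy (ρ ⇾ τ)) (A : Formula L (τ :: ρ :: Γ)) :
    (A.subst (Sub.choice hρ hY)).rename r.lift.lift =
      (A.rename r.lift.lift).subst (Sub.choice hρ hY) := by
  rw [Formula.rename_subst, Formula.subst_rename]
  congr 1
  funext σ h x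
  cases x with
  | zero => rfl
  | succ x => cases x <;> rfl

theorem EHA.rename {Γ Δ : Ctx} (r : Ren Γ Δ) {A : Formula L Γ} (h : EHA L Γ A) :
    EHA L Δ (A.rename r) := by
  cases h with
  | eq_refl t => exact .eq_refl _
  | eq_symm s t => exact .eq_symm _ _
  | eq_trans s t u => exact .eq_trans _ _ _
  | succ_ne_zero t => exact .succ_ne_zero _
  | succ_inj s t => exact .succ_inj _ _
  | add_zero s => exact .add_zero _
  | add_succ s t => exact .add_succ _ _
  | mul_zero s => exact .mul_zero _
  | mul_succ s t => exact .mul_succ _ _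
  | ext h x y z u =>
    simp only [Formula.rename, Formula.eqAt_rename, Term.apps_rename]
    exact .ext h _ _ _ _
  | proj x y u =>
    simp only [Formula.rename, Term.apps_rename]
    exact .proj _ _ _
  | comb x y z u =>
    simp only [Formula.rename, Term.apps_rename]
    exact .comb _ _ _ _
  | rec_zero h y z u =>
    simp only [Formula.rename, Term.apps_rename]
    exact .rec_zero h _ _ _
  | rec_succ h n y z u =>
    simp only [Formula.rename, Term.apps_rename]
    exact .rec_succ h _ _ _ _
  | induction A =>
    simp only [Formula.rename, Formula.inst_rename, Formula.step_rename]
    exact .induction _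

theorem QFAC.rename {Γ Δ : Ctx} (r : Ren Γ Δ) {ρ τ : Ty} {A : Formula L Γ} (h : QFAC L ρ τ Γ A) :
    QFAC L ρ τ Δ (A.rename r) := by
  cases h with
  | choice hρ hτ hY A hA =>
    simp only [Formula.rename, Formula.choice_rename]
    exact .choice hρ hτ hY _ (hA.rename _)

theorem LEM.rename {Γ Δ : Ctx} (r : Ren Γ Δ) {A : Formula L Γ} (h : LEM L Γ A) :
    LEM L Δ (A.rename r) := by
  cases h with
  | em A => exact .em _

theorem RCA.rename {Γ Δ : Ctx} (r : Ren Γ Δ) {A : Formula .second Γ} (h : A ∈ RCA Γ) :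
    A.rename r ∈ RCA Δ := by
  rcases h with h | h | h
  · exact .inl (h.rename r)
  · exact .inr (.inl (h.rename r))
  · exact .inr (.inr (h.rename r))

/-! ### Derivations -/

variable {T : ∀ Γ : Ctx, Set (Formula L Γ)}

/-- Derivations have to survive the addition of a fresh variable when passing to the next Henkin
stage; that is the instance used. -/
theorem Derives.rename (hT : ∀ {Γ Δ : Ctx} (r : Ren Γ Δ) {A}, A ∈ T Γ → A.rename r ∈ T Δ)
    {Γ Δ : Ctx} (r : Ren Γ Δ) {H : List (Formula L Γ)} {A : Formula L Γ} (d : Derives T H A) :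
    Derives T (H.map (Formula.rename r)) (A.rename r) := by
  -- The eigenvariable rules shift all hypotheses, so renaming under the binder must commute with
  -- that shift.
  have key : ∀ {Γ Δ : Ctx} {ρ : Ty} (r : Ren Γ Δ) (H : List (Formula L Γ)),
      (H.map (Formula.shift (ρ := ρ))).map (Formula.rename r.lift) =
        (H.map (Formula.rename r)).map Formula.shift := by
    intro Γ Δ ρ r H
    simp only [List.map_map]
    exact List.map_congr_left fun A _ => Formula.shift_rename_lift A r
  induction d generalizing Δ with
  | ax h => exact .ax (hT r h)
  | hyp h => exact .hyp (List.mem_map_of_mem h)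
  | botE _ ih => exact .botE (ih r)
  | andI _ _ ih₁ ih₂ => exact .andI (ih₁ r) (ih₂ r)
  | andE₁ _ ih => exact .andE₁ (ih r)
  | andE₂ _ ih => exact .andE₂ (ih r)
  | orI₁ _ ih => exact .orI₁ (ih r)
  | orI₂ _ ih => exact .orI₂ (ih r)
  | orE _ _ _ ih ih₁ ih₂ => exact .orE (ih r) (ih₁ r) (ih₂ r)
  | impI _ ih => exact .impI (ih r)
  | impE _ _ ih₁ ih₂ => exact .impE (ih₁ r) (ih₂ r)
  | allI _ ih =>
    refine .allI ?_
    rw [← key]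
    exact ih r.lift
  | allE t _ ih =>
    rw [Formula.inst_rename]
    exact .allE _ (ih r)
  | exI t _ ih =>
    refine .exI (t.rename r) ?_
    rw [← Formula.inst_rename]
    exact ih r
  | exE _ _ ih ih₁ =>
    refine .exE (ih r) ?_
    have := ih₁ r.lift
    rwa [List.map_cons, key, Formula.shift_rename_lift] at this

theorem Derives.weaken {Γ : Ctx} {H K : List (Formula L Γ)} {A : Formula L Γ}
    (d : Derives T H A) (hK : H ⊆ K) : Derives T K A := by
  induction d with
  | ax h => exact .ax h
  | hyp h => exact .hyp (hK h)
  | botE _ ih => exact .botE (ih hK)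
  | andI _ _ ih₁ ih₂ => exact .andI (ih₁ hK) (ih₂ hK)
  | andE₁ _ ih => exact .andE₁ (ih hK)
  | andE₂ _ ih => exact .andE₂ (ih hK)
  | orI₁ _ ih => exact .orI₁ (ih hK)
  | orI₂ _ ih => exact .orI₂ (ih hK)
  | orE _ _ _ ih ih₁ ih₂ =>
    exact .orE (ih hK) (ih₁ (List.cons_subset_cons _ hK)) (ih₂ (List.cons_subset_cons _ hK))
  | impI _ ih => exact .impI (ih (List.cons_subset_cons _ hK))
  | impE _ _ ih₁ ih₂ => exact .impE (ih₁ hK) (ih₂ hK)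
  | allI _ ih => exact .allI (ih (List.map_subset _ hK))
  | allE t _ ih => exact .allE t (ih hK)
  | exI t _ ih => exact .exI t (ih hK)
  | exE _ _ ih ih₁ =>
    exact .exE (ih hK) (ih₁ (List.cons_subset_cons _ (List.map_subset _ hK)))

theorem Derives.head {Γ : Ctx} {H : List (Formula L Γ)} {A : Formula L Γ} :
    Derives T (A :: H) A := .hyp List.mem_cons_self

theorem Derives.wk {Γ : Ctx} {H : List (Formula L Γ)} {A B : Formula L Γ} (d : Derives T H A) :
    Derives T (B :: H) A := d.weaken (List.subset_cons_self _ _)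

end Substitution

/-! ### Classical reasoning in `RCA`. -/

section Classical

theorem Derives.lem {Γ : Ctx} {H : List (Formula .second Γ)} (A : Formula .second Γ) :
    Derives RCA H (.or A A.neg) := .ax (.inr (.inr (.em A)))

theorem Derives.eha {Γ : Ctx} {H : List (Formula .second Γ)} {A : Formula .second Γ}
    (h : EHA .second Γ A) : Derives RCA H A := .ax (.inl h)

theorem Derives.byContra {Γ : Ctx} {H : List (Formula .second Γ)} {A : Formula .second Γ}
    (d : Derives RCA (A.neg :: H) .bot) : Derives RCA H A :=
  .orE (.lem A) .head (.botE d)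

theorem Derives.shift {Γ : Ctx} {ρ : Ty} {H : List (Formula .second Γ)} {A : Formula .second Γ}
    (d : Derives RCA H A) :
    Derives RCA (H.map (Formula.shift (ρ := ρ))) A.shift :=
  d.rename (fun r _ h => RCA.rename r h) _

/-- Assume `¬∃¬A`. For a fresh variable, `¬A` would make that variable a witness of `∃¬A`; so `A`
holds of it, and generalising contradicts `¬∀A`. -/
theorem Derives.ex_neg_of_neg_all {Γ : Ctx} {H : List (Formula .second Γ)} {σ : Ty}
    {h : Fragment.second.varTy σ} {A : Formula .second (σ :: Γ)}
    (d : Derives RCA H (Formula.all σ h A).neg) : Derives RCA H (.ex σ h A.neg) := by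
  refine .byContra (.impE d.wk (.allI (.byContra ?_)))
  refine .impE (A := (Formula.ex σ h A.neg).shift) (.hyp (by simp [Formula.rename, Formula.shift])) ?_
  refine .exI (.var h .zero) ?_
  have := Formula.rename_lift_inst_zero h A.neg
  simp only [Formula.inst] at this ⊢
  rw [this]
  exact .head

/-- A closed term of every type. -/
def Term.default {L : Fragment} {Γ : Ctx} : (σ : Ty) → Term L Γ σ
  | .nat => .zero
  | .arr ρ τ => .app (.proj τ ρ) (Term.default τ)

end Classical

end FiniteType

namespace FiniteType

/-! ### There are only countably many formulas in a given context -/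

/-- A numerical code of a type. -/
def Ty.code : Ty → ℕ
  | .nat => 0
  | .arr ρ τ => Nat.pair ρ.code τ.code + 1

theorem Ty.code_injective : Function.Injective Ty.code := by
  intro σ
  induction σ with
  | nat => intro τ h; cases τ <;> simp_all [Ty.code]
  | arr ρ τ ih₁ ih₂ =>
    intro σ h
    cases σ with
    | nat => simp [Ty.code] at h
    | arr ρ' τ' =>
      simp only [Ty.code, Nat.add_right_cancel_iff, Nat.pair_eq_pair] at h
      rw [ih₁ h.1, ih₂ h.2]

/-- The de Bruijn index of a variable. -/
def Var.code : {Γ : Ctx} → {σ : Ty} → Var Γ σ → ℕ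
  | _, _, .zero => 0
  | _, _, .succ x => x.code + 1

/-- The code omits the type, because within a fixed context the index determines it; hence the
equality of dependent pairs. -/
theorem Var.code_injective {Γ : Ctx} {σ τ : Ty} (x : Var Γ σ) (y : Var Γ τ)
    (h : x.code = y.code) : (⟨σ, x⟩ : Σ σ, Var Γ σ) = ⟨τ, y⟩ := by
  induction x with
  | zero => cases y <;> simp_all [Var.code]
  | succ x ih =>
    cases y with
    | zero => simp [Var.code] at h
    | succ y =>
      simp only [Var.code, Nat.add_right_cancel_iff] at h
      cases ih y h
      rfl

/-- A numerical code of a term. -/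
def Term.code {L : Fragment} {Γ : Ctx} : {σ : Ty} → Term L Γ σ → ℕ
  | _, .var _ x => Nat.pair 0 x.code
  | _, .zero => Nat.pair 1 0
  | _, .succ => Nat.pair 2 0
  | _, .add => Nat.pair 3 0
  | _, .mul => Nat.pair 4 0
  | _, .proj ρ τ => Nat.pair 5 (Nat.pair ρ.code τ.code)
  | _, .comb δ ρ τ => Nat.pair 6 (Nat.pair δ.code (Nat.pair ρ.code τ.code))
  | _, .recursor σ _ => Nat.pair 7 σ.code
  | _, .app s t => Nat.pair 8 (Nat.pair s.code t.code)

/-- The types of the two terms are not assumed equal: in an application the argument type is hidden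
and has to be recovered from the codes of the parts. -/
theorem Term.code_injective {L : Fragment} {Γ : Ctx} {σ τ : Ty} (s : Term L Γ σ) (t : Term L Γ τ)
    (h : s.code = t.code) : (⟨σ, s⟩ : Σ σ, Term L Γ σ) = ⟨τ, t⟩ := by
  induction s generalizing τ with
  | var hx x =>
    cases t <;> simp only [Term.code, Nat.pair_eq_pair, true_and] at h <;> try omega
    cases Var.code_injective _ _ h
    rfl
  | zero => cases t <;> simp only [Term.code, Nat.pair_eq_pair] at h <;> first | omega | rfl
  | succ => cases t <;> simp only [Term.code, Nat.pair_eq_pair] at h <;> first | omega | rfl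
  | add => cases t <;> simp only [Term.code, Nat.pair_eq_pair] at h <;> first | omega | rfl
  | mul => cases t <;> simp only [Term.code, Nat.pair_eq_pair] at h <;> first | omega | rfl
  | proj ρ τ =>
    cases t <;> simp only [Term.code, Nat.pair_eq_pair, true_and] at h <;> try omega
    rw [Ty.code_injective h.1, Ty.code_injective h.2]
  | comb δ ρ τ =>
    cases t <;> simp only [Term.code, Nat.pair_eq_pair, true_and] at h <;> try omega
    rw [Ty.code_injective h.1, Ty.code_injective h.2.1, Ty.code_injective h.2.2]
  | recursor σ hσ =>
    cases t <;> simp only [Term.code, Nat.pair_eq_pair, true_and] at h <;> try omega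
    cases Ty.code_injective h
    rfl
  | app s u ih₁ ih₂ =>
    cases t <;> simp only [Term.code, Nat.pair_eq_pair, true_and] at h <;> try omega
    cases ih₁ _ h.1
    cases ih₂ _ h.2
    rfl

theorem Term.code_injective' {L : Fragment} {Γ : Ctx} {σ : Ty} {s t : Term L Γ σ}
    (h : s.code = t.code) : s = t := by
  cases Term.code_injective s t h
  rfl

/-- A numerical code of a formula. -/
def Formula.code {L : Fragment} : {Γ : Ctx} → Formula L Γ → ℕ
  | _, .eq s t => Nat.pair 0 (Nat.pair s.code t.code)
  | _, .bot => Nat.pair 1 0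
  | _, .and A B => Nat.pair 2 (Nat.pair A.code B.code)
  | _, .or A B => Nat.pair 3 (Nat.pair A.code B.code)
  | _, .imp A B => Nat.pair 4 (Nat.pair A.code B.code)
  | _, .all σ _ A => Nat.pair 5 (Nat.pair σ.code A.code)
  | _, .ex σ _ A => Nat.pair 6 (Nat.pair σ.code A.code)

theorem Formula.code_injective {L : Fragment} {Γ : Ctx} :
    Function.Injective (Formula.code : Formula L Γ → ℕ) := by
  intro A
  induction A with
  | eq s t =>
    intro B h
    cases B <;> simp only [Formula.code, Nat.pair_eq_pair, true_and] at h <;> try omega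
    rw [Term.code_injective' h.1, Term.code_injective' h.2]
  | bot => intro B h; cases B <;> simp only [Formula.code, Nat.pair_eq_pair] at h <;> first | omega | rfl
  | and A B ih₁ ih₂ =>
    intro C h
    cases C <;> simp only [Formula.code, Nat.pair_eq_pair, true_and] at h <;> try omega
    rw [ih₁ h.1, ih₂ h.2]
  | or A B ih₁ ih₂ =>
    intro C h
    cases C <;> simp only [Formula.code, Nat.pair_eq_pair, true_and] at h <;> try omega
    rw [ih₁ h.1, ih₂ h.2]
  | imp A B ih₁ ih₂ =>
    intro C h
    cases C <;> simp only [Formula.code, Nat.pair_eq_pair, true_and] at h <;> try omega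
    rw [ih₁ h.1, ih₂ h.2]
  | all σ hσ A ih =>
    intro C h
    cases C <;> simp only [Formula.code, Nat.pair_eq_pair, true_and] at h <;> try omega
    cases Ty.code_injective h.1
    rw [ih h.2]
  | ex σ hσ A ih =>
    intro C h
    cases C <;> simp only [Formula.code, Nat.pair_eq_pair, true_and] at h <;> try omega
    cases Ty.code_injective h.1
    rw [ih h.2]

/-- Countability is what allows every formula to be scheduled at some finite stage of the tower. -/
instance {L : Fragment} {Γ : Ctx} : Countable (Formula L Γ) :=
  Formula.code_injective.countable

end FiniteType

namespace FiniteType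

open Filter

namespace Henkin

/-! ### Henkin extensions of `RCA` -/

/-- Types `0` and `1` in alternation. -/
def witnessTy (m : ℕ) : Ty := if m % 2 = 0 then .nat else .one

theorem witnessTy_mem (m : ℕ) : Fragment.second.varTy (witnessTy m) := by
  unfold witnessTy
  split
  · exact .inl rfl
  · exact .inr rfl

/-- The context of the first `m` witnessing variables. -/
def ctx : ℕ → Ctx
  | 0 => []
  | m + 1 => witnessTy m :: ctx m

/-- Transport of an element of stage `n` to the later stages along the maps `sh`. -/
def up {X : ℕ → Type} (d : X 0) (sh : ∀ m, X m → X (m + 1)) {n : ℕ} (x : X n) : ∀ m, X m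
  | 0 => if h : n = 0 then h ▸ x else d
  | m + 1 => if h : n = m + 1 then h ▸ x else sh m (up d sh x m)

theorem up_self {X : ℕ → Type} (d : X 0) (sh : ∀ m, X m → X (m + 1)) {n : ℕ} (x : X n) :
    up d sh x n = x := by
  cases n <;> simp [up]

theorem up_succ {X : ℕ → Type} (d : X 0) (sh : ∀ m, X m → X (m + 1)) {n : ℕ} (x : X n) {m : ℕ}
    (h : n ≤ m) : up d sh x (m + 1) = sh m (up d sh x m) := by
  rw [up, dif_neg (by omega)]

/-- Used to identify the scheduled copy of a formula with the coherent family it came from. -/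
theorem up_eq {X : ℕ → Type} (d : X 0) (sh : ∀ m, X m → X (m + 1)) {n : ℕ} (x : ∀ m, X m)
    (hx : ∀ m ≥ n, x (m + 1) = sh m (x m)) {m : ℕ} (h : n ≤ m) : up d sh (x n) m = x m := by
  induction m, h using Nat.le_induction with
  | base => exact up_self _ _ _
  | succ m hm ih => rw [up_succ _ _ _ hm, ih, hx m hm]

/-- The sequences of sets of hypotheses in a Henkin construction. -/
structure Tower where
  /-- the hypotheses at stage `m` -/
  hyps : ∀ m, List (Formula .second (ctx m))
  consistent : ∀ m, ¬ Derives RCA (hyps m) .bot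
  mono : ∀ m, (hyps m).map Formula.shift ⊆ hyps (m + 1)
  -- Stage `m` adds a variable of type `witnessTy m`, which depends on the parity of `m`.
  -- Prescribing the parity ensures that the new variable has the type of the existential quantifier
  -- to be witnessed.
  complete : ∀ (n p : ℕ) (B : ∀ m, Formula .second (ctx m)),
    (∀ m ≥ n, B (m + 1) = (B m).shift) → ∃ m ≥ n, m % 2 = p % 2 ∧
      ((B m).shift ∈ hyps (m + 1) ∨ (B m).neg.shift ∈ hyps (m + 1)) ∧
      ∀ h C, B m = .ex (witnessTy m) h C → (B m).shift ∈ hyps (m + 1) → C ∈ hyps (m + 1)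

/-- A fresh variable creates no inconsistency because every type has a closed term: generalise over
the variable and instantiate. -/
theorem consistent_shift {Γ : Ctx} {H : List (Formula .second Γ)} {σ : Ty}
    (hσ : Fragment.second.varTy σ) (h : ¬ Derives RCA H .bot) :
    ¬ Derives RCA (H.map (Formula.shift (ρ := σ))) .bot := fun d =>
  h (Derives.allE (h := hσ) (A := .bot) (Term.default σ) (.allI d))

/-- The formula is added if consistent and its negation otherwise. When it is an existential
statement of the current type, the fresh variable becomes its witness; consistency is then exactly
existential elimination. -/
theorem exists_step (m : ℕ) (H : List (Formula .second (ctx m))) (hH : ¬ Derives RCA H .bot)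
    (B : Formula .second (ctx m)) :
    ∃ K : List (Formula .second (ctx (m + 1))), ¬ Derives RCA K .bot ∧
      H.map Formula.shift ⊆ K ∧ (B.shift ∈ K ∨ B.neg.shift ∈ K) ∧
      ∀ h C, B = .ex (witnessTy m) h C → B.shift ∈ K → C ∈ K := by
  by_cases hB : Derives RCA (B :: H) .bot
  · refine ⟨(B.neg :: H).map Formula.shift, consistent_shift (witnessTy_mem m) ?_, ?_, ?_, ?_⟩
    · exact fun d => hH (.impE (.impI d) (.impI hB))
    · exact List.map_subset _ (List.subset_cons_self _ _)
    · exact .inr List.mem_cons_self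
    · intro h C hC hmem
      -- The witness clause is vacuous here: the list is consistent and already contains the
      -- negation.
      exfalso
      refine consistent_shift (witnessTy_mem m) (fun d => hH (.impE (.impI d) (.impI hB)))
        (.impE (A := B.shift) (.hyp ?_) (.hyp hmem))
      exact List.mem_cons_self
  · by_cases hC : ∃ h C, B = .ex (witnessTy m) h C
    · obtain ⟨h, C, rfl⟩ := hC
      refine ⟨C :: (Formula.ex (witnessTy m) h C :: H).map Formula.shift, ?_, ?_, ?_, ?_⟩
      · intro d
        exact hB (.exE .head (B := .bot) d)
      · exact fun A hA => List.mem_cons_of_mem _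
          (List.map_subset _ (List.subset_cons_self _ _) hA)
      · exact .inl (List.mem_cons_of_mem _ List.mem_cons_self)
      · intro h C' hC' _
        cases hC'
        exact List.mem_cons_self
    · refine ⟨(B :: H).map Formula.shift, consistent_shift (witnessTy_mem m) hB, ?_, ?_, ?_⟩
      · exact List.map_subset _ (List.subset_cons_self _ _)
      · exact .inl List.mem_cons_self
      · intro h C hC' _
        exact absurd ⟨h, C, hC'⟩ hC

theorem exists_tower (Φ : Sentence .second) (hΦ : ¬ Provable RCA Φ) :
    ∃ T : Tower, T.hyps 0 = [Φ.neg] := by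
  classical
  have : Nonempty (Σ n, Formula .second (ctx n)) := ⟨⟨0, .bot⟩⟩
  obtain ⟨g, hg⟩ := exists_surjective_nat (Σ n, Formula .second (ctx n))
  let upF {n : ℕ} (A : Formula .second (ctx n)) (m : ℕ) : Formula .second (ctx m) :=
    up (X := fun m => Formula .second (ctx m)) .bot (fun _ A => A.shift) A m
  -- The quotient `m / 2` selects the formula, while the parity of `m` selects the type of the fresh
  -- variable. Only the first component of the unpairing is used; the second makes every formula
  -- recur arbitrarily late.
  let task (m : ℕ) : Formula .second (ctx m) := upF (g (Nat.unpair (m / 2)).1).2 m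
  let State (m : ℕ) := {H : List (Formula .second (ctx m)) // ¬ Derives RCA H .bot}
  let next (m : ℕ) (H : State m) : State (m + 1) :=
    ⟨(exists_step m H.1 H.2 (task m)).choose, (exists_step m H.1 H.2 (task m)).choose_spec.1⟩
  have h₀ : ¬ Derives RCA [Φ.neg] .bot := fun d => hΦ (.byContra d)
  let H (m : ℕ) : State m := Nat.rec ⟨[Φ.neg], h₀⟩ next m
  have spec (m : ℕ) : (H m).1.map Formula.shift ⊆ (H (m + 1)).1 ∧
      ((task m).shift ∈ (H (m + 1)).1 ∨ (task m).neg.shift ∈ (H (m + 1)).1) ∧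
      ∀ h C, task m = .ex (witnessTy m) h C → (task m).shift ∈ (H (m + 1)).1 →
        C ∈ (H (m + 1)).1 :=
    (exists_step m (H m).1 (H m).2 (task m)).choose_spec.2
  refine ⟨⟨fun m => (H m).1, fun m => (H m).2, fun m => (spec m).1, ?_⟩, rfl⟩
  intro n p B hB
  obtain ⟨i, hi⟩ := hg ⟨n, B n⟩
  obtain ⟨m, hm, hp, hi'⟩ : ∃ m ≥ n, m % 2 = p % 2 ∧ (Nat.unpair (m / 2)).1 = i := by
    -- Since `n ≤ Nat.pair i n`, the padding by `n` pushes the stage beyond `n`.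
    refine ⟨2 * Nat.pair i n + p % 2, ?_, by omega, ?_⟩
    · have := Nat.right_le_pair i n
      omega
    · rw [show (2 * Nat.pair i n + p % 2) / 2 = Nat.pair i n by omega, Nat.unpair_pair]
  have ht : task m = B m := by
    change upF (g (Nat.unpair (m / 2)).1).2 m = B m
    rw [hi', hi]
    exact up_eq (X := fun m => Formula .second (ctx m)) _ _ B hB hm
  exact ⟨m, hm, hp, ht ▸ (spec m).2⟩

/-! ### Eventual truth along a tower -/

/-- A term that may mention finitely many of the witnessing variables. -/
structure Germ (σ : Ty) where
  /-- the term at stage `m` -/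
  at_ : ∀ m, Term .second (ctx m) σ
  coh : ∀ᶠ m in atTop, at_ (m + 1) = (at_ m).shift

namespace Tower

variable (T : Tower)

/-- The formulas `B m` are eventually derivable. -/
def Tr (B : ∀ m, Formula .second (ctx m)) : Prop := ∀ᶠ m in atTop, Derives RCA (T.hyps m) (B m)

variable {T}

theorem derives_succ {m : ℕ} {A : Formula .second (ctx m)} (d : Derives RCA (T.hyps m) A) :
    Derives RCA (T.hyps (m + 1)) A.shift := (Derives.shift d).weaken (T.mono m)

/-- Hypotheses only grow along the tower, so a single derivation beyond the point of coherence
persists to all later stages. -/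
theorem Tr.of_frequently {B : ∀ m, Formula .second (ctx m)}
    (hB : ∀ᶠ m in atTop, B (m + 1) = (B m).shift)
    (h : ∃ᶠ m in atTop, Derives RCA (T.hyps m) (B m)) : T.Tr B := by
  obtain ⟨n, hn⟩ := eventually_atTop.1 hB
  obtain ⟨m, hm, d⟩ := frequently_atTop.1 h n
  refine eventually_atTop.2 ⟨m, fun k hk => ?_⟩
  induction k, hk using Nat.le_induction with
  | base => exact d
  | succ k hk ih => rw [hn k (hm.trans hk)]; exact derives_succ ih

/-- If `B` is underivable from some stage on, then a decision taken after that stage can only have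
added the negation. -/
theorem tr_or_tr_neg {B : ∀ m, Formula .second (ctx m)}
    (hB : ∀ᶠ m in atTop, B (m + 1) = (B m).shift) : T.Tr B ∨ T.Tr (fun m => (B m).neg) := by
  by_cases h : ∃ᶠ m in atTop, Derives RCA (T.hyps m) (B m)
  · exact .inl (.of_frequently hB h)
  · refine .inr (.of_frequently ?_ ?_)
    · filter_upwards [hB] with m hm
      rw [hm]; rfl
    · rw [not_frequently] at h
      obtain ⟨n, hn⟩ := eventually_atTop.1 (h.and hB)
      refine frequently_atTop.2 fun k => ?_
      -- The parity `0` is immaterial, as no witness is sought.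
      obtain ⟨m, hm, -, h', -⟩ := T.complete (max n k) 0 B
        fun m hm => (hn m ((le_max_left _ _).trans hm)).2
      have hnm : n ≤ m := (le_max_left _ _).trans hm
      refine ⟨m + 1, (le_max_right n k).trans (hm.trans (Nat.le_succ m)), ?_⟩
      rcases h' with h' | h'
      · refine absurd (Derives.hyp (T := RCA) h') ?_
        rw [← (hn m hnm).2]
        exact (hn (m + 1) (hnm.trans (Nat.le_succ m))).1
      · rw [(hn m hnm).2]
        exact .hyp h'

theorem not_tr_bot : ¬ T.Tr fun _ => .bot := fun h =>
  let ⟨m, hm⟩ := h.exists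
  T.consistent m hm

theorem not_tr_neg {B : ∀ m, Formula .second (ctx m)} (h : T.Tr B) :
    ¬ T.Tr fun m => (B m).neg := fun h' =>
  not_tr_bot <| by
    filter_upwards [h, h'] with m d d'
    exact d'.impE d

/-- The witness is the variable added at the stage where the existential statement was decided,
carried along to later stages. -/
theorem Tr.ex {σ : Ty} {h : Fragment.second.varTy σ} {C : ∀ m, Formula .second (σ :: ctx m)}
    (hC : ∀ᶠ m in atTop, C (m + 1) = (C m).rename (Ren.lift fun _ x => .succ x))
    (hT : T.Tr fun m => .ex σ h (C m)) :
    ∃ t : Germ σ, T.Tr fun m => (C m).inst (t.at_ m) := by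
  obtain ⟨n, hn⟩ := eventually_atTop.1 (hC.and hT)
  -- `p` is the parity of the stages whose fresh variable has type `σ`.
  obtain ⟨p, hp⟩ : ∃ p, ∀ m, m % 2 = p % 2 → σ = witnessTy m := by
    rcases h with h | h
    · exact ⟨0, fun m hm => by simp [witnessTy, hm, h]⟩
    · exact ⟨1, fun m hm => by simp [witnessTy, hm, h]⟩
  obtain ⟨m, hm, hpm, h', hw⟩ := T.complete n p (fun m => .ex σ h (C m)) fun m hm => by
    rw [(hn m hm).1]; rfl
  obtain rfl := hp m hpm
  have hmem : (Formula.ex (witnessTy m) h (C m)).shift ∈ T.hyps (m + 1) := by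
    refine h'.resolve_right fun h' => T.consistent (m + 1) (.impE (.hyp h') ?_)
    exact derives_succ (hn m hm).2
  have hCm := hw h (C m) rfl hmem
  let t : Germ (witnessTy m) :=
    { at_ := up (X := fun k => Term .second (ctx k) (witnessTy m)) (Term.default _)
        (fun _ t => t.shift) (n := m + 1) (.var h .zero)
      coh := eventually_atTop.2 ⟨m + 1, fun k hk => up_succ _ _ _ hk⟩ }
  have ht : t.at_ (m + 1) = .var h .zero :=
    up_self (X := fun k => Term .second (ctx k) (witnessTy m)) _ _ _
  refine ⟨t, eventually_atTop.2 ⟨m + 1, fun k hk => ?_⟩⟩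
  induction k, hk using Nat.le_induction with
  | base =>
    beta_reduce
    rw [ht, (hn m hm).1]
    exact (Formula.rename_lift_inst_zero h (C m)).symm ▸ .hyp hCm
  | succ k hk ih =>
    have : (C (k + 1)).inst (t.at_ (k + 1)) = ((C k).inst (t.at_ k)).shift := by
      rw [(hn k (by omega)).1, Formula.shift, Formula.inst_rename]
      congr 1
      exact up_succ _ _ _ hk
    beta_reduce
    rw [this]
    exact derives_succ ih

/-- If the universal statement failed, completeness would make its negation true; classically this
gives an existential counterexample, whose witnessing germ contradicts the hypothesis. -/
theorem tr_all_iff {σ : Ty} {h : Fragment.second.varTy σ} {C : ∀ m, Formula .second (σ :: ctx m)}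
    (hC : ∀ᶠ m in atTop, C (m + 1) = (C m).rename (Ren.lift fun _ x => .succ x)) :
    (T.Tr fun m => .all σ h (C m)) ↔ ∀ t : Germ σ, T.Tr fun m => (C m).inst (t.at_ m) := by
  constructor
  · intro hT t
    filter_upwards [hT] with m d
    exact .allE _ d
  · intro hT
    refine (tr_or_tr_neg ?_).resolve_right fun hn => ?_
    · filter_upwards [hC] with m hm
      rw [hm]; rfl
    · obtain ⟨t, ht⟩ := Tr.ex (T := T) (h := h) (C := fun m => (C m).neg)
        (by filter_upwards [hC] with m hm; rw [hm]; rfl)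
        (by filter_upwards [hn] with m d; exact d.ex_neg_of_neg_all)
      exact not_tr_neg (hT t) ht

theorem tr_ex_iff {σ : Ty} {h : Fragment.second.varTy σ} {C : ∀ m, Formula .second (σ :: ctx m)}
    (hC : ∀ᶠ m in atTop, C (m + 1) = (C m).rename (Ren.lift fun _ x => .succ x)) :
    (T.Tr fun m => .ex σ h (C m)) ↔ ∃ t : Germ σ, T.Tr fun m => (C m).inst (t.at_ m) := by
  refine ⟨Tr.ex hC, fun ⟨t, hT⟩ => ?_⟩
  filter_upwards [hT] with m d
  exact .exI _ d

theorem tr_imp_iff {A B : ∀ m, Formula .second (ctx m)}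
    (hA : ∀ᶠ m in atTop, A (m + 1) = (A m).shift) :
    (T.Tr fun m => A m ⇒ B m) ↔ (T.Tr A → T.Tr B) := by
  constructor
  · intro h hA
    filter_upwards [h, hA] with m d d'
    exact d.impE d'
  · intro h
    rcases tr_or_tr_neg hA with hA | hA
    · filter_upwards [h hA] with m d
      exact .impI d.wk
    · filter_upwards [hA] with m d
      exact .impI (.botE (.impE d.wk .head))

theorem tr_and_iff {A B : ∀ m, Formula .second (ctx m)} :
    (T.Tr fun m => .and (A m) (B m)) ↔ T.Tr A ∧ T.Tr B := by
  constructor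
  · exact fun h => ⟨h.mono fun _ d => d.andE₁, h.mono fun _ d => d.andE₂⟩
  · rintro ⟨h, h'⟩
    filter_upwards [h, h'] with m d d'
    exact d.andI d'

theorem tr_or_iff {A B : ∀ m, Formula .second (ctx m)}
    (hA : ∀ᶠ m in atTop, A (m + 1) = (A m).shift) :
    (T.Tr fun m => .or (A m) (B m)) ↔ T.Tr A ∨ T.Tr B := by
  constructor
  · intro h
    refine (tr_or_tr_neg hA).imp_right fun hA => ?_
    filter_upwards [h, hA] with m d d'
    exact .orE d (.botE (.impE d'.wk .head)) .head
  · rintro (h | h)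
    · exact h.mono fun _ d => .orI₁ d
    · exact h.mono fun _ d => .orI₂ d

end Tower

end Henkin

end FiniteType

namespace FiniteType

open Filter

/-! ### Structures and satisfaction -/

/-- A typed applicative structure with interpretations of the constants of `L`. -/
structure Struct (L : Fragment) where
  /-- the objects of each type -/
  D : Ty → Type
  app : {σ τ : Ty} → D (σ ⇾ τ) → D σ → D τ
  zero : D .nat
  succ : D (.nat ⇾ .nat)
  add : D (.nat ⇾ .nat ⇾ .nat)
  mul : D (.nat ⇾ .nat ⇾ .nat)
  proj (ρ τ : Ty) : D (ρ ⇾ τ ⇾ ρ)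
  comb (δ ρ τ : Ty) : D ((δ ⇾ ρ ⇾ τ) ⇾ (δ ⇾ ρ) ⇾ δ ⇾ τ)
  recursor (σ : Ty) (h : L.recTy σ) : D (.nat ⇾ σ ⇾ (σ ⇾ .nat ⇾ σ) ⇾ σ)

namespace Struct

variable {L : Fragment} (M : Struct L)

/-- An assignment of objects to the variables of a context. -/
abbrev Env (Γ : Ctx) : Type := ∀ ⦃σ : Ty⦄, L.varTy σ → Var Γ σ → M.D σ

variable {M}

/-- Extension of an assignment by a value of the innermost variable. -/
def Env.cons {Γ : Ctx} {ρ : Ty} (a : M.D ρ) (e : M.Env Γ) : M.Env (ρ :: Γ)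
  | _, _, .zero => a
  | _, h, .succ x => e h x

/-- The value of a term. -/
def eval {Γ : Ctx} (e : M.Env Γ) : {σ : Ty} → Term L Γ σ → M.D σ
  | _, .var h x => e h x
  | _, .zero => M.zero
  | _, .succ => M.succ
  | _, .add => M.add
  | _, .mul => M.mul
  | _, .proj ρ τ => M.proj ρ τ
  | _, .comb δ ρ τ => M.comb δ ρ τ
  | _, .recursor σ h => M.recursor σ h
  | _, .app s t => M.app (eval e s) (eval e t)

/-- Satisfaction of a formula. -/
def Sat : {Γ : Ctx} → M.Env Γ → Formula L Γ → Prop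
  | _, e, .eq s t => eval e s = eval e t
  | _, _, .bot => False
  | _, e, .and A B => Sat e A ∧ Sat e B
  | _, e, .or A B => Sat e A ∨ Sat e B
  | _, e, .imp A B => Sat e A → Sat e B
  | _, e, .all _ _ A => ∀ a, Sat (Env.cons a e) A
  | _, e, .ex _ _ A => ∃ a, Sat (Env.cons a e) A

theorem eval_rename {Γ Δ : Ctx} (e : M.Env Δ) (r : Ren Γ Δ) {σ : Ty} (t : Term L Γ σ) :
    eval e (t.rename r) = eval (fun _ h x => e h (r x)) t := by
  induction t <;> simp_all only [eval, Term.rename]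

theorem eval_subst {Γ Δ : Ctx} (e : M.Env Δ) (s : Sub L Γ Δ) {σ : Ty} (t : Term L Γ σ) :
    eval e (t.subst s) = eval (fun _ h x => eval e (s h x)) t := by
  induction t <;> simp_all only [eval, Term.subst]

theorem Env.cons_lift {Γ Δ : Ctx} {ρ : Ty} (a : M.D ρ) (e : M.Env Δ) (r : Ren Γ Δ) :
    (fun _ h x => Env.cons a e h (r.lift x) : M.Env (ρ :: Γ)) =
      Env.cons a (fun _ h x => e h (r x)) := by
  funext σ h x
  cases x <;> rfl

theorem Env.eval_lift {Γ Δ : Ctx} {ρ : Ty} (a : M.D ρ) (e : M.Env Δ) (s : Sub L Γ Δ) :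
    (fun _ h x => eval (Env.cons a e) (s.lift h x) : M.Env (ρ :: Γ)) =
      Env.cons a (fun _ h x => eval e (s h x)) := by
  funext σ h x
  cases x with
  | zero => rfl
  | succ x => exact eval_rename _ _ _

theorem sat_rename {Γ Δ : Ctx} (e : M.Env Δ) (r : Ren Γ Δ) (A : Formula L Γ) :
    Sat e (A.rename r) ↔ Sat (fun _ h x => e h (r x)) A := by
  induction A generalizing Δ <;>
    simp_all only [Sat, Formula.rename, eval_rename, Env.cons_lift]

theorem sat_subst {Γ Δ : Ctx} (e : M.Env Δ) (s : Sub L Γ Δ) (A : Formula L Γ) :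
    Sat e (A.subst s) ↔ Sat (fun _ h x => eval e (s h x)) A := by
  induction A generalizing Δ <;>
    simp_all only [Sat, Formula.subst, eval_subst, Env.eval_lift]

theorem sat_inst {Γ : Ctx} {ρ : Ty} (e : M.Env Γ) (A : Formula L (ρ :: Γ)) (t : Term L Γ ρ) :
    Sat e (A.inst t) ↔ Sat (Env.cons (eval e t) e) A := by
  rw [Formula.inst, sat_subst]
  have : (fun _ h x => eval e (Sub.single t h x) : M.Env (ρ :: Γ)) = Env.cons (eval e t) e := by
    funext σ h x
    cases x <;> rfl
  rw [this]

end Struct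

/-- Extensional structures for the second order fragment that satisfy induction and
quantifier-free choice. -/
class IsModel (M : Struct .second) : Prop where
  ext {σ τ : Ty} {f g : M.D (σ ⇾ τ)} : (∀ a, M.app f a = M.app g a) → f = g
  proj_eq {ρ τ : Ty} (a : M.D ρ) (b : M.D τ) : M.app (M.app (M.proj ρ τ) a) b = a
  comb_eq {δ ρ τ : Ty} (a : M.D (δ ⇾ ρ ⇾ τ)) (b : M.D (δ ⇾ ρ)) (c : M.D δ) :
    M.app (M.app (M.app (M.comb δ ρ τ) a) b) c = M.app (M.app a c) (M.app b c)
  rec_zero (y : M.D .nat) (z : M.D (.nat ⇾ .nat ⇾ .nat)) :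
    M.app (M.app (M.app (M.recursor .nat rfl) M.zero) y) z = y
  rec_succ (n y : M.D .nat) (z : M.D (.nat ⇾ .nat ⇾ .nat)) :
    M.app (M.app (M.app (M.recursor .nat rfl) (M.app M.succ n)) y) z =
      M.app (M.app z (M.app (M.app (M.app (M.recursor .nat rfl) n) y) z)) n
  succ_ne_zero (a : M.D .nat) : M.app M.succ a ≠ M.zero
  succ_inj {a b : M.D .nat} : M.app M.succ a = M.app M.succ b → a = b
  add_zero (a : M.D .nat) : M.app (M.app M.add a) M.zero = a
  add_succ (a b : M.D .nat) :
    M.app (M.app M.add a) (M.app M.succ b) = M.app M.succ (M.app (M.app M.add a) b)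
  mul_zero (a : M.D .nat) : M.app (M.app M.mul a) M.zero = M.zero
  mul_succ (a b : M.D .nat) : M.app (M.app M.mul a) (M.app M.succ b) =
    M.app (M.app M.add (M.app (M.app M.mul a) b)) a
  induction {Γ : Ctx} (A : Formula .second (.nat :: Γ)) (e : M.Env Γ) :
    M.Sat (.cons M.zero e) A → (∀ n, M.Sat (.cons n e) A → M.Sat (.cons (M.app M.succ n) e) A) →
      ∀ n, M.Sat (.cons n e) A
  choice {Γ : Ctx} (A : Formula .second (.nat :: .nat :: Γ)) (hA : A.QF) (e : M.Env Γ) :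
    (∀ x, ∃ y, M.Sat (.cons y (.cons x e)) A) →
      ∃ f : M.D .one, ∀ x, M.Sat (.cons (M.app f x) (.cons x e)) A

/-! ### Substitution in the axiom schemes. -/

section
variable {L : Fragment}

theorem Formula.eqAt_subst {Γ Δ : Ctx} (s : Sub L Γ Δ) (σ : Ty) (h : σ.ArgsIn L)
    (t u : Term L Γ σ) :
    (Formula.eqAt σ h t u).subst s = Formula.eqAt σ h (t.subst s) (u.subst s) := by
  induction σ generalizing Γ Δ with
  | nat => rfl
  | arr ρ τ _ ih =>
    simp only [Formula.eqAt, Formula.subst, ih, Term.subst, Term.shift, Term.subst_rename,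
      Term.rename_subst]
    rfl

theorem Formula.QF.subst {Γ Δ : Ctx} (s : Sub L Γ Δ) {A : Formula L Γ} (h : A.QF) :
    (A.subst s).QF := by
  induction A generalizing Δ <;> simp_all only [Formula.QF, Formula.subst, and_self]

theorem Formula.inst_subst {Γ Δ : Ctx} {ρ : Ty} (A : Formula L (ρ :: Γ)) (t : Term L Γ ρ)
    (s : Sub L Γ Δ) : (A.inst t).subst s = (A.subst s.lift).inst (t.subst s) := by
  rw [Formula.subst_lift_inst, Formula.inst, Formula.subst_subst]
  congr 1
  funext σ h x
  cases x <;> rfl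

theorem Formula.step_subst {Γ Δ : Ctx} (s : Sub L Γ Δ) (A : Formula L (.nat :: Γ)) :
    (A.subst Sub.step).subst s.lift = (A.subst s.lift).subst Sub.step := by
  rw [Formula.subst_subst, Formula.subst_subst]
  congr 1
  funext σ h x
  cases x with
  | zero => rfl
  | succ x =>
    simp only [Sub.step, Sub.lift, Term.subst, Term.shift, Term.subst_rename]
    rw [← Term.subst_var ((s h x).rename _), Term.subst_rename]

theorem Formula.choice_subst {Γ Δ : Ctx} (s : Sub L Γ Δ) {ρ τ : Ty} (hρ : L.varTy ρ)
    (hY : L.varTy (ρ ⇾ τ)) (A : Formula L (τ :: ρ :: Γ)) :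
    (A.subst (Sub.choice hρ hY)).subst s.lift.lift =
      (A.subst s.lift.lift).subst (Sub.choice hρ hY) := by
  rw [Formula.subst_subst, Formula.subst_subst]
  congr 1
  funext σ h x
  cases x with
  | zero => rfl
  | succ x =>
    cases x with
    | zero => rfl
    | succ x =>
      simp only [Sub.choice, Sub.lift, Term.subst, Term.shift, Term.subst_rename,
        Term.rename_rename]
      rw [← Term.subst_var ((s h x).rename _), Term.subst_rename]

end

namespace Henkin

/-! ### The model given by a tower -/

/-- Application of germs. -/
def Germ.app {σ τ : Ty} (f : Germ (σ ⇾ τ)) (a : Germ σ) : Germ τ where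
  at_ m := .app (f.at_ m) (a.at_ m)
  coh := by
    filter_upwards [f.coh, a.coh] with m h₁ h₂
    rw [h₁, h₂]
    rfl

theorem noVar {σ : Ty} (x : Var [] σ) : False := nomatch x

/-- The germ of a closed term. -/
def Germ.closed {σ : Ty} (t : Term .second [] σ) : Germ σ where
  at_ m := t.rename (fun _ x => (noVar x).elim)
  coh := .of_forall fun m => by
    simp only [Term.shift, Term.rename_rename]
    congr 1
    funext σ x
    exact nomatch x

namespace Tower

variable (T : Tower)

/-- The hereditarily extensional partial equivalence relation on germs. -/
def Per : (σ : Ty) → Germ σ → Germ σ → Prop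
  | .nat, a, b => T.Tr fun m => a.at_ m ≐ b.at_ m
  | .arr ρ τ, f, g => ∀ a b : Germ ρ, Per ρ a b → Per τ (f.app a) (g.app b)

variable {T}

/-- Symmetry and transitivity go together: transitivity at an arrow type needs the second argument
to be related to itself, which uses both properties at the argument type. -/
theorem Per.symm_trans (σ : Ty) :
    (∀ a b, T.Per σ a b → T.Per σ b a) ∧
      ∀ a b c, T.Per σ a b → T.Per σ b c → T.Per σ a c := by
  induction σ with
  | nat =>
    constructor
    · intro a b h
      filter_upwards [h] with m d
      exact .impE (.eha (.eq_symm _ _)) d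
    · intro a b c h h'
      filter_upwards [h, h'] with m d d'
      exact .impE (.impE (.eha (.eq_trans _ _ _)) d) d'
  | arr ρ τ ih₁ ih₂ =>
    constructor
    · intro f g h a b hab
      exact ih₂.1 _ _ (h b a (ih₁.1 _ _ hab))
    · intro f g k h h' a b hab
      exact ih₂.2 _ _ _ (h a b hab) (h' b b (ih₁.2 _ _ _ (ih₁.1 _ _ hab) hab))

theorem Per.symm {σ : Ty} {a b : Germ σ} (h : T.Per σ a b) : T.Per σ b a :=
  (Per.symm_trans σ).1 _ _ h

theorem Per.trans {σ : Ty} {a b c : Germ σ} (h : T.Per σ a b) (h' : T.Per σ b c) : T.Per σ a c :=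
  (Per.symm_trans σ).2 _ _ _ h h'

theorem Per.left {σ : Ty} {a b : Germ σ} (h : T.Per σ a b) : T.Per σ a a := h.trans h.symm

/-- Higher type equations of `RCA` are available only through their type 0 instances on argument
lists. The induction on the type moves one argument at a time into the list. -/
theorem Per.of_apps_eq {σ : Ty} {a a' b : Germ σ} (h : T.Per σ a b)
    (ha : ∀ᶠ m in atTop, ∀ u, Derives RCA (T.hyps m) ((a'.at_ m).apps u ≐ (a.at_ m).apps u)) :
    T.Per σ a' b := by
  induction σ with
  | nat =>
    refine Per.trans ?_ h
    filter_upwards [ha] with m d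
    exact d .nil
  | arr ρ τ _ ih =>
    intro c c' hc
    refine ih (h c c' hc) ?_
    filter_upwards [ha] with m d u
    exact d (.cons (c.at_ m) u)

theorem per_nat_self (a : Germ .nat) : T.Per .nat a a := .of_forall fun _ => .eha (.eq_refl _)

theorem per_one_self (f : Germ .one) : T.Per .one f f := by
  intro a b h
  filter_upwards [h] with m d
  exact .impE (.eha (.ext (ρ := .nat) trivial _ _ _ .nil)) d

/-- Variables have type 0 or 1, and there the extensionality axiom at type 0 suffices. So every germ
of a variable type survives the collapse, and quantifiers may range over all germs. -/
theorem per_self {σ : Ty} (hσ : Fragment.second.varTy σ) (a : Germ σ) : T.Per σ a a := by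
  rcases hσ with rfl | rfl
  · exact per_nat_self a
  · exact per_one_self a

/-- Turns the relation on germs into truth of a formula, so that the extensionality axiom of `RCA`
becomes applicable; needed for the step argument of the recursor. -/
theorem Per.eqAt {σ : Ty} (hσ : σ.ArgsIn .second) {a b : Germ σ} (h : T.Per σ a b) :
    T.Tr fun m => Formula.eqAt σ hσ (a.at_ m) (b.at_ m) := by
  induction σ with
  | nat => exact h
  | arr ρ τ _ ih =>
    refine (tr_all_iff ?_).2 fun t => ?_
    · filter_upwards [a.coh, b.coh] with m h₁ h₂
      rw [h₁, h₂, Formula.eqAt_rename]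
      simp only [Term.rename, Term.shift]
      congr 2
      · exact (Term.shift_rename_lift _ _).symm
      · exact (Term.shift_rename_lift _ _).symm
    · have := ih hσ.2 (h t t (per_self hσ.1 t))
      refine this.mono fun m d => ?_
      beta_reduce
      unfold Formula.inst
      rw [Formula.eqAt_subst]
      simp only [Term.subst, Term.shift_subst_single]
      exact d

theorem per_zero : T.Per .nat (.closed .zero) (.closed .zero) := per_nat_self _

theorem per_succ : T.Per .one (.closed .succ) (.closed .succ) := per_one_self _

theorem per_binary (f : Germ (.nat ⇾ .one)) : T.Per (.nat ⇾ .one) f f := by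
  intro a a' ha b b' hb
  refine Per.trans (b := (f.app a).app b') (per_one_self _ _ _ hb) ?_
  filter_upwards [ha] with m d
  exact .impE (.eha (.ext (ρ := .nat) trivial _ _ (f.at_ m) (.cons (b'.at_ m) .nil))) d

theorem apps_proj {ρ τ : Ty} (a : Germ ρ) (b : Germ τ) :
    ∀ᶠ m in atTop, ∀ u, Derives RCA (T.hyps m)
      (((((Germ.closed (.proj ρ τ)).app a).app b).at_ m).apps u ≐ (a.at_ m).apps u) :=
  .of_forall fun _ u => .eha (.proj _ _ u)

theorem per_proj (ρ τ : Ty) : T.Per _ (.closed (.proj ρ τ)) (.closed (.proj ρ τ)) := by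
  intro a a' ha b b' hb
  exact ((ha.of_apps_eq (apps_proj _ _)).symm.of_apps_eq (apps_proj _ _)).symm

theorem apps_comb {δ ρ τ : Ty} (a : Germ (δ ⇾ ρ ⇾ τ)) (b : Germ (δ ⇾ ρ)) (c : Germ δ) :
    ∀ᶠ m in atTop, ∀ u, Derives RCA (T.hyps m)
      ((((((Germ.closed (.comb δ ρ τ)).app a).app b).app c).at_ m).apps u ≐
        (((a.app c).app (b.app c)).at_ m).apps u) :=
  .of_forall fun _ u => .eha (.comb _ _ _ u)

theorem per_comb (δ ρ τ : Ty) : T.Per _ (.closed (.comb δ ρ τ)) (.closed (.comb δ ρ τ)) := by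
  intro a a' ha b b' hb c c' hc
  have := ha c c' hc _ _ (hb c c' hc)
  exact ((this.of_apps_eq (apps_comb _ _ _)).symm.of_apps_eq (apps_comb _ _ _)).symm

/-- The three arguments are exchanged one at a time by extensionality. The step function has type `0
→ 0 → 0`, whose argument types are types of variables, so its pointwise equality can be written in
the fragment. -/
theorem per_recursor (σ : Ty) (h : Fragment.second.recTy σ) :
    T.Per _ (.closed (.recursor σ h)) (.closed (.recursor σ h)) := by
  have h' : σ = .nat := h
  subst h'
  intro n n' hn y y' hy z z' hz
  have hz' := hz.eqAt (σ := .nat ⇾ .nat ⇾ .nat) ⟨.inl rfl, .inl rfl, trivial⟩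
  have h₁ : T.Per .nat ((((Germ.closed (.recursor .nat h)).app n).app y).app z)
      ((((Germ.closed (.recursor .nat h)).app n').app y).app z) := by
    filter_upwards [hn] with m d
    exact .impE (.eha (.ext (ρ := .nat) trivial _ _ (.recursor .nat h) (.cons (y.at_ m) (.cons (z.at_ m) .nil)))) d
  have h₂ : T.Per .nat ((((Germ.closed (.recursor .nat h)).app n').app y).app z)
      ((((Germ.closed (.recursor .nat h)).app n').app y').app z) := by
    filter_upwards [hy] with m d
    exact .impE (.eha (.ext (ρ := .nat) trivial _ _ (.app (.recursor .nat h) (n'.at_ m)) (.cons (z.at_ m) .nil))) d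
  have h₃ : T.Per .nat ((((Germ.closed (.recursor .nat h)).app n').app y').app z)
      ((((Germ.closed (.recursor .nat h)).app n').app y').app z') := by
    filter_upwards [hz'] with m d
    exact .impE (.eha (.ext _ _ _ _ .nil)) d
  exact (h₁.trans h₂).trans h₃

variable (T)

/-- The setoid on the self-related germs. -/
def setoid (σ : Ty) : Setoid {a : Germ σ // T.Per σ a a} where
  r a b := T.Per σ a.1 b.1
  iseqv := ⟨fun a => a.2, Per.symm, Per.trans⟩

/-- The extensional collapse of the germs. -/
def model : Struct .second where
  D σ := Quotient (T.setoid σ)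
  app := Quotient.map₂ (fun f a => ⟨f.1.app a.1, f.2 _ _ a.2⟩) fun _ _ h _ _ h' => h _ _ h'
  zero := ⟦⟨_, per_zero⟩⟧
  succ := ⟦⟨_, per_succ⟩⟧
  add := ⟦⟨.closed .add, per_binary _⟩⟧
  mul := ⟦⟨.closed .mul, per_binary _⟩⟧
  proj ρ τ := ⟦⟨_, per_proj ρ τ⟩⟧
  comb δ ρ τ := ⟦⟨_, per_comb δ ρ τ⟩⟧
  recursor σ h := ⟦⟨_, per_recursor σ h⟩⟧

variable {T}

/-- The object given by a germ. -/
def toD {σ : Ty} (a : Germ σ) (h : T.Per σ a a) : T.model.D σ := Quotient.mk (T.setoid σ) ⟨a, h⟩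

theorem toD_eq {σ : Ty} {a b : Germ σ} {ha : T.Per σ a a} {hb : T.Per σ b b} :
    toD a ha = toD b hb ↔ T.Per σ a b := Quotient.eq (r := T.setoid σ)

theorem exists_toD {σ : Ty} (x : T.model.D σ) : ∃ a h, x = toD (T := T) a h := by
  obtain ⟨a, rfl⟩ := Quotient.exists_rep x
  exact ⟨a.1, a.2, rfl⟩

theorem app_toD {σ τ : Ty} {f : Germ (σ ⇾ τ)} {a : Germ σ} (hf : T.Per _ f f) (ha : T.Per _ a a) :
    T.model.app (toD f hf) (toD a ha) = toD (f.app a) (hf _ _ ha) := rfl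

/-- The germ of a term with germs for its variables. -/
def germOf {Γ : Ctx} (ν : ∀ ⦃σ : Ty⦄, Fragment.second.varTy σ → Var Γ σ → Germ σ) :
    {σ : Ty} → Term .second Γ σ → Germ σ
  | _, .var h x => ν h x
  | _, .zero => .closed .zero
  | _, .succ => .closed .succ
  | _, .add => .closed .add
  | _, .mul => .closed .mul
  | _, .proj ρ τ => .closed (.proj ρ τ)
  | _, .comb δ ρ τ => .closed (.comb δ ρ τ)
  | _, .recursor σ h => .closed (.recursor σ h)
  | _, .app s t => (germOf ν s).app (germOf ν t)

theorem germOf_at {Γ : Ctx} (ν : ∀ ⦃σ : Ty⦄, Fragment.second.varTy σ → Var Γ σ → Germ σ) {σ : Ty}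
    (t : Term .second Γ σ) (m : ℕ) :
    (germOf ν t).at_ m = t.subst (fun _ h x => (ν h x).at_ m) := by
  induction t with
  | app s t ih₁ ih₂ => simp only [germOf, Germ.app, Term.subst, ih₁, ih₂]
  | _ => rfl

theorem eval_toD {Γ : Ctx} (ν : ∀ ⦃σ : Ty⦄, Fragment.second.varTy σ → Var Γ σ → Germ σ) {σ : Ty}
    (t : Term .second Γ σ) : ∃ h, T.model.eval (fun _ h x => toD (ν h x) (per_self h _)) t =
      toD (T := T) (germOf ν t) h := by
  induction t with
  | var h x => exact ⟨per_self h _, rfl⟩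
  | zero => exact ⟨per_zero, rfl⟩
  | succ => exact ⟨per_succ, rfl⟩
  | add => exact ⟨per_binary _, rfl⟩
  | mul => exact ⟨per_binary _, rfl⟩
  | proj ρ τ => exact ⟨per_proj ρ τ, rfl⟩
  | comb δ ρ τ => exact ⟨per_comb δ ρ τ, rfl⟩
  | recursor σ h => exact ⟨per_recursor σ h, rfl⟩
  | app s t ih₁ ih₂ =>
    obtain ⟨h₁, e₁⟩ := ih₁
    obtain ⟨h₂, e₂⟩ := ih₂
    exact ⟨h₁ _ _ h₂, by rw [Struct.eval, e₁, e₂, app_toD]; rfl⟩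

/-- A context is finite, so the germs assigned to its variables have a common stage of coherence. -/
theorem coh_env {Γ : Ctx} (ν : ∀ ⦃σ : Ty⦄, Fragment.second.varTy σ → Var Γ σ → Germ σ) :
    ∀ᶠ m in atTop, ∀ ⦃σ : Ty⦄ (h : Fragment.second.varTy σ) (x : Var Γ σ),
      (ν h x).at_ (m + 1) = ((ν h x).at_ m).shift := by
  induction Γ with
  | nil => exact .of_forall fun _ _ _ x => nomatch x
  | cons ρ Γ ih =>
    have h₀ : ∀ᶠ m in atTop, ∀ h : Fragment.second.varTy ρ,
        (ν h .zero).at_ (m + 1) = ((ν h .zero).at_ m).shift := by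
      by_cases h : Fragment.second.varTy ρ
      · filter_upwards [(ν h .zero).coh] with m hm _
        exact hm
      · exact .of_forall fun _ h' => absurd h' h
    filter_upwards [h₀, ih fun _ h x => ν h x.succ] with m h₁ h₂ σ h x
    cases x with
    | zero => exact h₁ h
    | succ x => exact h₂ h x

theorem coh_subst {Γ : Ctx} (ν : ∀ ⦃σ : Ty⦄, Fragment.second.varTy σ → Var Γ σ → Germ σ)
    (A : Formula .second Γ) : ∀ᶠ m in atTop, A.subst (fun _ h x => (ν h x).at_ (m + 1)) =
      (A.subst fun _ h x => (ν h x).at_ m).shift := by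
  filter_upwards [coh_env ν] with m hm
  rw [Formula.shift, Formula.rename_subst]
  congr 1
  funext σ h x
  exact hm h x

theorem coh_subst_lift {Γ : Ctx} {ρ : Ty}
    (ν : ∀ ⦃σ : Ty⦄, Fragment.second.varTy σ → Var Γ σ → Germ σ)
    (A : Formula .second (ρ :: Γ)) :
    ∀ᶠ m in atTop, A.subst (Sub.lift fun _ h x => (ν h x).at_ (m + 1)) =
      (A.subst (Sub.lift fun _ h x => (ν h x).at_ m)).rename (Ren.lift fun _ x => .succ x) := by
  filter_upwards [coh_env ν] with m hm
  rw [Formula.rename_subst, Sub.lift_rename]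
  congr 2
  funext σ h x
  exact hm h x

/-- Extension of an assignment of germs. -/
def consGerm {Γ : Ctx} {ρ : Ty} (t : Germ ρ)
    (ν : ∀ ⦃σ : Ty⦄, Fragment.second.varTy σ → Var Γ σ → Germ σ) :
    ∀ ⦃σ : Ty⦄, Fragment.second.varTy σ → Var (ρ :: Γ) σ → Germ σ
  | _, _, .zero => t
  | _, h, .succ x => ν h x

theorem consGerm_at {Γ : Ctx} {ρ : Ty} (t : Germ ρ)
    (ν : ∀ ⦃σ : Ty⦄, Fragment.second.varTy σ → Var Γ σ → Germ σ) (m : ℕ) :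
    (fun _ h x => (consGerm t ν h x).at_ m : Sub .second (ρ :: Γ) (ctx m)) =
      Sub.cons (t.at_ m) fun _ h x => (ν h x).at_ m := by
  funext σ h x
  cases x <;> rfl

theorem cons_toD {Γ : Ctx} {ρ : Ty} (hρ : Fragment.second.varTy ρ) (t : Germ ρ)
    (ν : ∀ ⦃σ : Ty⦄, Fragment.second.varTy σ → Var Γ σ → Germ σ) :
    (Struct.Env.cons (toD t (per_self hρ t)) fun _ h x => toD (ν h x) (per_self h _) :
      T.model.Env (ρ :: Γ)) = fun _ h x => toD (consGerm t ν h x) (per_self h _) := by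
  funext σ h x
  cases x <;> rfl

/-- The truth lemma. Connectives use the `tr_*_iff` equivalences; a quantifier over objects is one
over germs, since every object has a representing germ and every germ of a variable type is
self-related. -/
theorem sat_toD {Γ : Ctx} (A : Formula .second Γ)
    (ν : ∀ ⦃σ : Ty⦄, Fragment.second.varTy σ → Var Γ σ → Germ σ) :
    T.model.Sat (fun _ h x => toD (ν h x) (per_self h _)) A ↔
      T.Tr fun m => A.subst fun _ h x => (ν h x).at_ m := by
  induction A with
  | eq s t =>
    obtain ⟨h₁, e₁⟩ := eval_toD (T := T) ν s
    obtain ⟨h₂, e₂⟩ := eval_toD (T := T) ν t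
    simp only [Struct.Sat, e₁, e₂, toD_eq, Per, germOf_at]
    rfl
  | bot => exact iff_of_false id not_tr_bot
  | and A B ih₁ ih₂ => exact (and_congr (ih₁ ν) (ih₂ ν)).trans tr_and_iff.symm
  | or A B ih₁ ih₂ => exact (or_congr (ih₁ ν) (ih₂ ν)).trans (tr_or_iff (coh_subst ν A)).symm
  | imp A B ih₁ ih₂ => exact (imp_congr (ih₁ ν) (ih₂ ν)).trans (tr_imp_iff (coh_subst ν A)).symm
  | all σ h A ih =>
    refine Iff.trans ?_ (tr_all_iff (coh_subst_lift ν A)).symm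
    have key : ∀ t : Germ σ, T.model.Sat (Struct.Env.cons (toD t (per_self h t))
        fun _ h x => toD (ν h x) (per_self h _)) A ↔
        T.Tr fun m => (A.subst (Sub.lift fun _ h x => (ν h x).at_ m)).inst (t.at_ m) := by
      intro t
      rw [cons_toD h, ih]
      simp only [consGerm_at, Formula.subst_lift_inst]
    constructor
    · exact fun H t => (key t).1 (H _)
    · intro H a
      obtain ⟨t, ht, rfl⟩ := exists_toD a
      exact (key t).2 (H t)
  | ex σ h A ih =>
    refine Iff.trans ?_ (tr_ex_iff (coh_subst_lift ν A)).symm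
    have key : ∀ t : Germ σ, T.model.Sat (Struct.Env.cons (toD t (per_self h t))
        fun _ h x => toD (ν h x) (per_self h _)) A ↔
        T.Tr fun m => (A.subst (Sub.lift fun _ h x => (ν h x).at_ m)).inst (t.at_ m) := by
      intro t
      rw [cons_toD h, ih]
      simp only [consGerm_at, Formula.subst_lift_inst]
    constructor
    · rintro ⟨a, H⟩
      obtain ⟨t, ht, rfl⟩ := exists_toD a
      exact ⟨t, (key t).1 H⟩
    · exact fun ⟨t, H⟩ => ⟨_, (key t).2 H⟩

/-- Replacing the free variables by representing germs yields, at each stage, a substitution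
instance of the axiom, which is again an axiom. -/
theorem sat_of_ax {Γ : Ctx} {A : Formula .second Γ}
    (hA : ∀ {Δ : Ctx} (s : Sub .second Γ Δ), A.subst s ∈ RCA Δ) (e : T.model.Env Γ) :
    T.model.Sat e A := by
  have : ∀ ⦃σ : Ty⦄ (h : Fragment.second.varTy σ) (x : Var Γ σ),
      ∃ a : Germ σ, e h x = toD (T := T) a (per_self h a) := fun σ h x => by
    obtain ⟨a, ha, he⟩ := exists_toD (e h x)
    exact ⟨a, he⟩
  choose ν hν using this
  have he : e = fun _ h x => toD (ν h x) (per_self h _) := by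
    funext σ h x
    exact hν h x
  rw [he, sat_toD]
  exact .of_forall fun m => .ax (hA _)

/-- Extensionality is built into the collapse, the laws of `Π` and `Σ` come from `of_apps_eq`, and
induction and choice are axiom schemes closed under substitution. -/
instance isModel : IsModel T.model where
  ext {σ τ f g} h := by
    obtain ⟨f, hf, rfl⟩ := exists_toD f
    obtain ⟨g, hg, rfl⟩ := exists_toD g
    -- Pointwise agreement gives `f a ~ g a`; self-relatedness of `g` moves from `a` to `b`.
    refine toD_eq.2 fun a b hab => ?_
    have := h (toD a hab.left)
    rw [app_toD, app_toD, toD_eq] at this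
    exact this.trans (hg _ _ hab)
  proj_eq a b := by
    obtain ⟨a, ha, rfl⟩ := exists_toD a
    obtain ⟨b, hb, rfl⟩ := exists_toD b
    exact toD_eq.2 (ha.of_apps_eq (apps_proj _ _))
  comb_eq a b c := by
    obtain ⟨a, ha, rfl⟩ := exists_toD a
    obtain ⟨b, hb, rfl⟩ := exists_toD b
    obtain ⟨c, hc, rfl⟩ := exists_toD c
    exact toD_eq.2 ((ha _ _ hc _ _ (hb _ _ hc)).of_apps_eq (apps_comb _ _ _))
  rec_zero y z := by
    obtain ⟨y, hy, rfl⟩ := exists_toD y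
    obtain ⟨z, hz, rfl⟩ := exists_toD z
    exact toD_eq.2 (.of_forall fun m => .eha (.rec_zero (σ := .nat) rfl _ _ .nil))
  rec_succ n y z := by
    obtain ⟨n, hn, rfl⟩ := exists_toD n
    obtain ⟨y, hy, rfl⟩ := exists_toD y
    obtain ⟨z, hz, rfl⟩ := exists_toD z
    exact toD_eq.2 (.of_forall fun m => .eha (.rec_succ (σ := .nat) rfl _ _ _ .nil))
  succ_ne_zero a := by
    obtain ⟨a, ha, rfl⟩ := exists_toD a
    intro h
    have h : T.Tr _ := toD_eq.1 h
    exact not_tr_bot (h.mono fun m d => .impE (.eha (.succ_ne_zero _)) d)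
  succ_inj {a b} h := by
    obtain ⟨a, ha, rfl⟩ := exists_toD a
    obtain ⟨b, hb, rfl⟩ := exists_toD b
    have h : T.Tr _ := toD_eq.1 h
    exact toD_eq.2 (h.mono fun m d => .impE (.eha (.succ_inj _ _)) d)
  add_zero a := by
    obtain ⟨a, ha, rfl⟩ := exists_toD a
    exact toD_eq.2 (.of_forall fun m => .eha (.add_zero _))
  add_succ a b := by
    obtain ⟨a, ha, rfl⟩ := exists_toD a
    obtain ⟨b, hb, rfl⟩ := exists_toD b
    exact toD_eq.2 (.of_forall fun m => .eha (.add_succ _ _))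
  mul_zero a := by
    obtain ⟨a, ha, rfl⟩ := exists_toD a
    exact toD_eq.2 (.of_forall fun m => .eha (.mul_zero _))
  mul_succ a b := by
    obtain ⟨a, ha, rfl⟩ := exists_toD a
    obtain ⟨b, hb, rfl⟩ := exists_toD b
    exact toD_eq.2 (.of_forall fun m => .eha (.mul_succ _ _))
  induction A e h₀ hs := by
    have := sat_of_ax (T := T) (fun s => by
      simp only [Formula.subst, Formula.inst_subst, Formula.step_subst]
      exact .inl (.induction (A.subst s.lift))) e
      (A := A.inst .zero ⇒ .all .nat Fragment.second.nat_mem (A ⇒ A.subst Sub.step) ⇒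
        .all .nat Fragment.second.nat_mem A)
    refine this ((Struct.sat_inst _ _ _).2 h₀) fun n hn => ?_
    rw [Struct.sat_subst]
    convert hs n hn using 1
    funext σ h x
    cases x <;> rfl
  choice A hA e h := by
    have h₀ : Fragment.second.varTy .nat := .inl rfl
    have h₁ : Fragment.second.varTy (.nat ⇾ .nat) := .inr rfl
    have := sat_of_ax (T := T) (fun s => by
      have := QFAC.choice h₀ h₀ h₁ _ (hA.subst s.lift.lift)
      rw [← Formula.choice_subst s] at this
      exact .inr (.inl this)) e
      (A := .all .nat h₀ (.ex .nat h₀ A) ⇒ .ex (.nat ⇾ .nat) h₁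
        (.all .nat h₀ (A.subst (Sub.choice h₀ h₁))))
    obtain ⟨f, hf⟩ := this h
    refine ⟨f, fun x => ?_⟩
    have := hf x
    rw [Struct.sat_subst] at this
    convert this using 1
    funext σ h x
    cases x with
    | zero => rfl
    | succ x => cases x <;> rfl

end Tower

end Henkin

/-- Completeness: a sentence that is not provable in `RCA` fails in some model. -/
theorem exists_model_of_not_provable (Φ : Sentence .second) (hΦ : ¬ Provable RCA Φ) :
    ∃ M : Struct .second, IsModel M ∧ ∃ e : M.Env [], ¬ M.Sat e Φ := by
  obtain ⟨T, hT⟩ := Henkin.exists_tower Φ hΦ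
  -- A sentence has no variables to substitute for, so the hypothesis `¬Φ` of stage 0 reappears at
  -- every stage.
  have hsub : ∀ {Δ : Ctx} (s s' : Sub .second [] Δ), s = s' := fun s s' => by
    funext _ _ x
    exact (Henkin.noVar x).elim
  let ν : ∀ ⦃σ : Ty⦄, Fragment.second.varTy σ → Var [] σ → Henkin.Germ σ :=
    fun _ _ x => (Henkin.noVar x).elim
  refine ⟨T.model, Henkin.Tower.isModel,
    fun _ h x => Henkin.Tower.toD (ν h x) (Henkin.Tower.per_self h _), fun h => ?_⟩
  refine Henkin.Tower.not_tr_neg ((Henkin.Tower.sat_toD (T := T) Φ ν).1 h)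
    (.of_forall fun m => .hyp ?_)
  induction m with
  | zero =>
    have h₀ : [Φ.neg] = [(Φ.subst fun _ h x => (ν h x).at_ 0).neg] := by
      rw [show Φ.subst (fun _ h x => (ν h x).at_ 0) = Φ from
        (congrArg (fun s => Formula.subst s Φ) (hsub _ _)).trans (Formula.subst_var Φ)]
      rfl
    exact (hT.trans h₀).symm ▸ List.mem_cons_self
  | succ m ih =>
    have := T.mono m (List.mem_map_of_mem (f := Formula.shift) ih)
    have h₁ : (Φ.subst fun _ h x => (ν h x).at_ m).neg.shift =
        (Φ.subst fun _ h x => (ν h x).at_ (m + 1)).neg := by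
      rw [Formula.shift, Formula.rename, Formula.rename_subst]
      exact congrArg (fun s => (Formula.subst s Φ).neg) (hsub _ _)
    exact cast (congrArg (fun A => A ∈ T.hyps (m + 1)) h₁) this

end FiniteType

namespace FiniteType

namespace Struct

variable {M : Struct .second}

/-! ### Definability with parameters -/

/-- Concatenation of assignments. -/
def Env.append {Γ' : Ctx} (e' : M.Env Γ') : {Γ : Ctx} → M.Env Γ → M.Env (Γ ++ Γ')
  | [], _ => e'
  | _ :: _, e => fun
    | _, h, .zero => e h .zero
    | _, h, .succ x => Env.append e' (fun _ h x => e h (.succ x)) h x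

theorem Env.append_cons {Γ Γ' : Ctx} {ρ : Ty} (a : M.D ρ) (e : M.Env Γ) (e' : M.Env Γ') :
    Env.append e' (.cons a e) = .cons a (Env.append e' e) := by
  funext σ h x
  cases x <;> rfl

end Struct

/-- Renaming of the last variables of a context. -/
def Ren.liftAll {Γ₁ Γ₂ : Ctx} (r : Ren Γ₁ Γ₂) : (Γ : Ctx) → Ren (Γ ++ Γ₁) (Γ ++ Γ₂)
  | [] => r
  | _ :: Γ => (Ren.liftAll r Γ).lift

/-- Inclusion of the first part of a context. -/
def Ren.inl {Γ₂ : Ctx} : {Γ₁ : Ctx} → Ren Γ₁ (Γ₁ ++ Γ₂)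
  | [] => fun _ x => (Henkin.noVar x).elim
  | _ :: _ => fun
    | _, .zero => .zero
    | _, .succ x => .succ (Ren.inl x)

/-- Inclusion of the second part of a context. -/
def Ren.inr {Γ₂ : Ctx} : (Γ₁ : Ctx) → Ren Γ₂ (Γ₁ ++ Γ₂)
  | [] => fun _ x => x
  | _ :: Γ₁ => fun _ x => .succ (Ren.inr Γ₁ x)

namespace Struct

variable {M : Struct .second}

theorem Env.append_liftAll {Γ₁ Γ₂ : Ctx} (r : Ren Γ₁ Γ₂) (e₂ : M.Env Γ₂) {Γ : Ctx}
    (e : M.Env Γ) : (fun _ h x => Env.append e₂ e h (r.liftAll Γ x) : M.Env (Γ ++ Γ₁)) =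
      Env.append (fun _ h x => e₂ h (r x)) e := by
  induction Γ with
  | nil => rfl
  | cons ρ Γ ih =>
    funext σ h x
    cases x with
    | zero => rfl
    | succ x => exact congrFun (congrFun (congrFun (ih fun _ h x => e h x.succ) σ) h) x

theorem Env.append_inl {Γ₁ Γ₂ : Ctx} (e₁ : M.Env Γ₁) (e₂ : M.Env Γ₂) :
    (fun _ h x => Env.append e₂ e₁ h (Ren.inl x) : M.Env Γ₁) = e₁ := by
  induction Γ₁ with
  | nil => funext σ h x; exact (Henkin.noVar x).elim
  | cons ρ Γ ih =>
    funext σ h x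
    cases x with
    | zero => rfl
    | succ x => exact congrFun (congrFun (congrFun (ih fun _ h x => e₁ h x.succ) σ) h) x

theorem Env.append_inr {Γ₁ Γ₂ : Ctx} (e₁ : M.Env Γ₁) (e₂ : M.Env Γ₂) :
    (fun _ h x => Env.append e₂ e₁ h (Ren.inr Γ₁ x) : M.Env Γ₂) = e₂ := by
  induction Γ₁ with
  | nil => rfl
  | cons ρ Γ ih => exact ih fun _ h x => e₁ h x.succ

/-- A predicate on assignments that is given by a formula with parameters. -/
def Def {Γ : Ctx} (P : M.Env Γ → Prop) : Prop :=
  ∃ (Γ' : Ctx) (e' : M.Env Γ') (A : Formula .second (Γ ++ Γ')),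
    ∀ e, P e ↔ M.Sat (Env.append e' e) A

/-- A function on assignments that is given by a term with parameters. -/
def DefT {Γ : Ctx} {σ : Ty} (g : M.Env Γ → M.D σ) : Prop :=
  ∃ (Γ' : Ctx) (e' : M.Env Γ') (t : Term .second (Γ ++ Γ') σ),
    ∀ e, g e = M.eval (Env.append e' e) t

section
variable {Γ : Ctx}

theorem sat_liftAll {Γ₁ Γ₂ : Ctx} (r : Ren Γ₁ Γ₂) (e₂ : M.Env Γ₂) (e : M.Env Γ)
    (A : Formula .second (Γ ++ Γ₁)) : M.Sat (Env.append e₂ e) (A.rename (r.liftAll Γ)) ↔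
      M.Sat (Env.append (fun _ h x => e₂ h (r x)) e) A := by
  rw [sat_rename, Env.append_liftAll]

theorem eval_liftAll {Γ₁ Γ₂ : Ctx} (r : Ren Γ₁ Γ₂) (e₂ : M.Env Γ₂) (e : M.Env Γ) {σ : Ty}
    (t : Term .second (Γ ++ Γ₁) σ) : M.eval (Env.append e₂ e) (t.rename (r.liftAll Γ)) =
      M.eval (Env.append (fun _ h x => e₂ h (r x)) e) t := by
  rw [eval_rename, Env.append_liftAll]

/-- The two definitions may use different parameters; both are renamed into the concatenated
parameter context. -/
theorem Def.combine {P Q R : M.Env Γ → Prop} (hP : Def P) (hQ : Def Q)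
    (op : ∀ {Δ : Ctx}, Formula .second Δ → Formula .second Δ → Formula .second Δ)
    (hR : ∀ {Δ : Ctx} (A B : Formula .second Δ) (e : M.Env Δ) (e₀ : M.Env Γ),
      (P e₀ ↔ M.Sat e A) → (Q e₀ ↔ M.Sat e B) → (R e₀ ↔ M.Sat e (op A B))) : Def R := by
  obtain ⟨Γ₁, e₁, A, hA⟩ := hP
  obtain ⟨Γ₂, e₂, B, hB⟩ := hQ
  refine ⟨Γ₁ ++ Γ₂, Env.append e₂ e₁,
    op (A.rename (Ren.inl.liftAll Γ)) (B.rename ((Ren.inr Γ₁).liftAll Γ)), fun e => hR _ _ _ _ ?_ ?_⟩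
  · rw [sat_liftAll, Env.append_inl]
    exact hA e
  · rw [sat_liftAll, Env.append_inr]
    exact hB e

theorem DefT.combine {σ₁ σ₂ : Ty} {f : M.Env Γ → M.D σ₁} {g : M.Env Γ → M.D σ₂} (hf : DefT f)
    (hg : DefT g) : ∃ (Γ' : Ctx) (e' : M.Env Γ') (s : Term .second (Γ ++ Γ') σ₁)
      (t : Term .second (Γ ++ Γ') σ₂), ∀ e, f e = M.eval (Env.append e' e) s ∧
        g e = M.eval (Env.append e' e) t := by
  obtain ⟨Γ₁, e₁, s, hs⟩ := hf
  obtain ⟨Γ₂, e₂, t, ht⟩ := hg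
  refine ⟨Γ₁ ++ Γ₂, Env.append e₂ e₁, s.rename (Ren.inl.liftAll Γ),
    t.rename ((Ren.inr Γ₁).liftAll Γ), fun e => ⟨?_, ?_⟩⟩
  · rw [eval_liftAll, Env.append_inl]
    exact hs e
  · rw [eval_liftAll, Env.append_inr]
    exact ht e

theorem DefT.app {σ τ : Ty} {f : M.Env Γ → M.D (σ ⇾ τ)} {g : M.Env Γ → M.D σ} (hf : DefT f)
    (hg : DefT g) : DefT fun e => M.app (f e) (g e) := by
  obtain ⟨Γ', e', s, t, h⟩ := hf.combine hg
  refine ⟨Γ', e', .app s t, fun e => ?_⟩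
  beta_reduce
  rw [(h e).1, (h e).2]
  rfl

theorem DefT.var {σ : Ty} {h : Fragment.second.varTy σ} {x : Var Γ σ} :
    DefT fun e : M.Env Γ => e h x := by
  refine ⟨[], fun _ _ x => (Henkin.noVar x).elim, .var h (Ren.inl x), fun e => ?_⟩
  exact (congrFun (congrFun (congrFun (Env.append_inl e _) σ) h) x).symm

theorem DefT.param {σ : Ty} (h : Fragment.second.varTy σ) (a : M.D σ) :
    DefT fun _ : M.Env Γ => a := by
  refine ⟨[σ], .cons a fun _ _ x => (Henkin.noVar x).elim, .var h (Ren.inr Γ .zero), fun e => ?_⟩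
  exact (congrFun (congrFun (congrFun (Env.append_inr e
    (.cons a fun _ _ x => (Henkin.noVar x).elim)) σ) h) (.zero : Var [σ] σ)).symm

theorem DefT.const {a : M.D .nat} : DefT fun _ : M.Env Γ => a := .param (.inl rfl) a

theorem DefT.constOne {a : M.D .one} : DefT fun _ : M.Env Γ => a := .param (.inr rfl) a

theorem DefT.closed {σ : Ty} (t : ∀ {Δ : Ctx}, Term .second Δ σ) (a : M.D σ)
    (h : ∀ {Δ : Ctx} (e : M.Env Δ), M.eval e t = a) : DefT fun _ : M.Env Γ => a :=
  ⟨[], fun _ _ x => (Henkin.noVar x).elim, t, fun _ => (h _).symm⟩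

theorem Def.eq {f g : M.Env Γ → M.D .nat} (hf : DefT f) (hg : DefT g) :
    Def fun e => f e = g e := by
  obtain ⟨Γ', e', s, t, h⟩ := hf.combine hg
  refine ⟨Γ', e', s ≐ t, fun e => ?_⟩
  beta_reduce
  rw [(h e).1, (h e).2]
  rfl

theorem Def.and {P Q : M.Env Γ → Prop} (hP : Def P) (hQ : Def Q) : Def fun e => P e ∧ Q e :=
  hP.combine hQ .and fun _ _ _ _ h h' => and_congr h h'

theorem Def.or {P Q : M.Env Γ → Prop} (hP : Def P) (hQ : Def Q) : Def fun e => P e ∨ Q e :=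
  hP.combine hQ .or fun _ _ _ _ h h' => or_congr h h'

theorem Def.imp {P Q : M.Env Γ → Prop} (hP : Def P) (hQ : Def Q) : Def fun e => P e → Q e :=
  hP.combine hQ .imp fun _ _ _ _ h h' => imp_congr h h'

theorem Def.iff {P Q : M.Env Γ → Prop} (hP : Def P) (hQ : Def Q) : Def fun e => P e ↔ Q e := by
  simp only [iff_iff_implies_and_implies]
  exact (hP.imp hQ).and (hQ.imp hP)

theorem Def.bot : Def fun _ : M.Env Γ => False :=
  ⟨[], fun _ _ x => (Henkin.noVar x).elim, .bot, fun _ => Iff.rfl⟩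

theorem Def.not {P : M.Env Γ → Prop} (hP : Def P) : Def fun e => ¬ P e := hP.imp .bot

/-- Parameters sit at the end of the context, so the variable to be bound is the head and the
quantifier applies directly. -/
theorem Def.all {σ : Ty} {hσ : Fragment.second.varTy σ} {Q : M.D σ → M.Env Γ → Prop}
    (hQ : Def fun e : M.Env (σ :: Γ) => Q (e hσ .zero) (fun _ h x => e h (.succ x))) :
    Def fun e => ∀ a, Q a e := by
  obtain ⟨Γ', e', A, hA⟩ := hQ
  refine ⟨Γ', e', .all σ hσ A, fun e => forall_congr' fun a => ?_⟩
  exact (hA (.cons a e)).trans (by rw [Env.append_cons])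

theorem Def.ex {σ : Ty} {hσ : Fragment.second.varTy σ} {Q : M.D σ → M.Env Γ → Prop}
    (hQ : Def fun e : M.Env (σ :: Γ) => Q (e hσ .zero) (fun _ h x => e h (.succ x))) :
    Def fun e => ∃ a, Q a e := by
  obtain ⟨Γ', e', A, hA⟩ := hQ
  refine ⟨Γ', e', .ex σ hσ A, fun e => exists_congr fun a => ?_⟩
  exact (hA (.cons a e)).trans (by rw [Env.append_cons])

theorem varTy_nat : Fragment.second.varTy .nat := .inl rfl

theorem varTy_one : Fragment.second.varTy .one := .inr rfl

theorem Def.allN {Q : M.D .nat → M.Env Γ → Prop}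
    (hQ : Def fun e : M.Env (.nat :: Γ) => Q (e varTy_nat .zero) (fun _ h x => e h (.succ x))) :
    Def fun e => ∀ a, Q a e := .all hQ

theorem Def.exN {Q : M.D .nat → M.Env Γ → Prop}
    (hQ : Def fun e : M.Env (.nat :: Γ) => Q (e varTy_nat .zero) (fun _ h x => e h (.succ x))) :
    Def fun e => ∃ a, Q a e := .ex hQ

theorem DefT.weak {σ τ : Ty} {f : M.Env Γ → M.D τ} (hf : DefT f) :
    DefT fun e : M.Env (σ :: Γ) => f fun _ h x => e h (.succ x) := by
  obtain ⟨Γ', e', t, ht⟩ := hf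
  refine ⟨Γ', e', t.shift, fun e => (ht _).trans ?_⟩
  rw [Term.shift, eval_rename]
  rfl

theorem Def.comp {P : M.D .nat → Prop} {f : M.Env Γ → M.D .nat}
    (hP : Def fun e : M.Env [.nat] => P (e varTy_nat .zero)) (hf : DefT f) :
    Def fun e => P (f e) := by
  obtain ⟨Γ₁, e₁, A, hA⟩ := hP
  obtain ⟨Γ₂, e₂, t, ht⟩ := hf
  refine ⟨Γ₁ ++ Γ₂, Env.append e₂ e₁, A.subst (Sub.cons (t.rename ((Ren.inr Γ₁).liftAll Γ))
    fun _ h x => .var h (Ren.inr Γ (Ren.inl x))), fun e => ?_⟩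
  have h₁ := hA (.cons (f e) fun _ _ x => (Henkin.noVar x).elim)
  rw [Env.append_cons] at h₁
  refine h₁.trans ?_
  rw [sat_subst]
  refine iff_of_eq (congrArg (M.Sat · A) ?_)
  funext σ h x
  cases x with
  | zero =>
    change f e = M.eval _ (t.rename _)
    rw [eval_liftAll, Env.append_inr]
    exact ht e
  | succ x =>
    change e₁ h x = Env.append (Env.append e₂ e₁) e h (Ren.inr Γ (Ren.inl x))
    rw [congrFun (congrFun (congrFun (Env.append_inr e (Env.append e₂ e₁)) σ) h) (Ren.inl x)]
    exact (congrFun (congrFun (congrFun (Env.append_inl e₁ e₂) σ) h) x).symm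

theorem Def.congr {P Q : M.Env Γ → Prop} (hP : Def P) (h : ∀ e, Q e ↔ P e) : Def Q := by
  rwa [show Q = P from funext fun e => propext (h e)]

end

/-- Induction for definable predicates. -/
theorem ind [hM : IsModel M] {P : M.D .nat → Prop}
    (hP : Def fun e : M.Env [.nat] => P (e varTy_nat .zero)) (h₀ : P M.zero)
    (hs : ∀ n, P n → P (M.app M.succ n)) (n : M.D .nat) : P n := by
  obtain ⟨Γ', e', A, hA⟩ := hP
  have key : ∀ n, P n ↔ M.Sat (.cons n e') A := fun n => by
    have := hA (.cons n fun _ _ x => (Henkin.noVar x).elim)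
    rwa [Env.append_cons] at this
  rw [key]
  refine hM.induction A e' ((key _).1 h₀) (fun n hn => (key _).1 (hs n ((key n).2 hn))) n

end Struct

end FiniteType

namespace FiniteType

namespace Struct

/-- The numbers of a structure. -/
abbrev N (M : Struct .second) : Type := M.D .nat

variable {M : Struct .second}

/-! ### Arithmetic in a model -/

instance : Zero (M.D .nat) := ⟨M.zero⟩
instance : One (M.D .nat) := ⟨M.app M.succ M.zero⟩
instance : Add (M.D .nat) := ⟨fun a b => M.app (M.app M.add a) b⟩
instance : Mul (M.D .nat) := ⟨fun a b => M.app (M.app M.mul a) b⟩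

section
variable {Γ : Ctx}

theorem DefT.zero : DefT fun _ : M.Env Γ => (0 : M.N) := .const

theorem DefT.one : DefT fun _ : M.Env Γ => (1 : M.N) := .const

theorem DefT.add {f g : M.Env Γ → M.N} (hf : DefT f) (hg : DefT g) : DefT fun e => f e + g e :=
  .app (.app (.closed .add M.add fun _ => rfl) hf) hg

theorem DefT.mul {f g : M.Env Γ → M.N} (hf : DefT f) (hg : DefT g) : DefT fun e => f e * g e :=
  .app (.app (.closed .mul M.mul fun _ => rfl) hf) hg

end

section Arithmetic
variable [hM : IsModel M]

theorem succ_eq (a : M.N) : M.app M.succ a = a + 1 := by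
  change _ = M.app (M.app M.add a) (M.app M.succ M.zero)
  rw [hM.add_succ, hM.add_zero]

/-- As `M` may be nonstandard, induction holds only for definable predicates. Each use therefore
supplies a definition, assembled from the closure lemmas for `Def` and `DefT` along the shape of the
predicate. -/
theorem nat_ind {P : M.N → Prop} (hP : Def fun e : M.Env [.nat] => P (e varTy_nat .zero))
    (h₀ : P 0) (hs : ∀ n, P n → P (n + 1)) (n : M.N) : P n :=
  ind hP h₀ (fun n hn => succ_eq n ▸ hs n hn) n

theorem nat_add_zero (a : M.N) : a + 0 = a := hM.add_zero a

theorem nat_add_succ (a b : M.N) : a + (b + 1) = a + b + 1 := by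
  rw [← succ_eq, ← succ_eq]
  exact hM.add_succ a b

theorem nat_mul_zero (a : M.N) : a * 0 = 0 := hM.mul_zero a

theorem nat_mul_succ (a b : M.N) : a * (b + 1) = a * b + a := by
  rw [← succ_eq]
  exact hM.mul_succ a b

theorem nat_zero_add (a : M.N) : 0 + a = a := by
  refine nat_ind (P := fun a => 0 + a = a) (.eq (.add .zero .var) .var) (nat_add_zero 0) ?_ a
  intro n hn
  rw [nat_add_succ, hn]

theorem nat_succ_add (a b : M.N) : a + 1 + b = a + b + 1 := by
  refine nat_ind (P := fun b => a + 1 + b = a + b + 1)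
    (.eq (.add .const .var) (.add (.add .const .var) .const)) ?_ ?_ b
  · rw [nat_add_zero, nat_add_zero]
  · intro n hn
    rw [nat_add_succ, hn, nat_add_succ]

theorem nat_add_comm (a b : M.N) : a + b = b + a := by
  refine nat_ind (P := fun b => a + b = b + a) (.eq (.add .const .var) (.add .var .const)) ?_ ?_ b
  · rw [nat_add_zero, nat_zero_add]
  · intro n hn
    rw [nat_add_succ, hn, nat_succ_add]

theorem nat_add_assoc (a b c : M.N) : a + b + c = a + (b + c) := by
  refine nat_ind (P := fun c => a + b + c = a + (b + c))
    (.eq (.add .const .var) (.add .const (.add .const .var))) ?_ ?_ c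
  · rw [nat_add_zero, nat_add_zero]
  · intro n hn
    rw [nat_add_succ, hn, nat_add_succ, nat_add_succ]

theorem nat_zero_mul (a : M.N) : 0 * a = 0 := by
  refine nat_ind (P := fun a => 0 * a = 0) (.eq (.mul .zero .var) .zero) (nat_mul_zero 0) ?_ a
  intro n hn
  rw [nat_mul_succ, hn, nat_add_zero]

theorem nat_succ_mul (a b : M.N) : (a + 1) * b = a * b + b := by
  refine nat_ind (P := fun b => (a + 1) * b = a * b + b)
    (.eq (.mul .const .var) (.add (.mul .const .var) .var)) ?_ ?_ b
  · rw [nat_mul_zero, nat_mul_zero, nat_add_zero]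
  · intro n hn
    rw [nat_mul_succ, hn, nat_mul_succ, nat_add_succ (a * n + n), nat_add_succ (a * n + a),
      nat_add_assoc (a * n) n a, nat_add_comm n a, ← nat_add_assoc (a * n) a n]

theorem nat_mul_comm (a b : M.N) : a * b = b * a := by
  refine nat_ind (P := fun b => a * b = b * a) (.eq (.mul .const .var) (.mul .var .const)) ?_ ?_ b
  · rw [nat_mul_zero, nat_zero_mul]
  · intro n hn
    rw [nat_mul_succ, hn, nat_succ_mul]

theorem nat_mul_add (a b c : M.N) : a * (b + c) = a * b + a * c := by
  refine nat_ind (P := fun c => a * (b + c) = a * b + a * c)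
    (.eq (.mul .const (.add .const .var)) (.add .const (.mul .const .var))) ?_ ?_ c
  · rw [nat_add_zero, nat_mul_zero, nat_add_zero]
  · intro n hn
    rw [nat_add_succ, nat_mul_succ, hn, nat_mul_succ, nat_add_assoc]

theorem nat_mul_assoc (a b c : M.N) : a * b * c = a * (b * c) := by
  refine nat_ind (P := fun c => a * b * c = a * (b * c))
    (.eq (.mul .const .var) (.mul .const (.mul .const .var))) ?_ ?_ c
  · rw [nat_mul_zero, nat_mul_zero, nat_mul_zero]
  · intro n hn
    rw [nat_mul_succ, hn, nat_mul_succ, nat_mul_add]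

theorem nat_mul_one (a : M.N) : a * 1 = a := by
  rw [← nat_zero_add 1, nat_mul_succ, nat_mul_zero, nat_zero_add]

instance : CommSemiring (M.D .nat) where
  add_assoc := nat_add_assoc
  zero_add := nat_zero_add
  add_zero := nat_add_zero
  add_comm := nat_add_comm
  left_distrib := nat_mul_add
  right_distrib a b c := by
    rw [nat_mul_comm, nat_mul_add, nat_mul_comm c a, nat_mul_comm c b]
  zero_mul := nat_zero_mul
  mul_zero := nat_mul_zero
  mul_assoc := nat_mul_assoc
  one_mul a := by rw [nat_mul_comm, nat_mul_one]
  mul_one := nat_mul_one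
  mul_comm := nat_mul_comm
  nsmul := nsmulRec

theorem add_one_ne_zero' (a : M.N) : a + 1 ≠ 0 := by
  rw [← succ_eq]
  exact hM.succ_ne_zero a

theorem add_one_inj {a b : M.N} (h : a + 1 = b + 1) : a = b := by
  rw [← succ_eq, ← succ_eq] at h
  exact hM.succ_inj h

theorem eq_zero_or_succ (a : M.N) : a = 0 ∨ ∃ b, a = b + 1 := by
  refine nat_ind (P := fun a => a = 0 ∨ ∃ b, a = b + 1)
    (.or (.eq .var .zero) (.exN (.eq .var (.add .var .one)))) (.inl rfl) ?_ a
  exact fun n _ => .inr ⟨n, rfl⟩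

instance : IsCancelAdd (M.D .nat) :=
  have h : ∀ a b c : M.N, b + a = c + a → b = c := fun a b c => by
    refine nat_ind (P := fun a => b + a = c + a → b = c)
      (.imp (.eq (.add .const .var) (.add .const .var)) (.eq .const .const)) ?_ ?_ a
    · simp
    · intro n hn h
      rw [← add_assoc, ← add_assoc] at h
      exact hn (add_one_inj h)
  { add_left_cancel := fun a b c hbc => h a b c (by rwa [add_comm b, add_comm c])
    add_right_cancel := fun a b c hbc => h a b c hbc }

theorem eq_zero_of_add_eq_zero' {a b : M.N} (h : a + b = 0) : b = 0 := by
  rcases eq_zero_or_succ b with rfl | ⟨b, rfl⟩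
  · rfl
  · rw [← add_assoc] at h
    exact absurd h (add_one_ne_zero' _)

instance : LE (M.D .nat) := ⟨fun a b => ∃ c, b = a + c⟩

theorem nat_le_total (a b : M.N) : a ≤ b ∨ b ≤ a := by
  refine nat_ind (P := fun a => (∃ c, b = a + c) ∨ ∃ c, a = b + c)
    (.or (.exN (.eq .const (.add .var .var))) (.exN (.eq .var (.add .const .var)))) ?_ ?_ a
  · exact .inl ⟨b, (zero_add b).symm⟩
  · rintro n (⟨c, rfl⟩ | ⟨c, rfl⟩)
    · rcases eq_zero_or_succ c with rfl | ⟨c, rfl⟩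
      · exact .inr ⟨1, by rw [add_zero]⟩
      · exact .inl ⟨c, by ring⟩
    · exact .inr ⟨c + 1, by ring⟩

open Classical in
noncomputable instance : LinearOrder (M.D .nat) where
  le_refl a := ⟨0, (add_zero a).symm⟩
  le_trans := by
    rintro a _ _ ⟨c, rfl⟩ ⟨d, rfl⟩
    exact ⟨c + d, add_assoc _ _ _⟩
  le_antisymm := by
    rintro a _ ⟨c, rfl⟩ ⟨d, hd⟩
    rw [add_assoc] at hd
    have : c + d = 0 := (add_left_cancel (a := a) (by rw [add_zero]; exact hd)).symm
    rw [add_comm] at this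
    rw [eq_zero_of_add_eq_zero' this, add_zero]
  le_total := nat_le_total
  toDecidableLE := Classical.decRel _

instance : CanonicallyOrderedAdd (M.D .nat) where
  exists_add_of_le := fun ⟨c, hc⟩ => ⟨c, hc⟩
  le_add_self _ b := ⟨b, add_comm _ _⟩
  le_self_add _ b := ⟨b, rfl⟩

instance : IsOrderedAddMonoid (M.D .nat) where
  add_le_add_left := by
    rintro a _ ⟨c, rfl⟩ b
    exact ⟨c, by ring⟩

theorem lt_add_one_iff' {a b : M.N} : a < b + 1 ↔ a ≤ b := by
  constructor
  · intro h
    obtain ⟨c, hc⟩ := h.le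
    rcases eq_zero_or_succ c with rfl | ⟨c, rfl⟩
    · rw [add_zero] at hc
      exact absurd hc.symm h.ne
    · exact ⟨c, add_one_inj (by rw [hc]; ring)⟩
  · rintro ⟨c, rfl⟩
    refine lt_of_le_of_ne ⟨c + 1, by ring⟩ fun h => ?_
    have : (0 : M.N) = c + 1 := add_left_cancel (a := a) (by rw [add_zero]; exact h.trans (add_assoc _ _ _))
    exact add_one_ne_zero' _ this.symm

theorem add_one_le_iff' {a b : M.N} : a + 1 ≤ b ↔ a < b := by
  rw [← not_lt, lt_add_one_iff', not_le]

theorem lt_add_one' (a : M.N) : a < a + 1 := lt_add_one_iff'.2 le_rfl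

theorem nat_mul_pos {a b : M.N} (ha : 0 < a) (hb : 0 < b) : 0 < a * b := by
  rcases eq_zero_or_succ a with rfl | ⟨a, rfl⟩
  · exact absurd ha (lt_irrefl _)
  rcases eq_zero_or_succ b with rfl | ⟨b, rfl⟩
  · exact absurd hb (lt_irrefl _)
  rw [pos_iff_ne_zero, show (a + 1) * (b + 1) = (a * b + a + b) + 1 by ring]
  exact add_one_ne_zero' _

instance : Nontrivial (M.D .nat) := ⟨0, 1, fun h => add_one_ne_zero' (0 : M.N) (by rw [zero_add, ← h])⟩

theorem nat_mul_lt_mul_left {a b c : M.N} (ha : 0 < a) (h : b < c) : a * b < a * c := by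
  obtain ⟨d, rfl⟩ := h.le
  have hd : 0 < d := by
    rw [pos_iff_ne_zero]
    rintro rfl
    exact h.ne (add_zero b).symm
  rw [mul_add]
  exact lt_add_of_pos_right _ (nat_mul_pos ha hd)

instance : IsStrictOrderedRing (M.D .nat) where
  zero_le_one := zero_le
  le_of_add_le_add_left _ _ _ := le_of_add_le_add_left
  mul_lt_mul_of_pos_left _ ha _ _ h := nat_mul_lt_mul_left ha h
  mul_lt_mul_of_pos_right a ha b c h := by
    change b * a < c * a
    rw [mul_comm b, mul_comm c]
    exact nat_mul_lt_mul_left ha h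

/-- The least number principle. -/
theorem exists_least {P : M.N → Prop} (hP : Def fun e : M.Env [.nat] => P (e varTy_nat .zero))
    {n : M.N} (hn : P n) : ∃ m, P m ∧ ∀ k < m, ¬ P k := by
  by_contra! h
  -- Strong induction: no `k ≤ n` satisfies `P`, with the inequality written out as an existential
  -- statement.
  have : ∀ n, ∀ k, (∃ c, n = k + c) → ¬ P k := by
    refine nat_ind (.allN (.imp (.exN (.eq .var (.add .var .var))) (.not (.comp hP .var)))) ?_ ?_
    · rintro k ⟨c, hc⟩ hk
      obtain ⟨m, hm, -⟩ := h k hk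
      have : k = 0 := eq_zero_of_add_eq_zero' (a := c) (by rw [add_comm, ← hc])
      exact not_lt_zero (this ▸ hm)
    · rintro n ih k hk hPk
      obtain ⟨m, hm, hPm⟩ := h k hPk
      exact ih m (lt_add_one_iff'.1 (hm.trans_le hk)) hPm
  exact this n n ⟨0, (add_zero n).symm⟩ hn

end Arithmetic

end Struct

end FiniteType

namespace FiniteType

namespace Struct

variable {M : Struct .second}

/-! ### Definability of the order. -/

section
variable {Γ : Ctx} [IsModel M]

theorem Def.le {f g : M.Env Γ → M.N} (hf : DefT f) (hg : DefT g) : Def fun e => f e ≤ g e :=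
  .exN (.eq hg.weak (.add hf.weak .var))

theorem Def.lt {f g : M.Env Γ → M.N} (hf : DefT f) (hg : DefT g) : Def fun e => f e < g e := by
  simp only [← add_one_le_iff']
  exact .le (.add hf .one) hg

end

/-! ### Representable functions -/

/-- The functions that are given by application of an object. -/
def Rep {σ τ : Ty} (φ : M.D σ → M.D τ) : Prop := ∃ f : M.D (σ ⇾ τ), ∀ a, M.app f a = φ a

/-- The functions on numbers that are given by an object of type `1`. -/
abbrev Rec (φ : M.N → M.N) : Prop := Rep φ

/-- Application of the recursor. -/
def recN (n y : M.N) (z : M.D (.nat ⇾ .nat ⇾ .nat)) : M.N :=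
  M.app (M.app (M.app (M.recursor .nat rfl) n) y) z

/-- The pointwise application of a binary operation. -/
def ap₂ {δ ρ σ τ : Ty} (o : M.D (ρ ⇾ σ ⇾ τ)) (f : M.D (δ ⇾ ρ)) (g : M.D (δ ⇾ σ)) : M.D (δ ⇾ τ) :=
  M.app (M.app (M.comb δ σ τ) (M.app (M.app (M.comb δ ρ (σ ⇾ τ)) (M.app (M.proj _ δ) o)) f)) g

/-- Composition. -/
def comp {δ ρ τ : Ty} (f : M.D (ρ ⇾ τ)) (g : M.D (δ ⇾ ρ)) : M.D (δ ⇾ τ) :=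
  M.app (M.app (M.comb δ ρ τ) (M.app (M.proj _ δ) f)) g

/-- A pairing function. -/
def pair (a b : M.N) : M.N := (a + b) * (a + b) + a

section
variable [hM : IsModel M]

theorem ap₂_app {δ ρ σ τ : Ty} (o : M.D (ρ ⇾ σ ⇾ τ)) (f : M.D (δ ⇾ ρ)) (g : M.D (δ ⇾ σ))
    (a : M.D δ) : M.app (ap₂ o f g) a = M.app (M.app o (M.app f a)) (M.app g a) := by
  simp only [ap₂, hM.comb_eq, hM.proj_eq]

theorem comp_app {δ ρ τ : Ty} (f : M.D (ρ ⇾ τ)) (g : M.D (δ ⇾ ρ)) (a : M.D δ) :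
    M.app (comp f g) a = M.app f (M.app g a) := by
  simp only [comp, hM.comb_eq, hM.proj_eq]

theorem recN_zero (y : M.N) (z : M.D (.nat ⇾ .nat ⇾ .nat)) : recN 0 y z = y := hM.rec_zero y z

theorem recN_succ (n y : M.N) (z : M.D (.nat ⇾ .nat ⇾ .nat)) :
    recN (n + 1) y z = M.app (M.app z (recN n y z)) n := by
  rw [← succ_eq]
  exact hM.rec_succ n y z

section
variable {ρ σ τ : Ty}

theorem Rep.id : Rep fun a : M.D σ => a :=
  ⟨M.app (M.app (M.comb σ (.nat ⇾ σ) σ) (M.proj σ (.nat ⇾ σ))) (M.proj σ .nat), fun a => by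
    simp only [hM.comb_eq, hM.proj_eq]⟩

theorem Rep.const (b : M.D τ) : Rep fun _ : M.D σ => b :=
  ⟨M.app (M.proj τ σ) b, fun a => hM.proj_eq b a⟩

theorem Rep.app {φ : M.D σ → M.D (ρ ⇾ τ)} {ψ : M.D σ → M.D ρ} (hφ : Rep φ) (hψ : Rep ψ) :
    Rep fun a => M.app (φ a) (ψ a) := by
  obtain ⟨f, hf⟩ := hφ
  obtain ⟨g, hg⟩ := hψ
  exact ⟨M.app (M.app (M.comb σ ρ τ) f) g, fun a => by rw [hM.comb_eq, hf, hg]⟩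

theorem Rep.comp {φ : M.D ρ → M.D τ} {ψ : M.D σ → M.D ρ} (hφ : Rep φ) (hψ : Rep ψ) :
    Rep fun a => φ (ψ a) := by
  obtain ⟨f, hf⟩ := hφ
  have := Rep.app (.const f) hψ
  simpa only [hf] using this

theorem Rep.of (f : M.D (σ ⇾ τ)) : Rep fun a => M.app f a := ⟨f, fun _ => rfl⟩

theorem Rep.ap₂ {δ ρ' : Ty} (o : M.D (ρ ⇾ ρ' ⇾ τ)) {φ : M.D σ → M.D (δ ⇾ ρ)}
    {ψ : M.D σ → M.D (δ ⇾ ρ')} (hφ : Rep φ) (hψ : Rep ψ) : Rep fun a => Struct.ap₂ o (φ a) (ψ a) :=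
  .app (.app (.const _) (.app (.app (.const _) (.const _)) hφ)) hψ

end

theorem Rec.add {f g : M.N → M.N} (hf : Rec f) (hg : Rec g) : Rec fun n => f n + g n :=
  .app (.app (.const _) hf) hg

theorem Rec.mul {f g : M.N → M.N} (hf : Rec f) (hg : Rec g) : Rec fun n => f n * g n :=
  .app (.app (.const _) hf) hg

theorem Rec.pair {f g : M.N → M.N} (hf : Rec f) (hg : Rec g) : Rec fun n => pair (f n) (g n) :=
  .add (.mul (.add hf hg) (.add hf hg)) hf

theorem Rec.comp {f g : M.N → M.N} (hf : Rec f) (hg : Rec g) : Rec fun n => f (g n) :=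
  Rep.comp hf hg

theorem Rec.recN {f g : M.N → M.N} {h : M.N → M.D (.nat ⇾ .nat ⇾ .nat)} (hf : Rec f) (hg : Rec g)
    (hh : Rep h) : Rec fun n => recN (f n) (g n) (h n) :=
  .app (.app (.app (.const _) hf) hg) hh

theorem DefT.recN {Γ : Ctx} {f g : M.Env Γ → M.N} {h : M.Env Γ → M.D (.nat ⇾ .nat ⇾ .nat)}
    (hf : DefT f) (hg : DefT g) (hh : DefT h) : DefT fun e => recN (f e) (g e) (h e) :=
  .app (.app (.app (.closed (.recursor .nat rfl) _ fun _ => rfl) hf) hg) hh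

/-! ### Truncated subtraction -/

open Classical in
noncomputable instance : _root_.Sub (M.D .nat) :=
  ⟨fun a b => if h : b ≤ a then h.choose else 0⟩

theorem nat_add_sub {a b : M.N} (h : b ≤ a) : b + (a - b) = a := by
  change b + (if h : b ≤ a then h.choose else 0) = a
  rw [dif_pos h]
  exact h.choose_spec.symm

theorem nat_sub_of_lt {a b : M.N} (h : a < b) : a - b = 0 := dif_neg h.not_ge

instance : OrderedSub (M.D .nat) where
  tsub_le_iff_right a b c := by
    rcases le_or_gt b a with h | h
    · rw [← nat_add_sub h, add_comm c, add_le_add_iff_left]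
      rw [nat_add_sub h]
    · rw [nat_sub_of_lt h]
      exact iff_of_true zero_le (h.le.trans le_add_self)

/-- Primitive recursion whose step ignores the previous value and returns its index. -/
theorem exists_pred : ∃ f : M.D .one, M.app f 0 = 0 ∧ ∀ n, M.app f (n + 1) = n := by
  obtain ⟨i, hi⟩ := Rep.id (M := M) (σ := .nat)
  obtain ⟨f, hf⟩ := Rec.recN (M := M) .id (.const 0) (.const (M.app (M.proj _ _) i))
  beta_reduce at hf hi
  refine ⟨f, by rw [hf, recN_zero], fun n => ?_⟩
  rw [hf, recN_succ, hM.proj_eq, hi]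

variable (M) in
/-- The predecessor function. -/
noncomputable def pred : M.D .one := (exists_pred (M := M)).choose

theorem pred_zero : M.app M.pred 0 = 0 := exists_pred.choose_spec.1

theorem pred_succ (n : M.N) : M.app M.pred (n + 1) = n := exists_pred.choose_spec.2 n

variable (M) in
/-- The function with the values `pred r`, as a step function for the recursor. -/
noncomputable def predStep : M.D (.nat ⇾ .nat ⇾ .nat) := comp (M.proj .nat .nat) M.pred

theorem predStep_app (r m : M.N) : M.app (M.app M.predStep r) m = M.app M.pred r := by
  rw [predStep, comp_app, hM.proj_eq]

/-- Subtraction was defined from the order by choice in the metatheory; iterating the predecessor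
shows that it is given by a term, hence is representable and definable. -/
theorem sub_eq_recN (a b : M.N) : a - b = recN b a M.predStep := by
  obtain ⟨h, hh⟩ := Rec.recN (M := M) .id (.const a) (.const M.predStep)
  beta_reduce at hh
  have key : ∀ b, (a ≤ b → M.app h b = 0) ∧ (b ≤ a → b + M.app h b = a) := by
    refine nat_ind (.and (.imp (.le .const .var) (.eq (.app .constOne .var) .zero))
      (.imp (.le .var .const) (.eq (.add .var (.app .constOne .var)) .const))) ?_ ?_
    · rw [hh, recN_zero]
      exact ⟨fun h => nonpos_iff_eq_zero.1 h, fun _ => zero_add a⟩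
    · intro b ⟨h₁, h₂⟩
      rw [hh] at h₁ h₂
      rw [hh, recN_succ, predStep_app]
      constructor
      · intro hab
        rcases hab.lt_or_eq with hab | rfl
        · rw [h₁ (lt_add_one_iff'.1 hab), pred_zero]
        · have := h₂ (lt_add_one' b).le
          rw [add_left_cancel this, ← zero_add (1 : M.N), pred_succ]
      · intro hab
        have := h₂ ((lt_add_one' b).le.trans hab)
        rcases eq_zero_or_succ (recN b a M.predStep) with h0 | ⟨c, hc⟩
        · rw [h0, add_zero] at this
          exact absurd (this ▸ hab) (lt_add_one' b).not_ge
        · rw [hc] at this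
          rw [hc, pred_succ, ← this]
          ring
  rw [← hh]
  rcases le_total b a with hab | hab
  · exact add_left_cancel ((nat_add_sub hab).trans ((key b).2 hab).symm)
  · rw [(key b).1 hab]
    exact tsub_eq_zero_of_le hab

theorem Rec.sub {f g : M.N → M.N} (hf : Rec f) (hg : Rec g) : Rec fun n => f n - g n := by
  simp only [sub_eq_recN]
  exact .recN hg hf (.const _)

theorem DefT.sub {Γ : Ctx} {f g : M.Env Γ → M.N} (hf : DefT f) (hg : DefT g) :
    DefT fun e => f e - g e := by
  simp only [sub_eq_recN]
  refine .recN hg hf (.app (.app (.closed (.comb _ _ _) _ fun _ => rfl)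
    (.app (.closed (.proj _ _) _ fun _ => rfl) (.closed (.proj _ _) _ fun _ => rfl))) .constOne)

/-! ### Choice and pairing -/

/-- The matrix is an equation `φ x y = 0`; other decidable conditions are brought to this form with
truncated subtraction. -/
theorem exists_choice {φ : M.N → M.N → M.N}
    (hφ : DefT fun e : M.Env [.nat, .nat] => φ (e varTy_nat (.succ .zero)) (e varTy_nat .zero))
    (h : ∀ x, ∃ y, φ x y = 0) : ∃ f, Rec f ∧ ∀ x, φ x (f x) = 0 := by
  obtain ⟨Γ', e', t, ht⟩ := hφ
  have key : ∀ x y, φ x y = 0 ↔ M.Sat (.cons y (.cons x e')) (t ≐ .zero) := fun x y => by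
    have := ht (.cons y (.cons x fun _ _ x => (Henkin.noVar x).elim))
    rw [Env.append_cons, Env.append_cons] at this
    change φ x y = _ at this
    rw [this]
    rfl
  simp only [key] at h ⊢
  obtain ⟨f, hf⟩ := hM.choice (Γ := Γ') (t ≐ .zero) trivial e' h
  exact ⟨fun x => M.app f x, .of f, hf⟩

theorem sq_lt_sq_succ (s : M.N) : s * s < (s + 1) * (s + 1) :=
  mul_lt_mul'' (lt_add_one' s) (lt_add_one' s) zero_le zero_le

theorem exists_sqrt (n : M.N) : ∃ s, s * s ≤ n ∧ n < (s + 1) * (s + 1) := by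
  refine nat_ind (P := fun n => ∃ s, s * s ≤ n ∧ n < (s + 1) * (s + 1))
    (.exN (.and (.le (.mul .var .var) .var) (.lt .var (.mul (.add .var .one) (.add .var .one)))))
    ?_ ?_ n
  · exact ⟨0, by simp, by simp⟩
  · rintro n ⟨s, hs, hs'⟩
    rcases lt_or_ge (n + 1) ((s + 1) * (s + 1)) with h | h
    · exact ⟨s, hs.trans (lt_add_one' n).le, h⟩
    · refine ⟨s + 1, h, ?_⟩
      rw [le_antisymm (add_one_le_iff'.2 hs') h]
      exact sq_lt_sq_succ _

theorem sqrt_unique {n s t : M.N} (hs : s * s ≤ n) (ht : n < (t + 1) * (t + 1)) : s ≤ t := by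
  by_contra! h
  have := add_one_le_iff'.2 h
  exact (hs.trans_lt ht).not_ge (mul_le_mul' this this)

theorem exists_sqrt_fun : ∃ f : M.N → M.N, Rec f ∧
    ∀ n, f n * f n ≤ n ∧ n < (f n + 1) * (f n + 1) := by
  obtain ⟨f, hf, h⟩ := exists_choice (M := M)
    -- The sum vanishes iff both differences do, that is iff `s² ≤ n` and `n + 1 ≤ (s + 1)²`.
    (φ := fun n s => (s * s - n) + (n + 1 - (s + 1) * (s + 1)))
    (.add (.sub (.mul .var .var) .var)
      (.sub (.add .var .one) (.mul (.add .var .one) (.add .var .one)))) fun n => by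
        obtain ⟨s, hs, hs'⟩ := exists_sqrt n
        refine ⟨s, ?_⟩
        rw [tsub_eq_zero_of_le hs, tsub_eq_zero_of_le (add_one_le_iff'.2 hs'), add_zero]
  refine ⟨f, hf, fun n => ?_⟩
  have := h n
  rw [add_eq_zero, tsub_eq_zero_iff_le, tsub_eq_zero_iff_le, add_one_le_iff'] at this
  exact this

/-- The integer square root. -/
noncomputable def sqrt : M.N → M.N := exists_sqrt_fun.choose

theorem Rec.sqrt : Rec (M := M) sqrt := exists_sqrt_fun.choose_spec.1

/-- `pair a b` lies between `(a + b)²` and `(a + b + 1)²`, so the root recovers `a + b` and the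
remainder recovers `a`. -/
theorem sqrt_pair (a b : M.N) : sqrt (pair a b) = a + b := by
  have h := exists_sqrt_fun.choose_spec.2 (pair a b)
  have h₁ : (a + b) * (a + b) ≤ pair a b := le_self_add
  have h₂ : pair a b < (a + b + 1) * (a + b + 1) := by
    rw [pair, show (a + b + 1) * (a + b + 1) = (a + b) * (a + b) + a + (a + b + b) + 1 by ring,
      lt_add_one_iff']
    exact le_self_add
  exact le_antisymm (sqrt_unique h.1 h₂) (sqrt_unique h₁ h.2)

/-- The first component of a pair. -/
noncomputable def fst (n : M.N) : M.N := n - sqrt n * sqrt n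

/-- The second component of a pair. -/
noncomputable def snd (n : M.N) : M.N := sqrt n - fst n

theorem fst_pair (a b : M.N) : fst (pair a b) = a := by
  rw [fst, sqrt_pair, pair, add_tsub_cancel_left]

theorem snd_pair (a b : M.N) : snd (pair a b) = b := by
  rw [snd, fst_pair, sqrt_pair, add_tsub_cancel_left]

theorem Rec.fst {f : M.N → M.N} (hf : Rec f) : Rec fun n => fst (f n) :=
  .sub hf (.mul (.comp .sqrt hf) (.comp .sqrt hf))

theorem Rec.snd {f : M.N → M.N} (hf : Rec f) : Rec fun n => snd (f n) :=
  .sub (.comp .sqrt hf) (.fst hf)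

theorem DefT.pair {Γ : Ctx} {f g : M.Env Γ → M.N} (hf : DefT f) (hg : DefT g) :
    DefT fun e => pair (f e) (g e) := .add (.mul (.add hf hg) (.add hf hg)) hf

theorem DefT.rec {Γ : Ctx} {φ : M.N → M.N} {f : M.Env Γ → M.N} (hφ : Rec φ) (hf : DefT f) :
    DefT fun e => φ (f e) := by
  obtain ⟨g, hg⟩ := hφ
  simp only [← hg]
  exact .app .constOne hf

/-- Quantifier-free choice for representable functions. -/
theorem exists_rec_choice {φ : M.N → M.N} (hφ : Rec φ) (h : ∀ x, ∃ y, φ (pair x y) = 0) :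
    ∃ f, Rec f ∧ ∀ x, φ (pair x (f x)) = 0 :=
  exists_choice (φ := fun x y => φ (pair x y)) (.rec hφ (.pair .var .var)) h

/-! ### Bounded sums and powers of two -/

/-- `s p n` is the sum of `φ (pair p k)` over `k < n`. The recursor takes a step function that must
itself depend representably on the parameter `p`, hence the explicit combinators. -/
theorem exists_sum {φ : M.N → M.N} (hφ : Rec φ) : ∃ s : M.N → M.N → M.N, (∀ p, s p 0 = 0) ∧
    (∀ p k, s p (k + 1) = s p k + φ (pair p k)) ∧
      ∀ u v, Rec u → Rec v → Rec fun q => s (u q) (v q) := by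
  obtain ⟨g, hg⟩ := hφ
  -- The combinator is chosen so that `b r h m = r + h m`.
  obtain ⟨b, hb⟩ := show Rep fun r : M.N => M.app (M.comb .nat .nat .nat)
      (M.app (M.app (M.comb .nat .nat _) (M.app (M.proj _ _) M.add)) (M.app (M.proj .nat .nat) r))
    from .app (.const _) (.app (.app (.const _) (.const _)) (.app (.const _) .id))
  let pairing (p : M.N) : M.D .one :=
    ap₂ M.add (ap₂ M.mul (M.app M.add p) (M.app M.add p)) (M.app (M.proj .nat .nat) p)
  have hpairing : Rep pairing := .ap₂ _ (.ap₂ _ (.of _) (.of _)) (.of _)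
  let step (p : M.N) : M.D (.nat ⇾ .nat ⇾ .nat) :=
    M.app (M.app (M.comb _ _ _) b) (M.app (M.proj _ _) (Struct.comp g (pairing p)))
  have hstep : Rep step :=
    .app (.const _) (.app (.const _) (.app (.const _) hpairing))
  have happ : ∀ p r m, M.app (M.app (step p) r) m = r + φ (pair p m) := by
    intro p r m
    simp only [step, hM.comb_eq, hM.proj_eq, hb, comp_app, pairing, ap₂_app, ← hg]
    rfl
  refine ⟨fun p n => recN n 0 (step p), fun p => recN_zero _ _, fun p k => ?_, fun u v hu hv => ?_⟩
  · beta_reduce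
    rw [recN_succ, happ]
  · exact .recN hv (.const 0) (hstep.comp hu)

theorem exists_exp : ∃ f : M.N → M.N, Rec f ∧ f 0 = 1 ∧ ∀ n, f (n + 1) = 2 * f n := by
  obtain ⟨z, hz⟩ := show Rep fun r : M.N => M.app (M.proj .nat .nat) (r + r) from
    .app (.const _) (.app (.app (.const _) .id) .id)
  refine ⟨fun n => recN n 1 z, .recN .id (.const 1) (.const z), recN_zero _ _, fun n => ?_⟩
  beta_reduce
  rw [recN_succ, hz, hM.proj_eq]
  ring

/-- The powers of two. -/
noncomputable def exp : M.N → M.N := exists_exp.choose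

theorem Rec.exp : Rec (M := M) exp := exists_exp.choose_spec.1

theorem exp_zero : exp (0 : M.N) = 1 := exists_exp.choose_spec.2.1

theorem exp_succ (n : M.N) : exp (n + 1) = 2 * exp n := exists_exp.choose_spec.2.2 n

end

end Struct

end FiniteType

namespace FiniteType

namespace Struct

variable {M : Struct .second} [hM : IsModel M]

/-! ### Coded finite sets -/

/-- The binary digit of `D` at the place `x` is `1`. -/
def Mem (x D : M.N) : Prop := ∃ q r, r < exp x ∧ D = (2 * q + 1) * exp x + r

theorem exp_pos (n : M.N) : 0 < exp n := by
  refine nat_ind (P := fun n => 0 < exp n) (.lt .zero (.rec .exp .var)) ?_ ?_ n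
  · rw [exp_zero]
    exact zero_lt_one
  · intro n hn
    rw [exp_succ]
    exact mul_pos two_pos hn

theorem exp_add (a b : M.N) : exp (a + b) = exp a * exp b := by
  refine nat_ind (P := fun b => exp (a + b) = exp a * exp b)
    (.eq (.rec .exp (.add .const .var)) (.mul .const (.rec .exp .var))) ?_ ?_ b
  · rw [add_zero, exp_zero, mul_one]
  · intro n hn
    rw [← add_assoc, exp_succ, hn, exp_succ]
    ring

theorem lt_exp (n : M.N) : n < exp n := by
  refine nat_ind (P := fun n => n < exp n) (.lt .var (.rec .exp .var)) (exp_pos 0) ?_ n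
  intro n hn
  rw [exp_succ, two_mul]
  exact add_lt_add_of_lt_of_le hn (by simpa using add_one_le_iff'.2 (exp_pos n))

theorem exists_div (a : M.N) {b : M.N} (hb : 0 < b) : ∃ q r, r < b ∧ a = q * b + r := by
  refine nat_ind (P := fun a => ∃ q r, r < b ∧ a = q * b + r)
    (.exN (.exN (.and (.lt .var .const) (.eq .var (.add (.mul .var .const) .var))))) ?_ ?_ a
  · exact ⟨0, 0, hb, by simp⟩
  · rintro _ ⟨q, r, hr, rfl⟩
    rcases (add_one_le_iff'.2 hr).lt_or_eq with h | h
    · exact ⟨q, r + 1, h, add_assoc _ _ _⟩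
    · exact ⟨q + 1, 0, hb, by rw [add_assoc, h]; ring⟩

theorem div_le {b q r q' r' : M.N} (hr : r < b) (h : q' * b + r' = q * b + r) : q' ≤ q := by
  by_contra! hq
  have h₁ : (q + 1) * b ≤ q' * b := mul_le_mul_left (add_one_le_iff'.2 hq) b
  have h₂ : q * b + r < (q + 1) * b := by
    rw [add_mul, one_mul]
    exact (add_lt_add_iff_left _).2 hr
  exact absurd h ((h₂.trans_le (h₁.trans le_self_add)).ne')

theorem div_unique {b q r q' r' : M.N} (hr : r < b) (hr' : r' < b) (h : q' * b + r' = q * b + r) :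
    q' = q ∧ r' = r := by
  have := le_antisymm (div_le hr h) (div_le hr' h.symm)
  subst this
  exact ⟨rfl, add_left_cancel h⟩

theorem even_or_odd' (q : M.N) : ∃ p, q = 2 * p ∨ q = 2 * p + 1 := by
  obtain ⟨p, r, hr, h⟩ := exists_div q (two_pos (α := M.N))
  refine ⟨p, ?_⟩
  rw [← one_add_one_eq_two, lt_add_one_iff'] at hr
  rcases hr.lt_or_eq with hr | rfl
  · rw [← zero_add (1 : M.N), lt_add_one_iff', nonpos_iff_eq_zero] at hr
    exact .inl (by rw [h, hr]; ring)
  · exact .inr (by rw [h]; ring)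

theorem even_ne_odd {p q : M.N} : 2 * p ≠ 2 * q + 1 := by
  intro h
  have h₁ : (1 : M.N) < 2 := one_lt_two
  have := div_unique (b := (2 : M.N)) (q' := p) (r' := 0) (q := q) (r := 1) h₁ two_pos
    (by rw [add_zero, mul_comm, h]; ring)
  exact zero_ne_one this.2

theorem mem_iff_odd {x D q r : M.N} (hr : r < exp x) (h : D = q * exp x + r) :
    Mem x D ↔ ∃ p, q = 2 * p + 1 := by
  constructor
  · rintro ⟨p, r', hr', h'⟩
    exact ⟨p, (div_unique hr' hr (h.symm.trans h')).1⟩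
  · rintro ⟨p, rfl⟩
    exact ⟨p, r, hr, h⟩

theorem not_mem_iff {x D : M.N} : ¬ Mem x D ↔ ∃ q r, r < exp x ∧ D = (2 * q) * exp x + r := by
  constructor
  · intro h
    obtain ⟨q, r, hr, hD⟩ := exists_div D (exp_pos x)
    obtain ⟨p, rfl | rfl⟩ := even_or_odd' q
    · exact ⟨p, r, hr, hD⟩
    · exact absurd ⟨p, r, hr, hD⟩ h
  · rintro ⟨q, r, hr, hD⟩ h
    obtain ⟨p, hp⟩ := (mem_iff_odd hr hD).1 h
    exact even_ne_odd hp

theorem Mem.lt {x D : M.N} (h : Mem x D) : x < D := by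
  obtain ⟨q, r, -, rfl⟩ := h
  refine (lt_exp x).trans_le ?_
  rw [show (2 * q + 1) * exp x + r = exp x + (2 * q * exp x + r) by ring]
  exact le_self_add

theorem not_mem_zero (x : M.N) : ¬ Mem x 0 := fun h => not_lt_zero h.lt

/-- If the digit of `D` at `x` is 0, adding `2^x` changes just that digit. At a place below `x` the
quotient grows by an even number; at a place above `x` the remainder absorbs the summand without a
carry. -/
theorem exists_insert (D x : M.N) : ∃ D', ∀ y, Mem y D' ↔ Mem y D ∨ y = x := by
  by_cases hx : Mem x D
  · refine ⟨D, fun y => ⟨.inl, ?_⟩⟩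
    rintro (h | rfl)
    exacts [h, hx]
  obtain ⟨q, r, hr, hD⟩ := not_mem_iff.1 hx
  have odd_add : ∀ p k : M.N, (∃ n, p + 2 * k = 2 * n + 1) ↔ ∃ n, p = 2 * n + 1 := by
    intro p k
    constructor
    · rintro ⟨n, hn⟩
      obtain ⟨m, hm | hm⟩ := even_or_odd' p
      · rw [hm, ← mul_add] at hn
        exact absurd hn even_ne_odd
      · exact ⟨m, hm⟩
    · rintro ⟨n, rfl⟩
      exact ⟨n + k, by ring⟩
  refine ⟨D + exp x, fun y => ?_⟩
  rcases lt_trichotomy y x with hy | rfl | hy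
  · rw [or_iff_left hy.ne]
    obtain ⟨c, rfl⟩ := add_one_le_iff'.2 hy
    obtain ⟨p, s, hs, hp⟩ := exists_div D (exp_pos y)
    rw [mem_iff_odd hs hp, mem_iff_odd (q := p + 2 * exp c) hs, odd_add]
    rw [hp, exp_add, exp_succ]
    ring
  · refine iff_of_true ⟨q, r, hr, ?_⟩ (.inr rfl)
    rw [hD]
    ring
  · rw [or_iff_left hy.ne']
    obtain ⟨c, rfl⟩ := add_one_le_iff'.2 hy
    obtain ⟨p, s, hs, hp⟩ := exists_div D (exp_pos (x + 1 + c))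
    have hE : exp (x + 1 + c) = exp c * (2 * exp x) := by rw [exp_add, exp_succ, mul_comm]
    -- No carry: dividing the remainder `s` by `2^(x+1)` leaves the same `r < 2^x` as dividing `D`,
    -- so there is room for another `2^x`.
    have hs' : s + exp x < exp (x + 1 + c) := by
      obtain ⟨u, v, hv, hu⟩ := exists_div s (mul_pos two_pos (exp_pos x))
      have hr' : r < 2 * exp x := hr.trans_le (by rw [two_mul]; exact le_self_add)
      have h₁ := div_unique (q' := q) (r' := r) (q := p * exp c + u) (r := v) hv hr' (by
        rw [show q * (2 * exp x) + r = 2 * q * exp x + r by ring, ← hD, hp, hE, hu]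
        ring)
      have hu' : u < exp c := by
        by_contra! h
        refine absurd hs (not_lt.2 ?_)
        rw [hE, hu]
        exact (mul_le_mul_left h _).trans le_self_add
      calc s + exp x = u * (2 * exp x) + (v + exp x) := by rw [hu, add_assoc]
        _ < u * (2 * exp x) + 2 * exp x := by
          rw [← h₁.2, two_mul]
          exact (add_lt_add_iff_left _).2 ((add_lt_add_iff_right _).2 hr)
        _ = (u + 1) * (2 * exp x) := by ring
        _ ≤ exp (x + 1 + c) := by
          rw [hE]
          exact mul_le_mul_left (add_one_le_iff'.2 hu') _
    rw [mem_iff_odd hs hp, mem_iff_odd (q := p) hs']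
    rw [hp, add_assoc]

theorem exists_singleton (x : M.N) : ∃ D, ∀ y, Mem y D ↔ y = x := by
  obtain ⟨D, hD⟩ := exists_insert 0 x
  exact ⟨D, fun y => by rw [hD, or_iff_right (not_mem_zero y)]⟩

theorem Def.mem {Γ : Ctx} {f g : M.Env Γ → M.N} (hf : DefT f) (hg : DefT g) :
    Def fun e => Mem (f e) (g e) :=
  .exN (.exN (.and (.lt .var (.rec .exp hf.weak.weak)) (.eq hg.weak.weak
    (.add (.mul (.add (.mul .const .var) .one) (.rec .exp hf.weak.weak)) .var))))

/-- Elements of `E` below `n` are inserted one by one; `n = E` suffices because every element of a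
coded set is smaller than its code. -/
theorem exists_union (D E : M.N) : ∃ U, ∀ y, Mem y U ↔ Mem y D ∨ Mem y E := by
  have : ∀ n : M.N, ∃ U, ∀ y, Mem y U ↔ Mem y D ∨ y < n ∧ Mem y E := by
    refine nat_ind (.exN (.allN (.iff (.mem .var .var) (.or (.mem .var .const)
      (.and (.lt .var .var) (.mem .var .const)))))) ?_ ?_
    · exact ⟨D, fun y => by simp⟩
    · rintro n ⟨U, hU⟩
      by_cases hn : Mem n E
      · obtain ⟨V, hV⟩ := exists_insert U n
        refine ⟨V, fun y => ?_⟩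
        rw [hV, hU, lt_add_one_iff', le_iff_lt_or_eq]
        constructor
        · rintro ((h | h) | rfl)
          exacts [.inl h, .inr ⟨.inl h.1, h.2⟩, .inr ⟨.inr rfl, hn⟩]
        · rintro (h | ⟨h | rfl, h'⟩)
          exacts [.inl (.inl h), .inl (.inr ⟨h, h'⟩), .inr rfl]
      · refine ⟨U, fun y => ?_⟩
        rw [hU, lt_add_one_iff', le_iff_lt_or_eq]
        constructor
        · rintro (h | h)
          exacts [.inl h, .inr ⟨.inl h.1, h.2⟩]
        · rintro (h | ⟨h | rfl, h'⟩)
          exacts [.inl h, .inr ⟨h, h'⟩, absurd h' hn]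
  obtain ⟨U, hU⟩ := this E
  exact ⟨U, fun y => by rw [hU, and_iff_right_of_imp Mem.lt]⟩

/-! ### Computably enumerable sets -/

/-- A sum of numbers vanishes iff every summand does, so bounded quantification keeps a decidable
condition decidable. -/
theorem exists_bounded_all {φ : M.N → M.N} (hφ : Rec φ) : ∃ s : M.N → M.N → M.N,
    (∀ p n, s p n = 0 ↔ ∀ k < n, φ (pair p k) = 0) ∧
      ∀ u v, Rec u → Rec v → Rec fun q => s (u q) (v q) := by
  obtain ⟨s, h₀, h₁, hs⟩ := exists_sum hφ
  refine ⟨s, fun p => ?_, hs⟩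
  refine nat_ind (.iff (.eq (.rec (hs (fun _ => p) _ (.const p) .id) .var) .zero)
    (.allN (.imp (.lt .var .var) (.eq (.rec hφ (.pair .const .var)) .zero)))) ?_ ?_
  · exact iff_of_true (h₀ p) fun k hk => absurd hk not_lt_zero
  · intro n ih
    rw [h₁, add_eq_zero, ih]
    constructor
    · rintro ⟨h, h'⟩ k hk
      rcases (lt_add_one_iff'.1 hk).lt_or_eq with hk | rfl
      exacts [h k hk, h']
    · exact fun h => ⟨fun k hk => h k (hk.trans (lt_add_one' n)), h n (lt_add_one' n)⟩

/-- Projections of decidable sets. -/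
def CE (A : Set M.N) : Prop := ∃ φ, Rec φ ∧ ∀ n, n ∈ A ↔ ∃ k, φ (pair n k) = 0

theorem CE.congr {A B : Set M.N} (hA : CE A) (h : ∀ n, n ∈ B ↔ n ∈ A) : CE B := by
  rwa [Set.ext h]

theorem CE.eq {f g : M.N → M.N} (hf : Rec f) (hg : Rec g) : CE {n | f n = g n} := by
  refine ⟨fun q => (f (fst q) - g (fst q)) + (g (fst q) - f (fst q)),
    .add (.sub (.comp hf (.fst .id)) (.comp hg (.fst .id)))
      (.sub (.comp hg (.fst .id)) (.comp hf (.fst .id))), fun n => ?_⟩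
  simp only [fst_pair, add_eq_zero, tsub_eq_zero_iff_le, exists_const, Set.mem_ofPred_eq]
  exact le_antisymm_iff

theorem CE.le {f g : M.N → M.N} (hf : Rec f) (hg : Rec g) : CE {n | f n ≤ g n} := by
  refine ⟨fun q => (f (fst q) - g (fst q)),
    (.sub (.comp hf (.fst .id)) (.comp hg (.fst .id))), fun n => ?_⟩
  simp only [fst_pair, tsub_eq_zero_iff_le, exists_const, Set.mem_ofPred_eq]

theorem CE.lt {f g : M.N → M.N} (hf : Rec f) (hg : Rec g) : CE {n | f n < g n} := by
  simp only [← add_one_le_iff']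
  exact .le (.add hf (.const 1)) hg

theorem CE.comp {A : Set M.N} {f : M.N → M.N} (hA : CE A) (hf : Rec f) : CE {n | f n ∈ A} := by
  obtain ⟨φ, hφ, h⟩ := hA
  refine ⟨fun q => φ (pair (f (fst q)) (snd q)),
    .comp hφ (.pair (.comp hf (.fst .id)) (.snd .id)), fun n => ?_⟩
  simp only [fst_pair, snd_pair, Set.mem_ofPred_eq, h]

theorem CE.and {P Q : M.N → Prop} (hP : CE {n | P n}) (hQ : CE {n | Q n}) :
    CE {n | P n ∧ Q n} := by
  obtain ⟨φ, hφ, h⟩ := hP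
  obtain ⟨ψ, hψ, h'⟩ := hQ
  refine ⟨fun q => φ (pair (fst q) (fst (snd q))) + ψ (pair (fst q) (snd (snd q))),
    .add (.comp hφ (.pair (.fst .id) (.fst (.snd .id))))
      (.comp hψ (.pair (.fst .id) (.snd (.snd .id)))), fun n => ?_⟩
  simp only [Set.mem_ofPred_eq] at h h'
  simp only [Set.mem_ofPred_eq, h, h', fst_pair, snd_pair, add_eq_zero]
  constructor
  · rintro ⟨⟨k, hk⟩, l, hl⟩
    exact ⟨pair k l, by rwa [fst_pair], by rwa [snd_pair]⟩
  · rintro ⟨k, hk, hl⟩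
    exact ⟨⟨_, hk⟩, _, hl⟩

theorem CE.or {P Q : M.N → Prop} (hP : CE {n | P n}) (hQ : CE {n | Q n}) :
    CE {n | P n ∨ Q n} := by
  obtain ⟨φ, hφ, h⟩ := hP
  obtain ⟨ψ, hψ, h'⟩ := hQ
  refine ⟨fun q => φ q * ψ q, .mul hφ hψ, fun n => ?_⟩
  simp only [Set.mem_ofPred_eq] at h h'
  simp only [Set.mem_ofPred_eq, h, h', mul_eq_zero, exists_or]

theorem CE.ex {Q : M.N → M.N → Prop} (hQ : CE {q | Q (fst q) (snd q)}) :
    CE {n | ∃ k, Q n k} := by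
  obtain ⟨φ, hφ, h⟩ := hQ
  refine ⟨fun q => φ (pair (pair (fst q) (fst (snd q))) (snd (snd q))),
    .comp hφ (.pair (.pair (.fst .id) (.fst (.snd .id))) (.snd (.snd .id))), fun n => ?_⟩
  have h : ∀ n k, Q n k ↔ ∃ j, φ (pair (pair n k) j) = 0 := fun n k => by
    simpa only [Set.mem_ofPred_eq, fst_pair, snd_pair] using h (pair n k)
  simp only [Set.mem_ofPred_eq, h, fst_pair, snd_pair]
  constructor
  · rintro ⟨k, j, hj⟩
    exact ⟨pair k j, by rwa [fst_pair, snd_pair]⟩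
  · rintro ⟨k, hk⟩
    exact ⟨_, _, hk⟩

/-- This is collection: witnesses for all `k < b n` have a common bound `J`, found by induction on
the length of the initial segment. With `J` fixed the condition is decidable, and `J` is the new
existential variable. -/
theorem CE.ball {Q : M.N → M.N → Prop} {b : M.N → M.N} (hb : Rec b)
    (hQ : CE {q | Q (fst q) (snd q)}) : CE {n | ∀ k < b n, Q n k} := by
  obtain ⟨φ, hφ, h⟩ := hQ
  have h : ∀ n k, Q n k ↔ ∃ j, φ (pair (pair n k) j) = 0 := fun n k => by
    simpa only [Set.mem_ofPred_eq, fst_pair, snd_pair] using h (pair n k)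
  -- Since `1 - a` vanishes exactly when `a ≠ 0`, `s p J = 0` says that there is no witness `j < J`
  -- for `p`.
  obtain ⟨s, hs, hs'⟩ := exists_bounded_all (φ := fun q => 1 - φ q) (.sub (.const 1) hφ)
  have h1 : ∀ a : M.N, 1 - a = 0 ↔ a ≠ 0 := fun a => by
    rw [tsub_eq_zero_iff_le, ← pos_iff_ne_zero, ← add_one_le_iff', zero_add]
  -- Negating once more, `t` vanishes iff every `k` in its range has a witness below `J`.
  obtain ⟨t, ht, ht'⟩ := exists_bounded_all
    (φ := fun q => 1 - s (pair (fst (fst q)) (snd q)) (snd (fst q)))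
    (.sub (.const 1) (hs' _ _ (.pair (.fst (.fst .id)) (.snd .id)) (.snd (.fst .id))))
  have key : ∀ n J, t (pair n J) (b n) = 0 ↔ ∀ k < b n, ∃ j < J, φ (pair (pair n k) j) = 0 := by
    intro n J
    simp only [ht, fst_pair, snd_pair, h1, ne_eq, hs, not_forall, not_not, exists_prop]
  refine ⟨fun q => t q (b (fst q)), ht' _ _ .id (.comp hb (.fst .id)), fun n => ?_⟩
  simp only [fst_pair, key, Set.mem_ofPred_eq, h]
  constructor
  · intro H
    have : ∀ m, m ≤ b n → ∃ J, ∀ k < m, ∃ j < J, φ (pair (pair n k) j) = 0 := by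
      refine nat_ind (.imp (.le .var .const) (.exN (.allN (.imp (.lt .var .var) (.exN (.and
        (.lt .var .var) (.eq (.rec hφ (.pair (.pair .const .var) .var)) .zero))))))) ?_ ?_
      · exact fun _ => ⟨0, fun k hk => absurd hk not_lt_zero⟩
      · intro m ih hm
        obtain ⟨J, hJ⟩ := ih ((lt_add_one' m).le.trans hm)
        obtain ⟨j, hj⟩ := H m (add_one_le_iff'.1 hm)
        refine ⟨J + (j + 1), fun k hk => ?_⟩
        rcases (lt_add_one_iff'.1 hk).lt_or_eq with hk | rfl
        · obtain ⟨i, hi, hi'⟩ := hJ k hk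
          exact ⟨i, hi.trans_le le_self_add, hi'⟩
        · exact ⟨j, (lt_add_one' j).trans_le le_add_self, hj⟩
    exact this (b n) le_rfl
  · rintro ⟨J, hJ⟩ k hk
    obtain ⟨j, -, hj⟩ := hJ k hk
    exact ⟨j, hj⟩

theorem CE.memCode {f g : M.N → M.N} (hf : Rec f) (hg : Rec g) : CE {n | Mem (f n) (g n)} :=
  have hf' := hf.comp (.fst (.fst .id))
  .ex (.ex (.and (.lt (.snd .id) (.comp .exp hf')) (.eq (.comp hg (.fst (.fst .id)))
    (.add (.mul (.add (.mul (.const 2) (.snd (.fst .id))) (.const 1)) (.comp .exp hf'))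
      (.snd .id)))))

theorem CE.not_memCode {f g : M.N → M.N} (hf : Rec f) (hg : Rec g) :
    CE {n | ¬ Mem (f n) (g n)} := by
  have hf' := hf.comp (.fst (.fst .id))
  simp only [not_mem_iff]
  exact .ex (.ex (.and (.lt (.snd .id) (.comp .exp hf')) (.eq (.comp hg (.fst (.fst .id)))
    (.add (.mul (.mul (.const 2) (.snd (.fst .id))) (.comp .exp hf')) (.snd .id)))))

/-- The quantifier is really bounded, because elements of a coded set are below the code. -/
theorem CE.allMem {Q : M.N → M.N → Prop} {g : M.N → M.N} (hg : Rec g)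
    (hQ : CE {q | Q (fst q) (snd q)}) : CE {n | ∀ k, Mem k (g n) → Q n k} := by
  refine (CE.ball (Q := fun n k => ¬ Mem k (g n) ∨ Q n k) hg
    (.or (.not_memCode (.snd .id) (hg.comp (.fst .id))) hQ)).congr fun n => ?_
  simp only [Set.mem_ofPred_eq, ← imp_iff_not_or]
  exact ⟨fun h k _ => h k, fun h k hk => h k hk.lt hk⟩

end Struct

end FiniteType

namespace FiniteType

namespace Struct

variable {M : Struct .second} [hM : IsModel M]

/-! ### The graph algebra of computably enumerable sets -/

/-- The finite set with code `D`. -/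
def code (D : M.N) : Set M.N := {x | Mem x D}

/-- The image of `B` under the enumeration operator with graph `A`. -/
def image (A B : Set M.N) : Set M.N := {n | ∃ D, pair n D ∈ A ∧ ∀ d, Mem d D → d ∈ B}

theorem mem_code {x D : M.N} : x ∈ code D ↔ Mem x D := Iff.rfl

theorem image_mono {A A' B B' : Set M.N} (hA : A ⊆ A') (hB : B ⊆ B') : image A B ⊆ image A' B' :=
  fun _ ⟨D, h, h'⟩ => ⟨D, hA h, fun d hd => hB (h' d hd)⟩

/-- Uniformly computably enumerable families of sets. -/
def CEFam (S : M.N → Set M.N) : Prop := CE {q | snd q ∈ S (fst q)}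

theorem CEFam.mem {S : M.N → Set M.N} {f : M.N → M.N} (hS : CEFam S) (hf : Rec f) :
    CE {n | f n ∈ S n} := by
  have := CE.comp hS (f := fun n => pair n (f n)) (.pair .id hf)
  simpa only [Set.mem_ofPred_eq, fst_pair, snd_pair] using this

theorem CEFam.const {A : Set M.N} (hA : CE A) : CEFam fun _ => A := hA.comp (.snd .id)

theorem CEFam.comp {S : M.N → Set M.N} {f : M.N → M.N} (hS : CEFam S) (hf : Rec f) :
    CEFam fun n => S (f n) := by
  have := CE.comp hS (f := fun q => pair (f (fst q)) (snd q)) (.pair (hf.comp (.fst .id)) (.snd .id))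
  unfold CEFam
  simpa only [Set.mem_ofPred_eq, fst_pair, snd_pair] using this

theorem CEFam.code {f : M.N → M.N} (hf : Rec f) : CEFam fun n => code (f n) :=
  .memCode (.snd .id) (hf.comp (.fst .id))

theorem CEFam.singleton {f : M.N → M.N} (hf : Rec f) : CEFam fun n => {f n} :=
  .eq (.snd .id) (hf.comp (.fst .id))

theorem CEFam.image {S T : M.N → Set M.N} (hS : CEFam S) (hT : CEFam T) :
    CEFam fun n => image (S n) (T n) :=
  .ex (.and ((hS.comp (.fst (.fst .id))).mem (.pair (.snd (.fst .id)) (.snd .id)))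
    (.allMem (.snd .id) ((hT.comp (.fst (.fst (.fst .id)))).mem (.snd .id))))

theorem CE.image {A B : Set M.N} (hA : CE A) (hB : CE B) : CE (image A B) := by
  have := ((CEFam.const hA).image (.const hB)).mem .id
  exact this

variable (M) in
/-- The computably enumerable sets of a model. -/
def CSet : Type := {A : Set M.N // CE A}

namespace CSet

instance : Membership M.N (CSet M) := ⟨fun A n => n ∈ A.1⟩

@[ext]
theorem ext {A B : CSet M} (h : ∀ n, n ∈ A ↔ n ∈ B) : A = B := Subtype.ext (Set.ext h)

/-- Application in the graph algebra. -/
def app (A B : CSet M) : CSet M := ⟨image A.1 B.1, A.2.image B.2⟩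

infixl:70 " ⋆ " => CSet.app

theorem mem_app {n : M.N} {A B : CSet M} :
    n ∈ A ⋆ B ↔ ∃ D, pair n D ∈ A ∧ ∀ d, Mem d D → d ∈ B := Iff.rfl

/-- Singletons. -/
def single (a : M.N) : CSet M := ⟨{a}, .eq .id (.const a)⟩

theorem mem_single {a n : M.N} : n ∈ single a ↔ n = a := Iff.rfl

theorem single_inj {a b : M.N} : single a = single b ↔ a = b := by
  refine ⟨fun h => ?_, fun h => h ▸ rfl⟩
  have : a ∈ single b := h ▸ mem_single.2 rfl
  exact this

/-- Every enumeration is given by an object of type `1`. -/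
theorem exists_index (A : CSet M) :
    ∃ f : M.D .one, ∀ n, n ∈ A ↔ ∃ k, M.app f (pair n k) = 0 := by
  obtain ⟨A, φ, ⟨f, hf⟩, h⟩ := A
  exact ⟨f, fun n => (h n).trans (by simp only [hf])⟩

/-- The set enumerated by an object of type `1`. -/
def ofIndex (f : M.D .one) : CSet M :=
  ⟨{n | ∃ k, M.app f (pair n k) = 0}, _, .of f, fun _ => Iff.rfl⟩

theorem ofIndex_surjective : Function.Surjective (ofIndex (M := M)) := fun A => by
  obtain ⟨f, hf⟩ := A.exists_index
  exact ⟨f, ext fun n => (hf n).symm⟩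

end CSet

/-! ### Definable families of sets -/

/-- Definable families of computably enumerable sets. -/
def DefSet {Γ : Ctx} (S : M.Env Γ → CSet M) : Prop :=
  Def fun e : M.Env (.nat :: Γ) => e varTy_nat .zero ∈ S fun _ h x => e h (.succ x)

section
variable {Γ : Ctx}

theorem Def.memSet {S : M.Env Γ → CSet M} {f : M.Env Γ → M.N} (hf : DefT f) (hS : DefSet S) :
    Def fun e => f e ∈ S e := by
  have : Def fun e => ∃ x, x = f e ∧ x ∈ S e := .exN (.and (.eq .var hf.weak) hS)
  simpa only [exists_eq_left] using this

theorem DefSet.weak {S : M.Env Γ → CSet M} {σ : Ty} (hS : DefSet S) :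
    DefSet fun e : M.Env (σ :: Γ) => S fun _ h x => e h (.succ x) := by
  obtain ⟨Γ', e', A, hA⟩ := hS
  -- The new variable is inserted below the head, which stays reserved for the number whose
  -- membership is tested.
  let r : Ren (.nat :: (Γ ++ Γ')) (.nat :: σ :: (Γ ++ Γ')) := Ren.lift fun _ x => .succ x
  refine ⟨Γ', e', A.rename r, fun e => ?_⟩
  refine (hA (.cons (e varTy_nat .zero) fun _ h x => e h (.succ (.succ x)))).trans ?_
  rw [sat_rename]
  refine iff_of_eq (congrArg (M.Sat · A) ?_)
  funext τ h x
  cases x <;> rfl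

theorem DefSet.index {h : Fragment.second.varTy .one} {x : Var Γ .one} :
    DefSet fun e : M.Env Γ => .ofIndex (e h x) :=
  .exN (.eq (.app .var (.pair .var .var)) .zero)

/-- A fixed set enters a definition through its index, as a parameter of type 1. -/
theorem DefSet.const {A : CSet M} : DefSet fun _ : M.Env Γ => A := by
  obtain ⟨f, rfl⟩ := CSet.ofIndex_surjective A
  exact .exN (.eq (.app .constOne (.pair .var .var)) .zero)

theorem DefSet.single {f : M.Env Γ → M.N} (hf : DefT f) : DefSet fun e => .single (f e) :=
  .eq .var hf.weak

theorem DefSet.app {S T : M.Env Γ → CSet M} (hS : DefSet S) (hT : DefSet T) :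
    DefSet fun e => S e ⋆ T e :=
  .exN (.and (.memSet (.pair .var .var) hS.weak.weak)
    (.allN (.imp (.mem .var .var) (.memSet .var hT.weak.weak.weak))))

theorem Def.eqSet {S T : M.Env Γ → CSet M} (hS : DefSet S) (hT : DefSet T) :
    Def fun e => S e = T e := by
  simp only [CSet.ext_iff]
  exact .allN (.iff (.memSet .var hS.weak) (.memSet .var hT.weak))

end

namespace CSet

/-! ### Combinators of the graph algebra -/

variable (M) in
/-- The projection combinator. -/
noncomputable def K : CSet M :=
  ⟨{x | fst (fst x) ∈ code (snd x)}, CEFam.mem (.code (.snd .id)) (.fst (.fst .id))⟩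

/-- In `pair (pair n D) E` the outer code `E` approximates the first argument and `D` the second.
The combinator asks for `n` in `E` and nothing of `D`. -/
theorem K_app (A B : CSet M) : K M ⋆ A ⋆ B = A := by
  ext n
  have hK : ∀ n D E : M.N, pair (pair n D) E ∈ K M ↔ Mem n E := fun n D E => by
    change fst (fst (pair (pair n D) E)) ∈ code (snd (pair (pair n D) E)) ↔ _
    rw [fst_pair, fst_pair, snd_pair, mem_code]
  simp only [mem_app, hK]
  constructor
  · rintro ⟨D, ⟨E, h, hE⟩, -⟩
    exact hE n h
  · intro hn
    obtain ⟨E, hE⟩ := exists_singleton n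
    exact ⟨0, ⟨E, (hE n).2 rfl, fun d hd => (hE d).1 hd ▸ hn⟩,
      fun d hd => absurd hd (not_mem_zero d)⟩

variable (M) in
/-- The substitution combinator. -/
noncomputable def S : CSet M :=
  ⟨{x | fst (fst (fst x)) ∈ image (image (code (snd x)) (code (snd (fst (fst x)))))
      (image (code (snd (fst x))) (code (snd (fst (fst x)))))},
    CEFam.mem (.image (.image (.code (.snd .id)) (.code (.snd (.fst (.fst .id)))))
      (.image (.code (.snd (.fst .id))) (.code (.snd (.fst (.fst .id))))))
      (.fst (.fst (.fst .id)))⟩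

/-- Compactness of application: a coded finite part of `B ⋆ C` already comes from finite parts of
`B` and `C`. Finiteness is meant inside `M`, so the parts are collected by a definable induction on
a bound `m`. -/
theorem exists_finite_app (B C : CSet M) (D : M.N) (h : ∀ d, Mem d D → d ∈ B ⋆ C) :
    ∃ E F, (∀ x, Mem x E → x ∈ B) ∧ (∀ x, Mem x F → x ∈ C) ∧
      ∀ d, Mem d D → d ∈ image (code E) (code F) := by
  have : ∀ m : M.N, ∃ E F, (∀ x, Mem x E → x ∈ B) ∧ (∀ x, Mem x F → x ∈ C) ∧
      ∀ d, Mem d D ∧ d < m → ∃ G, Mem (pair d G) E ∧ ∀ x, Mem x G → Mem x F := by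
    refine nat_ind (.exN (.exN (.and (.allN (.imp (.mem .var .var) (.memSet .var .const)))
      (.and (.allN (.imp (.mem .var .var) (.memSet .var .const)))
        (.allN (.imp (.and (.mem .var .const) (.lt .var .var)) (.exN (.and
          (.mem (.pair .var .var) .var)
          (.allN (.imp (.mem .var .var) (.mem .var .var))))))))))) ?_ ?_
    · exact ⟨0, 0, fun x hx => absurd hx (not_mem_zero x), fun x hx => absurd hx (not_mem_zero x),
        fun d hd => absurd hd.2 not_lt_zero⟩
    · rintro m ⟨E, F, hE, hF, hEF⟩
      by_cases hm : Mem m D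
      · obtain ⟨G, hG, hG'⟩ := mem_app.1 (h m hm)
        obtain ⟨E', hE'⟩ := exists_insert E (pair m G)
        obtain ⟨F', hF'⟩ := exists_union F G
        refine ⟨E', F', fun x hx => ?_, fun x hx => ?_, fun d ⟨hd, hdm⟩ => ?_⟩
        · rcases (hE' x).1 hx with hx | rfl
          exacts [hE x hx, hG]
        · rcases (hF' x).1 hx with hx | hx
          exacts [hF x hx, hG' x hx]
        · rcases (lt_add_one_iff'.1 hdm).lt_or_eq with hdm | rfl
          · obtain ⟨H, hH, hH'⟩ := hEF d ⟨hd, hdm⟩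
            exact ⟨H, (hE' _).2 (.inl hH), fun x hx => (hF' x).2 (.inl (hH' x hx))⟩
          · exact ⟨G, (hE' _).2 (.inr rfl), fun x hx => (hF' x).2 (.inr hx)⟩
      · refine ⟨E, F, hE, hF, fun d ⟨hd, hdm⟩ => hEF d ⟨hd, ?_⟩⟩
        rcases (lt_add_one_iff'.1 hdm).lt_or_eq with hdm | rfl
        exacts [hdm, absurd hd hm]
  obtain ⟨E, F, hE, hF, h⟩ := this D
  exact ⟨E, F, hE, hF, fun d hd => h d ⟨hd, hd.lt⟩⟩

/-- One inclusion is monotonicity of application, the other is compactness. -/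
theorem S_app (A B C : CSet M) : S M ⋆ A ⋆ B ⋆ C = A ⋆ C ⋆ (B ⋆ C) := by
  ext n
  have hS : ∀ n D E F : M.N, pair (pair (pair n D) E) F ∈ S M ↔
      n ∈ image (image (code F) (code D)) (image (code E) (code D)) := fun n D E F => by
    change _ ∈ image _ _ ↔ _
    simp only [fst_pair, snd_pair]
  rw [mem_app]
  simp only [mem_app (A := S M ⋆ A), mem_app (A := S M), hS]
  constructor
  · rintro ⟨D, ⟨E, ⟨F, h, hF⟩, hE⟩, hD⟩
    exact image_mono (image_mono hF hD) (image_mono hE hD) h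
  · rintro ⟨D, ⟨E, h, hE⟩, hD⟩
    obtain ⟨G, H, hG, hH, hGH⟩ := exists_finite_app B C D hD
    -- The finite parts used are `F` of `A`, `G` of `B`, and `U = E ∪ H` of `C`; the last serves
    -- both occurrences of `C`.
    obtain ⟨F, hF⟩ := exists_singleton (pair (pair n D) E)
    obtain ⟨U, hU⟩ := exists_union E H
    refine ⟨U, ⟨G, ⟨F, ⟨D, ⟨E, (hF _).2 rfl, fun d hd => (hU d).2 (.inl hd)⟩, fun d hd => ?_⟩,
      fun d hd => (hF d).1 hd ▸ h⟩, hG⟩, fun d hd => ?_⟩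
    · exact image_mono subset_rfl (fun x hx => (hU x).2 (.inr hx)) (hGH d hd)
    · rcases (hU d).1 hd with hd | hd
      exacts [hE d hd, hH d hd]

variable (M) in
/-- Case distinction on a number. -/
noncomputable def cases : CSet M :=
  ⟨{x | (0 ∈ code (snd x) ∧ fst (fst (fst x)) ∈ code (snd (fst x))) ∨
      ∃ m, m + 1 ∈ code (snd x) ∧ fst (fst (fst x)) ∈ image (code (snd (fst (fst x)))) {m}},
    .or (.and (CEFam.mem (.code (.snd .id)) (.const 0))
        (CEFam.mem (.code (.snd (.fst .id))) (.fst (.fst (.fst .id)))))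
      (.ex (.and (CEFam.mem (.code (.snd (.fst .id))) (.add (.snd .id) (.const 1)))
        (CEFam.mem (.image (.code (.snd (.fst (.fst (.fst .id))))) (.singleton (.snd .id)))
          (.fst (.fst (.fst (.fst .id)))))))⟩

theorem mem_cases {n : M.N} {A B C : CSet M} : n ∈ cases M ⋆ A ⋆ B ⋆ C ↔
    0 ∈ A ∧ n ∈ B ∨ ∃ m, m + 1 ∈ A ∧ n ∈ C ⋆ single m := by
  have hS : ∀ n D E F : M.N, pair (pair (pair n D) E) F ∈ cases M ↔
      (Mem 0 F ∧ Mem n E) ∨ ∃ m, Mem (m + 1) F ∧ n ∈ image (code D) {m} := fun n D E F => by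
    change _ ∨ _ ↔ _
    simp only [fst_pair, snd_pair, mem_code]
  rw [mem_app]
  simp only [mem_app (A := cases M ⋆ A), mem_app (A := cases M), hS]
  constructor
  · rintro ⟨D, ⟨E, ⟨F, h | ⟨m, h, h'⟩, hF⟩, hE⟩, hD⟩
    · exact .inl ⟨hF _ h.1, hE _ h.2⟩
    · exact .inr ⟨m, hF _ h, image_mono hD subset_rfl h'⟩
  · rintro (⟨h, h'⟩ | ⟨m, h, D, h', hD⟩)
    · obtain ⟨E, hE⟩ := exists_singleton n
      obtain ⟨F, hF⟩ := exists_singleton (0 : M.N)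
      exact ⟨0, ⟨E, ⟨F, .inl ⟨(hF _).2 rfl, (hE _).2 rfl⟩, fun d hd => (hF d).1 hd ▸ h⟩,
        fun d hd => (hE d).1 hd ▸ h'⟩, fun d hd => absurd hd (not_mem_zero d)⟩
    · obtain ⟨G, hG⟩ := exists_singleton (pair n D)
      obtain ⟨F, hF⟩ := exists_singleton (m + 1)
      exact ⟨G, ⟨0, ⟨F, .inr ⟨m, (hF _).2 rfl, D, (hG _).2 rfl, hD⟩, fun d hd => (hF d).1 hd ▸ h⟩,
        fun d hd => absurd hd (not_mem_zero d)⟩, fun d hd => (hG d).1 hd ▸ h'⟩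

theorem cases_zero (A B : CSet M) : cases M ⋆ single 0 ⋆ A ⋆ B = A := by
  ext n
  rw [mem_cases]
  simp only [mem_single, add_one_ne_zero', false_and, exists_false, or_false, true_and]

theorem cases_succ (m : M.N) (A B : CSet M) :
    cases M ⋆ single (m + 1) ⋆ A ⋆ B = B ⋆ single m := by
  ext n
  rw [mem_cases]
  simp only [mem_single, (add_one_ne_zero' m).symm, false_and, false_or, add_left_inj,
    exists_eq_left]

/-- The graph of a function on numbers. -/
def lift {φ : M.N → M.N} (hφ : Rec φ) : CSet M :=
  ⟨{x | ∃ a, a ∈ code (snd x) ∧ fst x = φ a},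
    .ex (.and (CEFam.mem (.code (.snd (.fst .id))) (.snd .id))
      (.eq (.fst (.fst .id)) (hφ.comp (.snd .id))))⟩

theorem lift_app {φ : M.N → M.N} (hφ : Rec φ) (a : M.N) : lift hφ ⋆ single a = single (φ a) := by
  ext n
  have h : ∀ n D : M.N, pair n D ∈ lift hφ ↔ ∃ a, Mem a D ∧ n = φ a := fun n D => by
    change (∃ a, _) ↔ _
    simp only [fst_pair, snd_pair, mem_code]
  simp only [mem_app, h, mem_single]
  constructor
  · rintro ⟨D, ⟨b, hb, rfl⟩, hD⟩
    rw [hD b hb]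
  · rintro rfl
    obtain ⟨D, hD⟩ := exists_singleton a
    exact ⟨D, ⟨a, (hD a).2 rfl, rfl⟩, fun d => (hD d).1⟩

/-- The graph of a binary function on numbers. -/
def lift₂ {φ : M.N → M.N} (hφ : Rec φ) : CSet M :=
  ⟨{x | ∃ a b, (a ∈ code (snd x) ∧ b ∈ code (snd (fst x))) ∧ fst (fst x) = φ (pair a b)},
    .ex (.ex (.and (.and (CEFam.mem (.code (.snd (.fst (.fst .id)))) (.snd (.fst .id)))
      (CEFam.mem (.code (.snd (.fst (.fst (.fst .id))))) (.snd .id)))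
      (.eq (.fst (.fst (.fst (.fst .id)))) (hφ.comp (.pair (.snd (.fst .id)) (.snd .id))))))⟩

theorem lift₂_app {φ : M.N → M.N} (hφ : Rec φ) (a b : M.N) :
    lift₂ hφ ⋆ single a ⋆ single b = single (φ (pair a b)) := by
  ext n
  have h : ∀ n D E : M.N, pair (pair n D) E ∈ lift₂ hφ ↔
      ∃ a b, (Mem a E ∧ Mem b D) ∧ n = φ (pair a b) := fun n D E => by
    change (∃ a b, _) ↔ _
    simp only [fst_pair, snd_pair, mem_code]
  simp only [mem_app (A := lift₂ hφ ⋆ single a), mem_app (A := lift₂ hφ), h, mem_single]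
  constructor
  · rintro ⟨D, ⟨E, ⟨a', b', ⟨ha, hb⟩, rfl⟩, hE⟩, hD⟩
    rw [hE _ ha, hD _ hb]
  · rintro rfl
    obtain ⟨D, hD⟩ := exists_singleton b
    obtain ⟨E, hE⟩ := exists_singleton a
    exact ⟨D, ⟨E, ⟨a, b, ⟨(hE a).2 rfl, (hD b).2 rfl⟩, rfl⟩, fun d => (hE d).1⟩, fun d => (hD d).1⟩

end CSet

variable (M) in
/-- Combinatory terms over the graph algebra. -/
inductive CL : Type
  | var (i : ℕ) : CL
  | const (A : CSet M) : CL
  | app (s t : CL) : CL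

namespace CL

open CSet

/-- Extension of an assignment. -/
def push (A : CSet M) (ν : ℕ → CSet M) : ℕ → CSet M
  | 0 => A
  | i + 1 => ν i

/-- The value of a combinatory term. -/
def eval (ν : ℕ → CSet M) : CL M → CSet M
  | var i => ν i
  | const A => A
  | app s t => eval ν s ⋆ eval ν t

/-- Bracket abstraction. -/
noncomputable def abs : CL M → CL M
  | var 0 => .app (.app (.const (S M)) (.const (K M))) (.const (K M))
  | var (i + 1) => .app (.const (K M)) (.var i)
  | const A => .app (.const (K M)) (.const A)
  | app s t => .app (.app (.const (S M)) (abs s)) (abs t)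

theorem eval_abs (ν : ℕ → CSet M) (t : CL M) (A : CSet M) :
    eval ν (abs t) ⋆ A = eval (push A ν) t := by
  induction t with
  | var i =>
    cases i with
    | zero => simp only [abs, eval, S_app, K_app, push]
    | succ i => simp only [abs, eval, K_app, push]
  | const B => simp only [abs, eval, K_app]
  | app s t ih₁ ih₂ => simp only [abs, eval, S_app, ih₁, ih₂]

end CL

/-! ### Fixed points, recursion and search in the graph algebra. -/

namespace CSet

open CL

/-- The value of a closed combinatory term. -/
noncomputable def ofCL (t : CL M) : CSet M := t.eval fun _ => K M

/-- Turing's fixed point combinator: `Y = U U` with `U A F = F (A A F)`. -/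
theorem exists_fix : ∃ Y : CSet M, ∀ F, Y ⋆ F = F ⋆ (Y ⋆ F) := by
  let U : CSet M := ofCL (.abs (.abs (.app (.var 0) (.app (.app (.var 1) (.var 1)) (.var 0)))))
  have hU : ∀ A F : CSet M, U ⋆ A ⋆ F = F ⋆ (A ⋆ A ⋆ F) := fun A F => by
    simp only [U, ofCL, eval_abs, CL.eval, push]
  exact ⟨U ⋆ U, fun F => hU U F⟩

/-- The recursion equations are solved by a fixed point for arbitrary `A` and `B`, without reference
to types, so one element interprets every `R_σ`. -/
theorem exists_recursor : ∃ R : CSet M, (∀ A B, R ⋆ single 0 ⋆ A ⋆ B = A) ∧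
    ∀ n A B, R ⋆ single (n + 1) ⋆ A ⋆ B = B ⋆ (R ⋆ single n ⋆ A ⋆ B) ⋆ single n := by
  obtain ⟨Y, hY⟩ := exists_fix (M := M)
  let F : CSet M := ofCL (.abs (.abs (.abs (.abs (.app (.app (.app (.const (cases M)) (.var 2))
    (.var 1)) (.abs (.app (.app (.var 1) (.app (.app (.app (.var 4) (.var 0)) (.var 2)) (.var 1)))
      (.var 0))))))))
  have hF : ∀ R N A B : CSet M, ∃ C, F ⋆ R ⋆ N ⋆ A ⋆ B = cases M ⋆ N ⋆ A ⋆ C ∧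
      ∀ m, C ⋆ m = B ⋆ (R ⋆ m ⋆ A ⋆ B) ⋆ m := fun R N A B => by
    -- `C` is the value of the inner abstraction; it is left open and determined by computing the
    -- left-hand side.
    refine ⟨?_, ?_, ?_⟩
    rotate_left
    · simp only [F, ofCL, eval_abs, CL.eval, push]
      rfl
    · intro m
      simp only [eval_abs, CL.eval, push]
  refine ⟨Y ⋆ F, fun A B => ?_, fun n A B => ?_⟩
  · rw [hY]
    obtain ⟨C, h, -⟩ := hF (Y ⋆ F) (single 0) A B
    rw [h, cases_zero]
  · obtain ⟨C, h, hC⟩ := hF (Y ⋆ F) (single (n + 1)) A B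
    conv_lhs => rw [hY]
    rw [h, cases_succ, hC]

/-- Unbounded search upwards from `n` for a zero of `G`. Only the one-step equations are claimed;
termination is a separate matter. -/
theorem exists_search : ∃ U : CSet M, ∀ G n,
    (G ⋆ single n = single 0 → U ⋆ G ⋆ single n = single n) ∧
    ∀ m, G ⋆ single n = single (m + 1) → U ⋆ G ⋆ single n = U ⋆ G ⋆ single (n + 1) := by
  obtain ⟨Y, hY⟩ := exists_fix (M := M)
  have hs : Rec fun n : M.N => n + 1 := .add .id (.const 1)
  let F : CSet M := ofCL (.abs (.abs (.abs (.app (.app (.app (.const (cases M))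
    (.app (.var 1) (.var 0))) (.var 0)) (.abs (.app (.app (.var 3) (.var 2))
      (.app (.const (lift hs)) (.var 1))))))))
  have hF : ∀ R G N : CSet M, ∃ C, F ⋆ R ⋆ G ⋆ N = cases M ⋆ (G ⋆ N) ⋆ N ⋆ C ∧
      ∀ m, C ⋆ m = R ⋆ G ⋆ (lift hs ⋆ N) := fun R G N => by
    refine ⟨?_, ?_, ?_⟩
    rotate_left
    · simp only [F, ofCL, eval_abs, CL.eval, push]
      rfl
    · intro m
      simp only [eval_abs, CL.eval, push]
  refine ⟨Y ⋆ F, fun G n => ?_⟩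
  obtain ⟨C, h, hC⟩ := hF (Y ⋆ F) G (single n)
  constructor
  · intro h₀
    rw [hY, h, h₀, cases_zero]
  · intro m hm
    conv_lhs => rw [hY]
    rw [h, hm, cases_succ, hC, lift_app]

variable (M) in
/-- The recursor of the graph algebra. -/
noncomputable def R : CSet M := exists_recursor.choose

theorem R_zero (A B : CSet M) : R M ⋆ single 0 ⋆ A ⋆ B = A := exists_recursor.choose_spec.1 A B

theorem R_succ (n : M.N) (A B : CSet M) :
    R M ⋆ single (n + 1) ⋆ A ⋆ B = B ⋆ (R M ⋆ single n ⋆ A ⋆ B) ⋆ single n :=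
  exists_recursor.choose_spec.2 n A B

end CSet

end Struct

end FiniteType

namespace FiniteType

namespace Struct

/-- Soundness of intuitionistic natural deduction for structures. -/
theorem sat_of_derives {L : Fragment} {T : ∀ Γ : Ctx, Set (Formula L Γ)} {M : Struct L}
    (hT : ∀ (Γ : Ctx) (A : Formula L Γ), A ∈ T Γ → ∀ e : M.Env Γ, M.Sat e A) {Γ : Ctx}
    {H : List (Formula L Γ)} {A : Formula L Γ} (h : Derives T H A) (e : M.Env Γ)
    (he : ∀ B ∈ H, M.Sat e B) : M.Sat e A := by
  have shift : ∀ {Γ : Ctx} {H : List (Formula L Γ)} {σ : Ty} {e : M.Env Γ} (a : M.D σ),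
      (∀ B ∈ H, M.Sat e B) → ∀ B ∈ H.map Formula.shift, M.Sat (.cons a e) B := by
    intro Γ H σ e a he B hB
    obtain ⟨B, hB', rfl⟩ := List.mem_map.1 hB
    exact (sat_rename _ (fun _ x => .succ x) _).2 (he B hB')
  induction h with
  | ax h => exact hT _ _ h e
  | hyp h => exact he _ h
  | botE _ ih => exact (ih e he).elim
  | andI _ _ ih₁ ih₂ => exact ⟨ih₁ e he, ih₂ e he⟩
  | andE₁ _ ih => exact (ih e he).1
  | andE₂ _ ih => exact (ih e he).2
  | orI₁ _ ih => exact .inl (ih e he)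
  | orI₂ _ ih => exact .inr (ih e he)
  | orE _ _ _ ih ih₁ ih₂ =>
    rcases ih e he with h | h
    · exact ih₁ e (List.forall_mem_cons.2 ⟨h, he⟩)
    · exact ih₂ e (List.forall_mem_cons.2 ⟨h, he⟩)
  | impI _ ih => exact fun h => ih e (List.forall_mem_cons.2 ⟨h, he⟩)
  | impE _ _ ih₁ ih₂ => exact ih₁ e he (ih₂ e he)
  | allI _ ih => exact fun a => ih _ (shift a he)
  | allE t _ ih => exact (sat_inst _ _ _).2 (ih e he _)
  | exI t _ ih => exact ⟨_, (sat_inst _ _ _).1 (ih e he)⟩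
  | exE _ _ ih₁ ih₂ =>
    obtain ⟨a, ha⟩ := ih₁ e he
    exact (sat_rename _ (fun _ x => .succ x) _).1 (ih₂ (.cons a e) (List.forall_mem_cons.2 ⟨ha, shift a he⟩))

variable {M : Struct .second} [hM : IsModel M]

namespace CSet

/-! ### Hereditarily extensional objects of the graph algebra -/

/-- Hereditary extensional equality. -/
def Per : Ty → CSet M → CSet M → Prop
  | .nat, A, B => ∃ n, A = single n ∧ B = single n
  | .arr ρ τ, F, G => ∀ A B, Per ρ A B → Per τ (F ⋆ A) (G ⋆ B)

theorem Per.symm_trans (σ : Ty) : (∀ A B : CSet M, Per σ A B → Per σ B A) ∧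
    ∀ A B C : CSet M, Per σ A B → Per σ B C → Per σ A C := by
  induction σ with
  | nat =>
    refine ⟨fun A B ⟨n, hA, hB⟩ => ⟨n, hB, hA⟩, ?_⟩
    rintro A B C ⟨n, hA, hB⟩ ⟨m, hB', hC⟩
    exact ⟨n, hA, by rw [hC, ← hB', hB]⟩
  | arr ρ τ ihρ ihτ =>
    refine ⟨fun F G h A B hAB => ihτ.1 _ _ (h _ _ (ihρ.1 _ _ hAB)), fun F G H h h' A B hAB => ?_⟩
    exact ihτ.2 _ _ _ (h A A (ihρ.2 _ _ _ hAB (ihρ.1 _ _ hAB))) (h' A B hAB)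

theorem Per.symm {σ : Ty} {A B : CSet M} (h : Per σ A B) : Per σ B A := (symm_trans σ).1 _ _ h

theorem Per.trans {σ : Ty} {A B C : CSet M} (h : Per σ A B) (h' : Per σ B C) : Per σ A C :=
  (symm_trans σ).2 _ _ _ h h'

theorem Per.left {σ : Ty} {A B : CSet M} (h : Per σ A B) : Per σ A A := h.trans h.symm

theorem Per.eq_of_nat {A B : CSet M} (h : Per .nat A B) : A = B := by
  obtain ⟨n, rfl, rfl⟩ := h
  rfl

theorem per_single (n : M.N) : Per .nat (single n) (single n) := ⟨n, rfl, rfl⟩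

/-- Quantifiers over enumerable sets become quantifiers over type 1 indices, so for each fixed type
the relation is definable in `M`. -/
theorem _root_.FiniteType.Struct.Def.per {Γ : Ctx} (σ : Ty) {S T : M.Env Γ → CSet M}
    (hS : DefSet S) (hT : DefSet T) : Def fun e => Per σ (S e) (T e) := by
  induction σ generalizing Γ with
  | nat => exact .exN (.and (.eqSet hS.weak (.single .var)) (.eqSet hT.weak (.single .var)))
  | arr ρ τ ihρ ihτ =>
    simp only [Per, ofIndex_surjective.forall]
    refine .all (hσ := varTy_one) (.all (hσ := varTy_one) (.imp (ihρ .index .index) (ihτ ?_ ?_)))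
    · exact .app hS.weak.weak .index
    · exact .app hT.weak.weak .index

/-- Addition in the graph algebra. -/
noncomputable def plus (M : Struct .second) [IsModel M] : CSet M :=
  lift₂ (M := M) (φ := fun p => fst p + snd p) (.add (.fst .id) (.snd .id))

/-- Multiplication in the graph algebra. -/
noncomputable def times (M : Struct .second) [IsModel M] : CSet M :=
  lift₂ (M := M) (φ := fun p => fst p * snd p) (.mul (.fst .id) (.snd .id))

/-- The successor function in the graph algebra. -/
noncomputable def next (M : Struct .second) [IsModel M] : CSet M :=
  lift (M := M) (φ := fun n => n + 1) (.add .id (.const 1))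

theorem plus_app (a b : M.N) : plus M ⋆ single a ⋆ single b = single (a + b) := by
  rw [plus, lift₂_app, fst_pair, snd_pair]

theorem times_app (a b : M.N) : times M ⋆ single a ⋆ single b = single (a * b) := by
  rw [times, lift₂_app, fst_pair, snd_pair]

theorem next_app (a : M.N) : next M ⋆ single a = single (a + 1) := lift_app _ a

theorem per_lift {φ : M.N → M.N} (hφ : Rec φ) : Per .one (lift hφ) (lift hφ) := by
  rintro _ _ ⟨a, rfl, rfl⟩
  rw [lift_app]
  exact per_single _

theorem per_lift₂ {φ : M.N → M.N} (hφ : Rec φ) : Per (.nat ⇾ .one) (lift₂ hφ) (lift₂ hφ) := by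
  rintro _ _ ⟨a, rfl, rfl⟩ _ _ ⟨b, rfl, rfl⟩
  rw [lift₂_app]
  exact per_single _

theorem per_K (ρ τ : Ty) : Per (ρ ⇾ τ ⇾ ρ) (K M) (K M) := by
  intro A A' hA B B' _
  rwa [K_app, K_app]

theorem per_S (δ ρ τ : Ty) : Per ((δ ⇾ ρ ⇾ τ) ⇾ (δ ⇾ ρ) ⇾ δ ⇾ τ) (S M) (S M) := by
  intro A A' hA B B' hB C C' hC
  rw [S_app, S_app]
  exact hA _ _ hC _ _ (hB _ _ hC)

/-- Induction in `M` on the first argument, legitimate because the relation at the fixed type `σ` is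
definable. -/
theorem per_R (σ : Ty) : Per (.nat ⇾ σ ⇾ (σ ⇾ .nat ⇾ σ) ⇾ σ) (R M) (R M) := by
  rintro _ _ ⟨n, rfl, rfl⟩ A A' hA B B' hB
  induction n using nat_ind with
  | hP =>
    exact .per σ (.app (.app (.app .const (.single .var)) .const) .const)
      (.app (.app (.app .const (.single .var)) .const) .const)
  | h₀ => rwa [R_zero, R_zero]
  | hs n ih =>
    rw [R_succ, R_succ]
    exact hB _ _ ih _ _ (per_single n)

end CSet

/-! ### The structures on the graph algebra and definability of satisfaction. -/

open CSet

/-- The graph algebra as a structure in which all types have the same objects. -/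
noncomputable def graph (M : Struct .second) [IsModel M] : Struct .omega where
  D _ := CSet M
  app := CSet.app
  zero := single 0
  succ := next M
  add := plus M
  mul := times M
  proj _ _ := K M
  comb _ _ _ := S M
  recursor _ _ := R M

/-- The structure of the hereditarily extensional objects of the graph algebra. -/
noncomputable def extModel (M : Struct .second) [IsModel M] : Struct .omega where
  D σ := {A : CSet M // Per σ A A}
  app F A := ⟨F.1 ⋆ A.1, F.2 _ _ A.2⟩
  zero := ⟨single 0, per_single 0⟩
  succ := ⟨next M, per_lift _⟩
  add := ⟨plus M, per_lift₂ _⟩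
  mul := ⟨times M, per_lift₂ _⟩
  proj ρ τ := ⟨K M, per_K ρ τ⟩
  comb δ ρ τ := ⟨S M, per_S δ ρ τ⟩
  recursor σ _ := ⟨R M, per_R σ⟩

/-- The assignment in the graph algebra that underlies an assignment of hereditarily extensional
objects. -/
def Env.raw {Γ : Ctx} (e : (extModel M).Env Γ) : (graph M).Env Γ := fun _ h x => (e h x).1

theorem Env.raw_cons {Γ : Ctx} {σ : Ty} (a : (extModel M).D σ) (e : (extModel M).Env Γ) :
    Env.raw (.cons a e) = .cons (M := graph M) a.1 (Env.raw e) := by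
  funext τ h x
  cases x <;> rfl

theorem eval_raw {Γ : Ctx} (e : (extModel M).Env Γ) {σ : Ty} (t : Term .omega Γ σ) :
    ((extModel M).eval e t).1 = (graph M).eval (Env.raw e) t := by
  induction t with
  | app s t ihs iht => exact congrArg₂ CSet.app ihs iht
  | _ => rfl

/-- Satisfaction in the graph algebra, with quantifiers restricted to hereditarily extensional
objects. -/
def SatExt : {Γ : Ctx} → (graph M).Env Γ → Formula .omega Γ → Prop
  | _, e, .eq s t => (graph M).eval e s = (graph M).eval e t
  | _, _, .bot => False
  | _, e, .and A B => SatExt e A ∧ SatExt e B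
  | _, e, .or A B => SatExt e A ∨ SatExt e B
  | _, e, .imp A B => SatExt e A → SatExt e B
  | _, e, .all σ _ A => ∀ a : CSet M, Per σ a a → SatExt (Env.cons (M := graph M) a e) A
  | _, e, .ex σ _ A => ∃ a : CSet M, Per σ a a ∧ SatExt (Env.cons (M := graph M) a e) A

/-- Trades the subtypes for relativised quantifiers over plain sets, a form in which definability
can be proved by induction on the formula. -/
theorem sat_iff_satExt {Γ : Ctx} (e : (extModel M).Env Γ) (A : Formula .omega Γ) :
    (extModel M).Sat e A ↔ SatExt (Env.raw e) A := by
  induction A with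
  | eq s t => exact Subtype.ext_iff.trans (by rw [eval_raw, eval_raw]; rfl)
  | bot => rfl
  | and A B ihA ihB => exact and_congr (ihA e) (ihB e)
  | or A B ihA ihB => exact or_congr (ihA e) (ihB e)
  | imp A B ihA ihB => exact imp_congr (ihA e) (ihB e)
  | all σ h A ih =>
    refine Subtype.forall.trans (forall_congr' fun a => forall_congr' fun ha => ?_)
    exact (ih _).trans (iff_of_eq (congrArg (SatExt · A) (Env.raw_cons _ _)))
  | ex σ h A ih =>
    refine Subtype.exists.trans (exists_congr fun a => ?_)
    rw [← exists_prop]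
    refine exists_congr fun ha => ?_
    exact (ih _).trans (iff_of_eq (congrArg (SatExt · A) (Env.raw_cons _ _)))

/-- Families of assignments in the graph algebra that are definable at each variable. -/
def DefEnv {Δ Γ : Ctx} (E : M.Env Δ → (graph M).Env Γ) : Prop :=
  ∀ ⦃σ : Ty⦄ (h : Fragment.omega.varTy σ) (x : Var Γ σ), DefSet fun e => E e h x

theorem DefEnv.eval {Δ Γ : Ctx} {E : M.Env Δ → (graph M).Env Γ} (hE : DefEnv E) {σ : Ty}
    (t : Term .omega Γ σ) : DefSet fun e => (graph M).eval (E e) t := by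
  induction t with
  | var h x => exact hE h x
  | app s t ihs iht => exact .app ihs iht
  | _ => exact .const

theorem DefEnv.cons {Δ Γ : Ctx} {E : M.Env Δ → (graph M).Env Γ} (hE : DefEnv E) {σ : Ty}
    {S : M.Env Δ → CSet M} (hS : DefSet S) :
    DefEnv fun e => Env.cons (M := graph M) (ρ := σ) (S e) (E e) := by
  intro τ h x
  cases x with
  | zero => exact hS
  | succ x => exact hE h x

theorem DefEnv.weak {Δ Γ : Ctx} {E : M.Env Δ → (graph M).Env Γ} (hE : DefEnv E) {σ : Ty} :
    DefEnv fun e : M.Env (σ :: Δ) => E fun _ h x => e h (.succ x) :=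
  fun _ h x => (hE h x).weak

/-- There is no uniform truth definition; the definition is produced formula by formula. This turns
the induction scheme of `M` into induction for all formulas of the full language. -/
theorem DefEnv.satExt {Δ Γ : Ctx} {E : M.Env Δ → (graph M).Env Γ} (hE : DefEnv E)
    (A : Formula .omega Γ) : Def fun e => SatExt (E e) A := by
  induction A generalizing Δ with
  | eq s t => exact .eqSet (hE.eval s) (hE.eval t)
  | bot => exact .bot
  | and A B ihA ihB => exact .and (ihA hE) (ihB hE)
  | or A B ihA ihB => exact .or (ihA hE) (ihB hE)
  | imp A B ihA ihB => exact .imp (ihA hE) (ihB hE)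
  | all σ h A ih =>
    simp only [SatExt, ofIndex_surjective.forall]
    exact .all (hσ := varTy_one) (.imp (.per σ .index .index) (ih (hE.weak.cons .index)))
  | ex σ h A ih =>
    simp only [SatExt, ofIndex_surjective.exists]
    exact .ex (hσ := varTy_one) (.and (.per σ .index .index) (ih (hE.weak.cons .index)))

end Struct

end FiniteType

namespace FiniteType

namespace Struct

variable {M : Struct .second} [hM : IsModel M]

open CSet

/-! ### The hereditarily extensional objects form a model of the higher order theory -/

/-- A number as an object of type `0`. -/
def num (n : M.N) : (extModel M).D .nat := ⟨single n, per_single n⟩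

theorem num_inj {m n : M.N} : num m = num n ↔ m = n := Subtype.ext_iff.trans single_inj

theorem exists_num (a : (extModel M).D .nat) : ∃ n, a = num n := by
  obtain ⟨A, n, h, -⟩ := a
  exact ⟨n, Subtype.ext h⟩

theorem zero_eq_num : (extModel M).zero = num 0 := rfl

theorem succ_num (n : M.N) : (extModel M).app (extModel M).succ (num n) = num (n + 1) :=
  Subtype.ext (next_app n)

theorem add_num (m n : M.N) :
    (extModel M).app ((extModel M).app (extModel M).add (num m)) (num n) = num (m + n) :=
  Subtype.ext (plus_app m n)

theorem mul_num (m n : M.N) :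
    (extModel M).app ((extModel M).app (extModel M).mul (num m)) (num n) = num (m * n) :=
  Subtype.ext (times_app m n)

section
variable {Γ : Ctx} (e : (extModel M).Env Γ)

/-- Higher type objects are not identified up to `Per`, so pointwise equality only compares values
at the same argument. Passing to a related argument uses that the value of `t` is itself
extensional. -/
theorem per_of_sat_eqAt (σ : Ty) (h : σ.ArgsIn .omega) (s t : Term .omega Γ σ)
    (hst : (extModel M).Sat e (.eqAt σ h s t)) :
    Per σ ((extModel M).eval e s).1 ((extModel M).eval e t).1 := by
  induction σ generalizing Γ with
  | nat =>
    have : (extModel M).eval e s = (extModel M).eval e t := hst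
    rw [this]
    exact ((extModel M).eval e t).2
  | arr ρ τ _ ih =>
    intro A B hAB
    have := ih (.cons ⟨A, hAB.left⟩ e) h.2 _ _ (hst ⟨A, hAB.left⟩)
    simp only [Struct.eval, Term.shift, eval_rename] at this
    exact this.trans (((extModel M).eval e t).2 _ _ hAB)

theorem eval_apps_eq {σ : Ty} (s t : Term .omega Γ σ) (u : Spine .omega Γ σ)
    (h : Per σ ((extModel M).eval e s).1 ((extModel M).eval e t).1) :
    (extModel M).eval e (s.apps u) = (extModel M).eval e (t.apps u) := by
  induction u with
  | nil => exact Subtype.ext h.eq_of_nat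
  | cons a u ih => exact ih _ _ (h _ _ ((extModel M).eval e a).2)

theorem eval_apps_eq_of_eq {σ : Ty} (s t : Term .omega Γ σ) (u : Spine .omega Γ σ)
    (h : ((extModel M).eval e s).1 = ((extModel M).eval e t).1) :
    (extModel M).eval e (s.apps u) = (extModel M).eval e (t.apps u) :=
  eval_apps_eq e s t u (h ▸ ((extModel M).eval e s).2)

theorem sat_induction (A : Formula .omega (.nat :: Γ)) (h₀ : (extModel M).Sat (.cons (num 0) e) A)
    (hs : ∀ n, (extModel M).Sat (.cons (num n) e) A → (extModel M).Sat (.cons (num (n + 1)) e) A)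
    (n : M.N) : (extModel M).Sat (.cons (num n) e) A := by
  induction n using nat_ind with
  | hP =>
    -- The sets assigned by `e` are fixed parameters; only the number varies.
    have hE : DefEnv fun _ : M.Env [.nat] => Env.raw e := fun _ _ _ => .const
    refine ((hE.cons (.single (.var (h := varTy_nat) (x := .zero)))).satExt A).congr fun e' => ?_
    exact (sat_iff_satExt _ _).trans (iff_of_eq (congrArg (SatExt · A) (Env.raw_cons _ _)))
  | h₀ => exact h₀
  | hs n ih => exact hs n ih

theorem sat_of_eha (A : Formula .omega Γ) (h : EHA .omega Γ A) : (extModel M).Sat e A := by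
  have hn : ∀ t : Term .omega Γ .nat, ∃ n, (extModel M).eval e t = num n := fun t => exists_num _
  cases h with
  | eq_refl t => rfl
  | eq_symm s t => exact Eq.symm
  | eq_trans s t u => exact Eq.trans
  | succ_ne_zero t =>
    obtain ⟨n, hn⟩ := hn t
    simp only [Sat, Struct.eval, hn, succ_num, zero_eq_num, num_inj]
    exact add_one_ne_zero' n
  | succ_inj s t =>
    obtain ⟨m, hm⟩ := hn s
    obtain ⟨n, hn⟩ := hn t
    simp only [Sat, Struct.eval, hm, hn, succ_num, num_inj]
    exact add_one_inj
  | add_zero s =>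
    obtain ⟨m, hm⟩ := hn s
    simp only [Sat, Struct.eval, hm, zero_eq_num, add_num, _root_.add_zero]
  | add_succ s t =>
    obtain ⟨m, hm⟩ := hn s
    obtain ⟨n, hn⟩ := hn t
    simp only [Sat, Struct.eval, hm, hn, succ_num, add_num, add_assoc]
  | mul_zero s =>
    obtain ⟨m, hm⟩ := hn s
    simp only [Sat, Struct.eval, hm, zero_eq_num, mul_num, MulZeroClass.mul_zero]
  | mul_succ s t =>
    obtain ⟨m, hm⟩ := hn s
    obtain ⟨n, hn⟩ := hn t
    simp only [Sat, Struct.eval, hm, hn, succ_num, add_num, mul_num, mul_add_one]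
  | ext h x y z u =>
    exact fun hxy => eval_apps_eq e _ _ u
      (((extModel M).eval e z).2 _ _ (per_of_sat_eqAt e _ h x y hxy))
  | proj x y u => exact eval_apps_eq_of_eq e _ _ u (K_app _ _)
  | comb x y z u => exact eval_apps_eq_of_eq e _ _ u (S_app _ _ _)
  | rec_zero h y z u => exact eval_apps_eq_of_eq e _ _ u (R_zero _ _)
  | rec_succ h n y z u =>
    refine eval_apps_eq_of_eq e _ _ u ?_
    obtain ⟨n, hn⟩ := hn n
    simp only [Struct.eval, hn, succ_num]
    exact R_succ n _ _
  | induction A =>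
    intro h₀ hs a
    obtain ⟨n, rfl⟩ := exists_num a
    refine sat_induction e A ((sat_inst _ _ _).1 h₀) (fun n hn => ?_) n
    have := (sat_subst _ _ _).1 (hs (num n) hn)
    convert this using 1
    funext σ h x
    cases x with
    | zero => exact (succ_num n).symm
    | succ x => rfl

end

theorem per_eval {Γ : Ctx} {e e' : (extModel M).Env Γ}
    (he : ∀ ⦃σ : Ty⦄ (h : Fragment.omega.varTy σ) (x : Var Γ σ), Per σ (e h x).1 (e' h x).1) {σ : Ty}
    (t : Term .omega Γ σ) : Per σ ((extModel M).eval e t).1 ((extModel M).eval e' t).1 := by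
  induction t with
  | var h x => exact he h x
  | app s t ihs iht => exact ihs _ _ iht
  | _ => exact Subtype.prop (p := fun A => Per _ A A) _

/-- Formulas compare only numbers, hence cannot distinguish extensionally equal assignments. The
extensionality of the choice functional rests on this. -/
theorem sat_congr {Γ : Ctx} {e e' : (extModel M).Env Γ}
    (he : ∀ ⦃σ : Ty⦄ (h : Fragment.omega.varTy σ) (x : Var Γ σ), Per σ (e h x).1 (e' h x).1)
    (A : Formula .omega Γ) : (extModel M).Sat e A ↔ (extModel M).Sat e' A := by
  have cons : ∀ {Γ : Ctx} {σ : Ty} {e e' : (extModel M).Env Γ},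
      (∀ ⦃σ : Ty⦄ (h : Fragment.omega.varTy σ) (x : Var Γ σ), Per σ (e h x).1 (e' h x).1) →
      ∀ (a : (extModel M).D σ) ⦃τ : Ty⦄ (h : Fragment.omega.varTy τ) (x : Var (σ :: Γ) τ),
        Per τ (Env.cons a e h x).1 (Env.cons a e' h x).1 := by
    intro Γ σ e e' he a τ h x
    cases x with
    | zero => exact a.2
    | succ x => exact he h x
  induction A with
  | eq s t =>
    have hs := Subtype.ext (per_eval he s).eq_of_nat
    have ht := Subtype.ext (per_eval he t).eq_of_nat
    change _ = _ ↔ _ = _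
    rw [hs, ht]
  | bot => rfl
  | and A B ihA ihB => exact and_congr (ihA he) (ihB he)
  | or A B ihA ihB => exact or_congr (ihA he) (ihB he)
  | imp A B ihA ihB => exact imp_congr (ihA he) (ihB he)
  | all σ h A ih => exact forall_congr' fun a => ih (cons he a)
  | ex σ h A ih => exact exists_congr fun a => ih (cons he a)

/-! ### Quantifier-free choice -/

/-- Binary operations on the graph algebra that are represented by an element. -/
def Rep₂ (f : CSet M → CSet M → CSet M) : Prop := ∃ C : CSet M, ∀ X Y, C ⋆ X ⋆ Y = f X Y

theorem Rep₂.fst : Rep₂ fun X _ : CSet M => X := ⟨K M, K_app⟩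

theorem Rep₂.snd : Rep₂ fun _ Y : CSet M => Y :=
  ⟨ofCL (.abs (.abs (.var 0))), fun X Y => by simp only [ofCL, CL.eval_abs, CL.eval, CL.push]⟩

theorem Rep₂.const (A : CSet M) : Rep₂ fun _ _ : CSet M => A :=
  ⟨ofCL (.abs (.abs (.const A))), fun X Y => by simp only [ofCL, CL.eval_abs, CL.eval]⟩

theorem Rep₂.app {f g : CSet M → CSet M → CSet M} (hf : Rep₂ f) (hg : Rep₂ g) :
    Rep₂ fun X Y => f X Y ⋆ g X Y := by
  obtain ⟨C, hC⟩ := hf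
  obtain ⟨D, hD⟩ := hg
  refine ⟨ofCL (.abs (.abs (.app (.app (.app (.const C) (.var 1)) (.var 0))
    (.app (.app (.const D) (.var 1)) (.var 0))))), fun X Y => ?_⟩
  simp only [ofCL, CL.eval_abs, CL.eval, CL.push, hC, hD]

section
variable {Γ : Ctx} (e : (extModel M).Env Γ)

theorem rep₂_eval {ρ τ σ : Ty} (t : Term .omega (τ :: ρ :: Γ) σ) : Rep₂ fun X Y : CSet M =>
    (graph M).eval (.cons (M := graph M) Y (.cons (M := graph M) X (Env.raw e))) t := by
  induction t with
  | var h x =>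
    match x with
    | .zero => exact .snd
    | .succ .zero => exact .fst
    | .succ (.succ x) => exact .const _
  | app s t ihs iht => exact ihs.app iht
  | _ => exact .const _

/-- The value 0 stands for truth: equality becomes `|a - b|`, conjunction a sum, disjunction a
product, and implication `(1 - a) * b`. On extensional arguments the value is always a number. -/
theorem exists_characteristic {ρ τ : Ty} (A : Formula .omega (τ :: ρ :: Γ)) (hA : A.QF) :
    ∃ C : CSet M, ∀ (x : (extModel M).D ρ) (y : (extModel M).D τ), ∃ v,
      C ⋆ x.1 ⋆ y.1 = single v ∧ (v = 0 ↔ (extModel M).Sat (.cons y (.cons x e)) A) := by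
  have binary : ∀ {φ : M.N → M.N} (hφ : Rec φ) (f g : CSet M → CSet M → CSet M), Rep₂ f → Rep₂ g →
      ∃ C : CSet M, ∀ X Y a b, f X Y = single a → g X Y = single b →
        C ⋆ X ⋆ Y = single (φ (pair a b)) := by
    intro φ hφ f g hf hg
    obtain ⟨C, hC⟩ := ((Rep₂.const (lift₂ hφ)).app hf).app hg
    exact ⟨C, fun X Y a b ha hb => by simp only [hC, ha, hb, lift₂_app]⟩
  match A, hA with
  | .eq s t, _ =>
    obtain ⟨C, hC⟩ := binary (φ := fun p => (fst p - snd p) + (snd p - fst p))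
      (.add (.sub (.fst .id) (.snd .id)) (.sub (.snd .id) (.fst .id))) _ _
      (rep₂_eval e s) (rep₂_eval e t)
    refine ⟨C, fun x y => ?_⟩
    obtain ⟨a, ha⟩ := exists_num ((extModel M).eval (.cons y (.cons x e)) s)
    obtain ⟨b, hb⟩ := exists_num ((extModel M).eval (.cons y (.cons x e)) t)
    have key : ∀ (u : Term .omega (τ :: ρ :: Γ) .nat) (c : M.N),
        (extModel M).eval (.cons y (.cons x e)) u = num c →
        (graph M).eval (.cons (M := graph M) y.1 (.cons (M := graph M) x.1 (Env.raw e))) u =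
          single c := by
      intro u c h
      rw [← Env.raw_cons, ← Env.raw_cons, ← eval_raw, h]
      rfl
    refine ⟨_, hC _ _ a b (key s a ha) (key t b hb), ?_⟩
    rw [fst_pair, snd_pair, Sat, ha, hb, num_inj, add_eq_zero, tsub_eq_zero_iff_le,
      tsub_eq_zero_iff_le]
    exact le_antisymm_iff.symm
  | .bot, _ =>
    obtain ⟨C, hC⟩ := Rep₂.const (M := M) (single 1)
    exact ⟨C, fun x y => ⟨1, hC _ _, iff_of_false one_ne_zero id⟩⟩
  | .and A B, hA =>
    obtain ⟨C, hC⟩ := exists_characteristic A hA.1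
    obtain ⟨D, hD⟩ := exists_characteristic B hA.2
    obtain ⟨E, hE⟩ := binary (φ := fun p => fst p + snd p) (.add (.fst .id) (.snd .id)) _ _
      ⟨C, fun _ _ => rfl⟩ ⟨D, fun _ _ => rfl⟩
    refine ⟨E, fun x y => ?_⟩
    obtain ⟨a, ha, ha'⟩ := hC x y
    obtain ⟨b, hb, hb'⟩ := hD x y
    refine ⟨_, hE _ _ a b ha hb, ?_⟩
    rw [fst_pair, snd_pair, add_eq_zero, ha', hb', Sat]
  | .or A B, hA =>
    obtain ⟨C, hC⟩ := exists_characteristic A hA.1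
    obtain ⟨D, hD⟩ := exists_characteristic B hA.2
    obtain ⟨E, hE⟩ := binary (φ := fun p => fst p * snd p) (.mul (.fst .id) (.snd .id)) _ _
      ⟨C, fun _ _ => rfl⟩ ⟨D, fun _ _ => rfl⟩
    refine ⟨E, fun x y => ?_⟩
    obtain ⟨a, ha, ha'⟩ := hC x y
    obtain ⟨b, hb, hb'⟩ := hD x y
    refine ⟨_, hE _ _ a b ha hb, ?_⟩
    rw [fst_pair, snd_pair, mul_eq_zero, ha', hb', Sat]
  | .imp A B, hA =>
    obtain ⟨C, hC⟩ := exists_characteristic A hA.1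
    obtain ⟨D, hD⟩ := exists_characteristic B hA.2
    obtain ⟨E, hE⟩ := binary (φ := fun p => (1 - fst p) * snd p)
      (.mul (.sub (.const 1) (.fst .id)) (.snd .id)) _ _ ⟨C, fun _ _ => rfl⟩ ⟨D, fun _ _ => rfl⟩
    refine ⟨E, fun x y => ?_⟩
    obtain ⟨a, ha, ha'⟩ := hC x y
    obtain ⟨b, hb, hb'⟩ := hD x y
    refine ⟨_, hE _ _ a b ha hb, ?_⟩
    rw [fst_pair, snd_pair, mul_eq_zero, Sat, ← ha', ← hb', tsub_eq_zero_iff_le]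
    rcases eq_zero_or_succ a with rfl | ⟨a, rfl⟩
    · simp
    · exact iff_of_true (.inl le_add_self) fun h => absurd h (add_one_ne_zero' a)

theorem search_eq {U G : CSet M} {n : M.N} (hU : ∀ G n,
      (G ⋆ single n = single 0 → U ⋆ G ⋆ single n = single n) ∧
      ∀ m, G ⋆ single n = single (m + 1) → U ⋆ G ⋆ single n = U ⋆ G ⋆ single (n + 1))
    (hG : ∀ n, ∃ v, G ⋆ single n = single v) (hn : G ⋆ single n = single 0)
    (hlt : ∀ k < n, G ⋆ single k ≠ single 0) : U ⋆ G ⋆ single 0 = single n := by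
  -- Induction on the distance `j` from `k` to the least zero `n`.
  have : ∀ j k : M.N, k + j = n → U ⋆ G ⋆ single k = single n := by
    refine nat_ind (.allN (.imp (.eq (.add .var .var) .const)
      (.eqSet (.app .const (.single .var)) .const))) ?_ ?_
    · intro k hk
      rw [add_zero] at hk
      rw [hk]
      exact (hU G n).1 hn
    · intro j ih k hk
      have hkn : k < n := by
        rw [← hk, ← add_one_le_iff']
        exact add_le_add_right le_add_self k
      obtain ⟨v, hv⟩ := hG k
      rcases eq_zero_or_succ v with rfl | ⟨v, rfl⟩
      · exact absurd hv (hlt k hkn)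
      · rw [(hU G k).2 v hv]
        exact ih _ (by rw [← hk]; ring)
  exact this n 0 (zero_add n)

/-- The functional searches from 0 for a zero of the characteristic element. Taking the least
witness matters: it depends only on the extensional class of the argument, whereas an arbitrary
witness need not. -/
theorem sat_choice {A : Formula .omega (.nat :: .one :: Γ)} (hA : A.QF)
    (h : ∀ x, ∃ y, (extModel M).Sat (.cons y (.cons x e)) A) :
    ∃ Y : (extModel M).D (.one ⇾ .nat), ∀ x,
      (extModel M).Sat (.cons ((extModel M).app Y x) (.cons x e)) A := by
  obtain ⟨C, hC⟩ := exists_characteristic e A hA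
  obtain ⟨U, hU⟩ := exists_search (M := M)
  have hC' : ∀ (x : (extModel M).D .one) (n : M.N), ∃ v, C ⋆ x.1 ⋆ single n = single v ∧
      (v = 0 ↔ (extModel M).Sat (.cons (num n) (.cons x e)) A) := fun x n => hC x (num n)
  have hiff : ∀ (x : (extModel M).D .one) (n : M.N), C ⋆ x.1 ⋆ single n = single 0 ↔
      (extModel M).Sat (.cons (num n) (.cons x e)) A := fun x n => by
    obtain ⟨v, hv, hv'⟩ := hC' x n
    rw [hv, single_inj, hv']
  have hleast : ∀ x : (extModel M).D .one, ∃ n,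
      (extModel M).Sat (.cons (num n) (.cons x e)) A ∧
      ∀ k < n, ¬ (extModel M).Sat (.cons (num k) (.cons x e)) A := fun x => by
    obtain ⟨y, hy⟩ := h x
    obtain ⟨n, rfl⟩ := exists_num y
    -- The least number principle applies because the matrix is equivalent to an equation between
    -- sets that is definable in `M`.
    refine exists_least ((Def.eqSet (S := fun e => C ⋆ x.1 ⋆ single (e varTy_nat .zero))
      (.app .const (.single .var)) .const).congr fun e' => (hiff x _).symm) hy
  let Y : CSet M := ofCL (.abs (.app (.app (.const U) (.app (.const C) (.var 0)))
    (.const (single 0))))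
  have hY : ∀ (x : (extModel M).D .one) (n : M.N), (extModel M).Sat (.cons (num n) (.cons x e)) A →
      (∀ k < n, ¬ (extModel M).Sat (.cons (num k) (.cons x e)) A) → Y ⋆ x.1 = single n := by
    intro x n hn hlt
    have : Y ⋆ x.1 = U ⋆ (C ⋆ x.1) ⋆ single 0 := by
      simp only [Y, ofCL, CL.eval_abs, CL.eval, CL.push]
    rw [this]
    exact search_eq hU (fun n => (hC' x n).imp fun _ h => h.1) ((hiff x n).2 hn)
      fun k hk h => hlt k hk ((hiff x k).1 h)
  -- Related arguments satisfy the same instances of `A`, hence have the same least witness.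
  have hYY : Per (.one ⇾ .nat) Y Y := by
    intro X X' hX
    let x : (extModel M).D .one := ⟨X, hX.left⟩
    let x' : (extModel M).D .one := ⟨X', hX.symm.left⟩
    have hxx' : ∀ n, (extModel M).Sat (.cons (num n) (.cons x e)) A ↔
        (extModel M).Sat (.cons (num n) (.cons x' e)) A := fun n => by
      refine sat_congr (fun σ h z => ?_) A
      match z with
      | .zero => exact per_single n
      | .succ .zero => exact hX
      | .succ (.succ z) => exact (e h z).2
    obtain ⟨n, hn, hlt⟩ := hleast x
    exact ⟨n, hY x n hn hlt, hY x' n ((hxx' n).1 hn) fun k hk h => hlt k hk ((hxx' k).2 h)⟩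
  refine ⟨⟨Y, hYY⟩, fun x => ?_⟩
  obtain ⟨n, hn, hlt⟩ := hleast x
  have : (extModel M).app ⟨Y, hYY⟩ x = num n := Subtype.ext (hY x n hn hlt)
  rwa [this]

theorem sat_of_RCAomega (A : Formula .omega Γ) (h : A ∈ RCAomega Γ) : (extModel M).Sat e A := by
  rcases h with h | h | h
  · exact sat_of_eha e A h
  · obtain ⟨hρ, hτ, hY, A, hA⟩ := h
    intro h
    obtain ⟨Y, h⟩ := sat_choice e hA h
    refine ⟨Y, fun x => (sat_subst _ _ _).2 ?_⟩
    convert h x using 1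
    funext σ hσ z
    match z with
    | .zero => rfl
    | .succ .zero => rfl
    | .succ (.succ z) => rfl
  · cases h
    exact Classical.em _

end

end Struct

end FiniteType

namespace FiniteType

namespace Struct

variable {M : Struct .second} [hM : IsModel M]

open CSet

/-! ### Transfer of second order sentences -/

/-- The logical relation between a model and its graph algebra. -/
def Rel : (σ : Ty) → M.D σ → CSet M → Prop
  | .nat, a, A => A = single a
  | .arr ρ τ, f, F => ∀ a A, Rel ρ a A → Rel τ (M.app f a) (F ⋆ A)

theorem rel_recursor (σ : Ty) (h : Fragment.second.recTy σ) : Rel _ (M.recursor σ h) (R M) := by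
  obtain rfl : σ = .nat := h
  rintro n _ rfl y _ rfl z Z hz
  change R M ⋆ single n ⋆ single y ⋆ Z = single (recN n y z)
  have hrec : Rec fun n => recN n y z := .recN .id (.const y) (.const z)
  induction n using nat_ind with
  | hP =>
    exact .eqSet (.app (.app (.app .const (.single .var)) .const) .const) (.single (.rec hrec .var))
  | h₀ => rw [R_zero, recN_zero]
  | hs n ih =>
    rw [R_succ, ih, recN_succ]
    exact hz _ _ rfl _ _ rfl

/-- The fundamental lemma of the logical relation. Closed terms of arbitrary type occur inside
second order sentences, so the relation is needed at all types although variables have only types 0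
and 1. -/
theorem rel_eval {Γ : Ctx} {e : M.Env Γ} {e' : (graph M).Env Γ}
    (he : ∀ ⦃σ : Ty⦄ (h : Fragment.second.varTy σ) (x : Var Γ σ), Rel σ (e h x) (e' trivial x))
    {σ : Ty} (t : Term .second Γ σ) : Rel σ (M.eval e t) ((graph M).eval e' t.toOmega) := by
  induction t with
  | var h x => exact he h x
  | zero => rfl
  | succ =>
    rintro a _ rfl
    exact (next_app a).trans (congrArg single (succ_eq a).symm)
  | add =>
    rintro a _ rfl b _ rfl
    exact plus_app a b
  | mul =>
    rintro a _ rfl b _ rfl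
    exact times_app a b
  | proj ρ τ =>
    intro a A hA b B _
    change Rel ρ (M.app (M.app (M.proj ρ τ) a) b) (K M ⋆ A ⋆ B)
    rwa [hM.proj_eq, K_app]
  | comb δ ρ τ =>
    intro a A hA b B hB c C hC
    change Rel τ (M.app (M.app (M.app (M.comb δ ρ τ) a) b) c) (S M ⋆ A ⋆ B ⋆ C)
    rw [hM.comb_eq, S_app]
    exact hA _ _ hC _ _ (hB _ _ hC)
  | recursor σ h => exact rel_recursor σ h
  | app s t ihs iht => exact ihs _ _ iht

theorem exists_rel_right {σ : Ty} (h : Fragment.second.varTy σ) (a : M.D σ) :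
    ∃ b : (extModel M).D σ, Rel σ a b.1 := by
  rcases h with rfl | rfl
  · exact ⟨num a, rfl⟩
  · refine ⟨⟨lift (.of a), per_lift _⟩, ?_⟩
    rintro n _ rfl
    exact lift_app (.of a) n

/-- At type 1 the relation `m ∈ B ⋆ single n` is enumerable and functional in `n`. Quantifier-free
choice in `M` picks a value together with a witness of its enumeration, and the first component is
the required function. -/
theorem exists_rel_left {σ : Ty} (h : Fragment.second.varTy σ) (b : (extModel M).D σ) :
    ∃ a : M.D σ, Rel σ a b.1 := by
  rcases h with rfl | rfl
  · obtain ⟨n, rfl⟩ := exists_num b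
    exact ⟨n, rfl⟩
  · obtain ⟨B, hB⟩ := b
    obtain ⟨ψ, hψ, hB'⟩ := CEFam.image (.const B.2) (.singleton (M := M) .id)
    have mem : ∀ n m k, ψ (pair (pair n m) k) = 0 → m ∈ B ⋆ single n := fun n m k hk => by
      have := (hB' (pair n m)).2 ⟨k, hk⟩
      rwa [Set.mem_ofPred_eq, fst_pair, snd_pair] at this
    have hval : ∀ n, ∃ m, B ⋆ single n = single m := fun n => by
      obtain ⟨m, hm, -⟩ := hB _ _ (per_single n)
      exact ⟨m, hm⟩
    obtain ⟨φ, hφ, h⟩ := exists_rec_choice (φ := fun q => ψ (pair (pair (fst q) (fst (snd q)))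
      (snd (snd q)))) (hψ.comp (.pair (.pair (.fst .id) (.fst (.snd .id))) (.snd (.snd .id))))
      fun n => by
        obtain ⟨m, hm⟩ := hval n
        have : pair n m ∈ {q | snd q ∈ image B.1 {fst q}} := by
          rw [Set.mem_ofPred_eq, fst_pair, snd_pair]
          change m ∈ B ⋆ single n
          rw [hm]
          exact mem_single.2 rfl
        obtain ⟨k, hk⟩ := (hB' _).1 this
        -- `m` is the value and `k` the witness that it is enumerated.
        refine ⟨pair m k, ?_⟩
        simpa only [fst_pair, snd_pair] using hk
    obtain ⟨f, hf⟩ : Rec fun n => fst (φ n) := .fst hφ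
    refine ⟨f, ?_⟩
    rintro n _ rfl
    have hn := h n
    simp only [fst_pair, snd_pair] at hn
    have hn := mem _ _ _ hn
    change B ⋆ single n = single (M.app f n)
    obtain ⟨m, hm⟩ := hval n
    rw [hm, mem_single] at hn
    rw [hm, hf, ← hn]

/-- Quantifiers of the second order fragment concern types 0 and 1 only, and there `Rel` is total in
both directions, so each quantifier transfers. -/
theorem sat_toOmega {Γ : Ctx} {e : M.Env Γ} {e' : (extModel M).Env Γ}
    (he : ∀ ⦃σ : Ty⦄ (h : Fragment.second.varTy σ) (x : Var Γ σ), Rel σ (e h x) (e' trivial x).1)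
    (A : Formula .second Γ) : M.Sat e A ↔ (extModel M).Sat e' A.toOmega := by
  have cons : ∀ {Γ : Ctx} {σ : Ty} {e : M.Env Γ} {e' : (extModel M).Env Γ} {a : M.D σ}
      {b : (extModel M).D σ}, Rel σ a b.1 →
      (∀ ⦃σ : Ty⦄ (h : Fragment.second.varTy σ) (x : Var Γ σ), Rel σ (e h x) (e' trivial x).1) →
      ∀ ⦃τ : Ty⦄ (h : Fragment.second.varTy τ) (x : Var (σ :: Γ) τ),
        Rel τ (Env.cons a e h x) (Env.cons b e' trivial x).1 := by
    intro Γ σ e e' a b hab he τ h x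
    cases x with
    | zero => exact hab
    | succ x => exact he h x
  induction A with
  | eq s t =>
    have key := fun u : Term .second _ .nat =>
      (eval_raw e' u.toOmega).trans (rel_eval (e' := Env.raw e') he u)
    refine Iff.trans ?_ Subtype.ext_iff.symm
    rw [key s, key t, single_inj]
    rfl
  | bot => rfl
  | and A B ihA ihB => exact and_congr (ihA he) (ihB he)
  | or A B ihA ihB => exact or_congr (ihA he) (ihB he)
  | imp A B ihA ihB => exact imp_congr (ihA he) (ihB he)
  | all σ h A ih =>
    constructor
    · intro H b
      obtain ⟨a, hab⟩ := exists_rel_left h b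
      exact (ih (cons hab he)).1 (H a)
    · intro H a
      obtain ⟨b, hab⟩ := exists_rel_right h a
      exact (ih (cons hab he)).2 (H b)
  | ex σ h A ih =>
    constructor
    · rintro ⟨a, H⟩
      obtain ⟨b, hab⟩ := exists_rel_right h a
      exact ⟨b, (ih (cons hab he)).1 H⟩
    · rintro ⟨b, H⟩
      obtain ⟨a, hab⟩ := exists_rel_left h b
      exact ⟨a, (ih (cons hab he)).2 H⟩

end Struct

end FiniteType

theorem mainTheorem6 (Φ : FiniteType.Sentence FiniteType.Fragment.second)
    (hΦ : FiniteType.Provable FiniteType.RCAomega Φ.toOmega) :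
    FiniteType.Provable FiniteType.RCA Φ := by
  by_contra h
  obtain ⟨M, hM, e, he⟩ := FiniteType.exists_model_of_not_provable Φ h
  refine he ((FiniteType.Struct.sat_toOmega
    (e' := fun _ _ x => (FiniteType.Henkin.noVar x).elim)
    (fun _ _ x => (FiniteType.Henkin.noVar x).elim) Φ).2 ?_)
  exact FiniteType.Struct.sat_of_derives
    (fun _ A hA e => FiniteType.Struct.sat_of_RCAomega e A hA) hΦ _ (fun B hB => by cases hB)
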